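/- Let $G$ be a locally compact second countable Hausdorff group and let $\mathcal H$ be a separable real affine Hilbert space with tangent space $\mathcal H^0$. Let $\alpha : G \curvearrowright \mathcal H$ be an affine isometric action, i.e. a homomorphism from $G$ to the group of affine isometries of $\mathcal H$ such that $g\mapsto \alpha_g(x)$ is continuous for every $x\in\mathcal H$, and let $\alpha^0 : G \to \mathcal O(\mathcal H^0)$ be its linear part. A Gaussian density of $\mathcal H$ is a family $(\mu_x)_{x\in\mathcal H}$ of mutually equivalent probability measures on a standard Borel space $\widehat{\mathcal H}$ for which there is a linear map $f\mapsto\widehat f$ from the continuous affine functions $f:\mathcal H\to\mathbf R$ to $L^0(\widehat{\mathcal H},\mathbf R)$ such that $\widehat f$ has law $\mathcal N(f(x),\|f^0\|^2)$ under $\mu_x$ for all $x$ and $f$ (where $f^0$ is the linear part of $f$) and such that the $\widehat f$ generate the $\sigma$-algebra up to null sets. The Gaussian action $\widehat\alpha : G\curvearrowright\widehat{\mathcal H}$ is a nonsingular action (a continuous homomorphism to the group of nonsingular automorphisms, taken modulo null sets) with $(\widehat\alpha_g)_*\mu_x=\mu_{\alpha_g(x)}$ for all $g\in G$, $x\in\mathcal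 H$. All measures on $\widehat{\mathcal H}$ are understood to be absolutely continuous with respect to the $\mu_x$, and a measure is called faithful if it is equivalent to them. A Gaussian density of $\mathcal H$ with a Gaussian action of $\alpha$ exists, and for every such pair the following hold. (i) $\widehat\alpha$ admits an invariant probability measure (not necessarily faithful) if and only if $\alpha$ has a fixed point. (ii) $\widehat\alpha$ is of zero-type (its Koopman representation $\pi$ on $L^2(\widehat{\mathcal H})$ is mixing: $\langle\pi(g)\xi,\eta\rangle\to0$ as $g\to\infty$ for all $\xi,\eta$) if and only if $\alpha$ is proper ($\|\alpha_g(x)-x\|\to\infty$ as $g\to\infty$ for every $x\in\mathcal H$). (iii) If $\alpha$ has almost fixed points (there is a sequence $(x_n)$ in $\mathcal H$ with $\|\alpha_g(x_n)-x_n\|\to0$ uniformly on compact subsets of $G$), then $\widehat\alpha$ has almost vanishing entropy (for every $\varepsilon>0$ and compact $K\subset G$ there is a faithful probability measure $\eta$ with $-\int\log\frac{d(g_*\eta)}{d\eta}\,d\eta\le\varepsilon$ for all $g\in K$), and $\widehat\alpha$ has an invariant mean (a $G$-invariant state on $L^\infty(\widehat{\mathcal H})$). (iv) If $\alpha^0$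 has stable spectral gap (for every continuous orthogonal representation $\rho$ of $G$ on a separable real Hilbert space, $\alpha^0\otimes\rho$ has no almost invariant vectors, i.e. it is not true that for every compact $K\subset G$ and $\varepsilon>0$ there is a unit vector moved by less than $\varepsilon$ by every element of $K$) and $\alpha$ has no fixed point, then $\widehat\alpha$ has no invariant mean. -/

import Mathlib

open MeasureTheory ProbabilityTheory Filter Topology
open scoped ENNReal NNReal TensorProduct

universe u v w z

noncomputable section

namespace GaussianDictionary

/-! ### Nonsingular actions -/

/-- A nonsingular action of a topological group `G` on the nonsingular space given by the
measurable space `X` and the measure class of `m`: a continuous homomorphism from `G` to the group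
of nonsingular automorphisms of `X`, two of which are identified when they agree almost everywhere.
Each `g` is a map that pulls null sets back to null sets, the group law holds almost everywhere
(so every `g` is invertible up to null sets), and `g_* η → η` in total variation norm as `g → 1`
for every probability measure `η` absolutely continuous with respect to `m`. -/
structure NonsingularAction (G : Type v) [Group G] [TopologicalSpace G]
    (X : Type z) [MeasurableSpace X] (m : Measure X) where
  /-- the underlying family of maps -/
  act : G → X → X
  quasiMeasurePreserving : ∀ g, Measure.QuasiMeasurePreserving (act g) m m
  act_one : act 1 =ᵐ[m] id
  act_mul : ∀ g h, act (g * h) =ᵐ[m] act g ∘ act h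
  tendsto_totalVariation : ∀ (η : Measure X) [IsProbabilityMeasure η], η ≪ m →
    Tendsto (fun g => ((η.map (act g)).toSignedMeasure - η.toSignedMeasure).totalVariation
      Set.univ) (𝓝 1) (𝓝 0)

section Nonsingular

variable {G : Type v} [Group G] [TopologicalSpace G] {X : Type z} [MeasurableSpace X]
  {m : Measure X}

/-- There is an invariant probability measure on the nonsingular space, that is, one that is
absolutely continuous with respect to `m` (but perhaps not equivalent to `m`). -/
def HasInvariantProbability (σ : NonsingularAction G X m) : Prop :=
  ∃ η : Measure X, IsProbabilityMeasure η ∧ η ≪ m ∧ ∀ g, η.map (σ.act g) = η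

/-- The Koopman representation on real functions, in the trivialization
`f ↦ f m^{1/2}` of half-densities:
`(π(g) f)(x) = (d(g_* m)/dm (x))^{1/2} f(g⁻¹ x)`. -/
def koopman (σ : NonsingularAction G X m) (g : G) (f : X → ℝ) (x : X) : ℝ :=
  √((m.map (σ.act g)).rnDeriv m x).toReal * f (σ.act g⁻¹ x)

/-- The action is of zero-type: its Koopman representation on `L²(X, m)` is mixing, i.e.
`⟨π(g) ξ, η⟩ → 0` as `g → ∞` for all `ξ, η ∈ L²(X, m)`. -/
def IsZeroType (σ : NonsingularAction G X m) : Prop :=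
  ∀ ξ η : Lp ℝ 2 m,
    Tendsto (fun g => ∫ x, koopman σ g ξ x * η x ∂m) (cocompact G) (𝓝 0)

/-- The relative entropy `H(μ | ν) = -∫ log (dμ/dν) dν = ∫ log (dν/dμ) dν` of two equivalent
probability measures, with values in `[0, ∞]`. -/
def relEntropy (μ ν : Measure X) : ℝ≥0∞ := InformationTheory.klDiv ν μ

/-- Almost vanishing entropy: for every `ε > 0` and every compact `K ⊆ G` there is a probability
measure `η` in the measure class of `m` such that `H(g_* η | η) ≤ ε` for all `g ∈ K`. -/
def HasAlmostVanishingEntropy (σ : NonsingularAction G X m) : Prop :=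
  ∀ ε : ℝ, 0 < ε → ∀ K : Set G, IsCompact K →
    ∃ η : Measure X, IsProbabilityMeasure η ∧ η ≪ m ∧ m ≪ η ∧
      ∀ g ∈ K, relEntropy (η.map (σ.act g)) η ≤ ENNReal.ofReal ε

/-- There is an invariant mean: a state `φ` on `L^∞(X, m)` such that `φ(f ∘ g) = φ(f)` for all
`f ∈ L^∞(X, m)` and `g ∈ G`. -/
def HasInvariantMean (σ : NonsingularAction G X m) : Prop :=
  ∃ φ : Lp ℝ ∞ m →L[ℝ] ℝ,
    (∀ f : Lp ℝ ∞ m, 0 ≤ f → 0 ≤ φ f) ∧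
    (∀ f : Lp ℝ ∞ m, (f =ᵐ[m] fun _ => (1 : ℝ)) → φ f = 1) ∧
    (∀ (g : G) (f f' : Lp ℝ ∞ m), (f' =ᵐ[m] f ∘ σ.act g) → φ f' = φ f)

end Nonsingular

/-! ### Orthogonal representations -/

section Representations

variable {G : Type v} [Group G] [TopologicalSpace G]

/-- Almost invariant vectors: for every compact `K ⊆ G` and `ε > 0` there is a unit vector moved
by less than `ε` by every element of `K`. -/
def HasAlmostInvariantVectors {E : Type*} [NormedAddCommGroup E] (T : G → E → E) : Prop :=
  ∀ K : Set G, IsCompact K → ∀ ε : ℝ, 0 < ε → ∃ ξ : E, ‖ξ‖ = 1 ∧ ∀ g ∈ K, ‖T g ξ - ξ‖ < ε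

/-- The tensor product representation `π ⊗ ρ` on the Hilbert space tensor product, which is the
completion of the algebraic tensor product. -/
def tensorRep {V : Type u} {W : Type w} [NormedAddCommGroup V] [InnerProductSpace ℝ V]
    [NormedAddCommGroup W] [InnerProductSpace ℝ W]
    (π : G →* (V ≃ₗᵢ[ℝ] V)) (ρ : G →* (W ≃ₗᵢ[ℝ] W)) (g : G) :
    UniformSpace.Completion (V ⊗[ℝ] W) →L[ℝ] UniformSpace.Completion (V ⊗[ℝ] W) :=
  (TensorProduct.congrIsometry (π g) (ρ g)).toContinuousLinearEquiv.toContinuousLinearMap.completion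

/-- Stable spectral gap: `π ⊗ ρ` has no almost invariant vectors for any (strongly continuous)
orthogonal representation `ρ` on a separable real Hilbert space. Every separable Hilbert space is
isometric to one in `Type`, so nothing is lost by the choice of the universe. -/
def HasStableSpectralGap {V : Type u} [NormedAddCommGroup V] [InnerProductSpace ℝ V]
    (π : G →* (V ≃ₗᵢ[ℝ] V)) : Prop :=
  ∀ (W : Type) [NormedAddCommGroup W] [InnerProductSpace ℝ W] [CompleteSpace W]
    [TopologicalSpace.SeparableSpace W] (ρ : G →* (W ≃ₗᵢ[ℝ] W)),
    (∀ ξ, Continuous fun g => ρ g ξ) →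
      ¬ HasAlmostInvariantVectors (fun g ξ => tensorRep π ρ g ξ)

end Representations

/-! ### Affine isometric actions -/

section Affine

variable {G : Type v} [Group G] [TopologicalSpace G]
  {V : Type u} [NormedAddCommGroup V] [InnerProductSpace ℝ V]
  {P : Type w} [MetricSpace P] [NormedAddTorsor V P]

/-- The linear part of an affine isometric action. -/
def linearPart (α : G →* (P ≃ᵃⁱ[ℝ] P)) : G →* (V ≃ₗᵢ[ℝ] V) where
  toFun g := (α g).linearIsometryEquiv
  map_one' := by
    rw [map_one]
    rfl
  map_mul' g h := by
    rw [map_mul]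
    rfl

def HasFixedPoint (α : G →* (P ≃ᵃⁱ[ℝ] P)) : Prop := ∃ x : P, ∀ g, α g x = x

/-- `‖g xₙ - xₙ‖ → 0` uniformly on compact subsets of `G`, for some sequence `xₙ`. -/
def HasAlmostFixedPoints (α : G →* (P ≃ᵃⁱ[ℝ] P)) : Prop :=
  ∃ x : ℕ → P, ∀ K : Set G, IsCompact K →
    TendstoUniformlyOn (fun n g => dist (α g (x n)) (x n)) (fun _ => 0) atTop K

/-- Metric properness: `‖g x - x‖ → ∞` as `g → ∞`. -/
def IsProperAction (α : G →* (P ≃ᵃⁱ[ℝ] P)) : Prop :=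
  ∀ x : P, Tendsto (fun g => dist (α g x) x) (cocompact G) atTop

/-! ### Gaussian densities and Gaussian actions -/

/-- `(X, (μ x)_{x ∈ P})` is a Gaussian density of the affine Hilbert space `P`, whose measure
class is the one of `m`: the `μ x` are probability measures equivalent to `m`, and there is a linear
map `f ↦ F f` from the continuous affine functions on `P` to `L⁰(X)` such that `F f` has law
`N(f(x), ‖f⁰‖²)` under `μ x`, where `f⁰` is the linear part of `f`, and such that the
random variables `F f` generate the `σ`-algebra of `X` up to null sets. -/
structure IsGaussianDensity {X : Type z} [MeasurableSpace X] (m : Measure X)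
    (μ : P → Measure X) : Prop where
  isProbabilityMeasure : ∀ x, IsProbabilityMeasure (μ x)
  absolutelyContinuous : ∀ x, μ x ≪ m
  absolutelyContinuous' : ∀ x, m ≪ μ x
  exists_linearMap : ∃ F : (P →ᴬ[ℝ] ℝ) →ₗ[ℝ] (X →ₘ[m] ℝ),
    (∀ (x : P) (f : P →ᴬ[ℝ] ℝ),
      (μ x).map (F f) = gaussianReal (f x) (‖f.contLinear‖₊ ^ 2)) ∧
    (∀ A : Set X, MeasurableSet A →
      ∃ B : Set X, MeasurableSet[⨆ f, MeasurableSpace.comap (F f) (borel ℝ)] B ∧ A =ᵐ[m] B)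

/-- `σ` is the Gaussian action of `α` on the Gaussian density `μ`: the automorphism given by `g`
maps `μ x` to `μ (g x)`. -/
def IsGaussianAction {X : Type z} [MeasurableSpace X] {m : Measure X} (μ : P → Measure X)
    (α : G →* (P ≃ᵃⁱ[ℝ] P)) (σ : NonsingularAction G X m) : Prop :=
  ∀ (g : G) (x : P), (μ x).map (σ.act g) = μ (α g x)

end Affine

end GaussianDictionary

end

noncomputable section

namespace GaussianDictionary

open scoped RealInnerProductSpace

/-! ### Determining a measure by the laws of random variables -/

/-! Fix a base point `o`. The continuous affine functions become a process `W v`, almost surely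
linear in `v`, of law N(⟪v, x - o⟫, ‖v‖²) under `μ x`, and the laws of the `W v` separate finite
measures. Comparing exponential moments gives the Cameron–Martin formula dμ_x/dμ_o = exp(W(x - o) -
‖x - o‖²/2). Three distances follow from it: the L¹ distance of two translates is at most √(exp d² -
1), their relative entropy is d²/2, and the half-densities u_x of the `μ x` satisfy ⟪u_x, u_y⟫ =
exp(-d²/8) (`inner_sqrtDensity`), where d is the distance of the points. The u_x are total in L²,
and the Koopman representation sends u_x to u_{gx}. For existence, a sequence of independent
standard normals carries such a process, and the Cameron–Martin formula serves as the definition of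
`μ x`.

Koopman coefficients therefore vanish along a filter as soon as orbits go to infinity along it, and
the coefficients of the u_x show the converse; this is (ii). If there is no fixed point, orbits are
unbounded and coefficients vanish along some proper filter, which an invariant unit vector, the
half-density of an invariant probability, forbids; this is (i). For (iii), the measures of almost
fixed points have small entropy, and a weak-* cluster point of them is an invariant mean.

For (iv), an invariant mean produces, by Hahn–Banach and smoothing over `G`, almost invariant
probability densities, and their square roots are almost invariant unit vectors ξ of the Koopman
representation. Consider ξ ⊗ ξ in L²(X × X), which is approximated by combinations of the u_x ⊗ u_y.
Passing to the midpoint and the difference of x and y splits u_x ⊗ u_y into a diagonal part, a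
multiple of u_z ⊗ u_z with z the midpoint, and an orthogonal rest. The Gram matrix of the rest is ⟪x
- y, x' - y'⟫/8 times an invariant kernel of positive type, because exp a - 1 = a ∫₀¹ exp(ta) dt, so
the rest lives in α⁰ ⊗ ρ for some representation ρ, and the stable spectral gap makes the rest of ξ
⊗ ξ small (`exists_le_norm_offDiagPart_sub`).

On the diagonal part W v(ω) - W v(ω') has mean square 2‖v‖². Hence, under the probability measure ξ²
m, every `W v` is concentrated at scale ‖v‖ around ⟪v, x - o⟫ for one point x, and almost invariance
of ξ² m bounds the displacement of x by a universal constant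
(`exists_dist_le_of_norm_koopman_sub_le`). So for every compact set some point is moved by at most
64. The spectral gap of α⁰ itself bounds the distance between such points, orbits are bounded, and
there is a fixed point. -/

theorem map_eq_map_of_mgf_eq {X Y : Type*} [MeasurableSpace X] [MeasurableSpace Y]
    {μ : Measure X} {ν : Measure Y} [IsFiniteMeasure μ] [IsFiniteMeasure ν]
    {f : X → ℝ} {g : Y → ℝ} (hf : AEMeasurable f μ) (hg : AEMeasurable g ν)
    (hint : ∀ t, Integrable (fun x => Real.exp (t * f x)) μ)
    (h : ∀ t, ∫ x, Real.exp (t * f x) ∂μ = ∫ x, Real.exp (t * g x) ∂ν) :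
    μ.map f = ν.map g := by
  refine Measure.ext_of_complexMGF_eq hf hg ?_
  have huniv : integrableExpSet f μ = Set.univ := by
    ext t; simpa [integrableExpSet] using hint t
  have h0 : μ = 0 ↔ ν = 0 := by
    have h1 : μ.real Set.univ = ν.real Set.univ := by simpa using h 0
    rw [← Measure.measure_univ_eq_zero, ← Measure.measure_univ_eq_zero (μ := ν),
      ← measureReal_eq_zero_iff, ← measureReal_eq_zero_iff, h1]
  -- The complex moment generating functions are analytic on the strip over the interior of the set
  -- where the exponential moments are finite. That strip is the whole plane here, so equality on
  -- the real axis spreads everywhere.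
  have := eqOn_complexMGF_of_mgf' (X := f) (Y := g) (μ := μ) (μ' := ν) (funext h) h0
  rw [huniv] at this
  funext z
  exact this (by simp)

/-- Cramér–Wold on each finite set of indices: a functional on ℝ^I is a linear combination of
coordinates, so characteristic functions agree. Finite-dimensional marginals then determine the law
on the product, by uniqueness of projective limits. -/
theorem map_pi_eq_of_forall_map_sum_eq {X ι : Type*} [MeasurableSpace X]
    {Y : ι → X → ℝ} (hY : ∀ i, Measurable (Y i)) {ν₁ ν₂ : Measure X} [IsFiniteMeasure ν₁]
    [IsFiniteMeasure ν₂]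
    (h : ∀ (s : Finset ι) (c : ι → ℝ),
      ν₁.map (fun x => ∑ i ∈ s, c i * Y i x) = ν₂.map (fun x => ∑ i ∈ s, c i * Y i x)) :
    ν₁.map (fun x i => Y i x) = ν₂.map (fun x i => Y i x) := by
  classical
  have hΦ : Measurable (fun x i => Y i x) := measurable_pi_lambda _ hY
  refine IsProjectiveLimit.unique (P := fun I => (ν₂.map (fun x i => Y i x)).map I.restrict)
    (fun I => ?_) (fun I => rfl)
  refine Measure.ext_of_charFunDual (funext fun L => ?_)
  have hL : Measurable fun x : (I → ℝ) => L x := L.continuous.measurable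
  rw [charFunDual_eq_charFun_map_one, charFunDual_eq_charFun_map_one,
    Measure.map_map hL (by fun_prop), Measure.map_map (hL.comp (by fun_prop)) hΦ,
    Measure.map_map hL (by fun_prop), Measure.map_map (hL.comp (by fun_prop)) hΦ]
  have key : (fun y => L y) ∘ I.restrict ∘ (fun x i => Y i x) = fun x => ∑ i ∈ I,
      (if hi : i ∈ I then L (Pi.single ⟨i, hi⟩ 1) else 0) * Y i x := by
    funext x
    simp only [Function.comp_apply]
    conv_lhs => rw [← Finset.univ_sum_single (I.restrict fun i => Y i x)]
    rw [map_sum, ← Finset.sum_coe_sort I]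
    refine Finset.sum_congr rfl fun i _ => ?_
    have : Pi.single i (I.restrict (fun i => Y i x) i) =
        (Y i x) • (Pi.single i (1 : ℝ) : I → ℝ) := by
      ext j; by_cases hj : j = i <;> simp [Pi.single_apply, hj]
    rw [this, map_smul]
    simp [mul_comm]
  have := h I (fun i => if hi : i ∈ I then L (Pi.single ⟨i, hi⟩ 1) else 0)
  rw [← key] at this
  exact congrArg (fun q : Measure ℝ => charFun q 1) this

/-- Up to a null set every measurable set is the preimage of a set in the product space under the
joint map of the variables, so the joint law determines the measure. -/
theorem measure_eq_of_forall_map_sum_eq {X ι : Type*} [MeasurableSpace X] {m : Measure X}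
    {Y : ι → X → ℝ} (hY : ∀ i, Measurable (Y i))
    (hgen : ∀ A : Set X, MeasurableSet A →
      ∃ B : Set X, MeasurableSet[⨆ i, MeasurableSpace.comap (Y i) (borel ℝ)] B ∧ A =ᵐ[m] B)
    {ν₁ ν₂ : Measure X} [IsFiniteMeasure ν₁] [IsFiniteMeasure ν₂] (h₁ : ν₁ ≪ m) (h₂ : ν₂ ≪ m)
    (h : ∀ (s : Finset ι) (c : ι → ℝ),
      ν₁.map (fun x => ∑ i ∈ s, c i * Y i x) = ν₂.map (fun x => ∑ i ∈ s, c i * Y i x)) :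
    ν₁ = ν₂ := by
  have hΦ : Measurable (fun x i => Y i x) := measurable_pi_lambda _ hY
  have hmap := map_pi_eq_of_forall_map_sum_eq hY h
  ext A hA
  obtain ⟨B, hB, hAB⟩ := hgen A hA
  have hcomap : (⨆ i, MeasurableSpace.comap (Y i) (borel ℝ)) =
      MeasurableSpace.comap (fun x i => Y i x) MeasurableSpace.pi := by
    rw [MeasurableSpace.pi, MeasurableSpace.comap_iSup]
    refine iSup_congr fun i => ?_
    rw [MeasurableSpace.comap_comp]
    rw [← BorelSpace.measurable_eq (α := ℝ)]
    rfl
  rw [hcomap] at hB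
  obtain ⟨D, hD, rfl⟩ := hB
  rw [measure_congr (h₁.ae_eq hAB), measure_congr (h₂.ae_eq hAB),
    ← Measure.map_apply hΦ hD, hmap, Measure.map_apply hΦ hD]

/-! ### Isonormal processes -/

section Isonormal

variable {V : Type u} [NormedAddCommGroup V] [InnerProductSpace ℝ V]
  {P : Type w} [MetricSpace P] [NormedAddTorsor V P] {X : Type z} [MeasurableSpace X]

/-- The continuous affine function `x ↦ ⟪v, x - o⟫`. -/
def innerAffine (o : P) (v : V) : P →ᴬ[ℝ] ℝ where
  toFun x := ⟪v, x -ᵥ o⟫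
  linear := (innerSL ℝ v : V →L[ℝ] ℝ)
  map_vadd' x w := by simp [vadd_vsub_assoc, inner_add_right]
  cont := by
    fun_prop

@[simp]
theorem innerAffine_apply (o : P) (v : V) (x : P) : innerAffine o v x = ⟪v, x -ᵥ o⟫ := rfl

@[simp]
theorem innerAffine_contLinear (o : P) (v : V) :
    (innerAffine o v).contLinear = innerSL ℝ v := by
  ext w; rfl

/-- The coordinate process `W` of a Gaussian density, with base point `o`. -/
structure IsIsonormal (m : Measure X) (μ : P → Measure X) (o : P) (W : V → X → ℝ) : Prop where
  prob : ∀ x, IsProbabilityMeasure (μ x)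
  ac : ∀ x, μ x ≪ m
  ac' : ∀ x, m ≪ μ x
  meas : ∀ v, Measurable (W v)
  add : ∀ v w, W (v + w) =ᵐ[m] fun x => W v x + W w x
  smul : ∀ (c : ℝ) v, W (c • v) =ᵐ[m] fun x => c * W v x
  law : ∀ x v, (μ x).map (W v) = gaussianReal ⟪v, x -ᵥ o⟫ (‖v‖₊ ^ 2)
  separating : ∀ ν₁ ν₂ : Measure X, IsFiniteMeasure ν₁ → IsFiniteMeasure ν₂ → ν₁ ≪ m → ν₂ ≪ m →
    (∀ v, ν₁.map (W v) = ν₂.map (W v)) → ν₁ = ν₂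

theorem ae_eq_const_of_map_eq_dirac {ν : Measure X} {f : X → ℝ} (hf : Measurable f) {c : ℝ}
    (h : ν.map f = Measure.dirac c) : f =ᵐ[ν] fun _ => c := by
  have h1 : ∀ᵐ y ∂(ν.map f), y = c := by rw [h, ae_dirac_eq]; simp
  exact ae_of_ae_map hf.aemeasurable h1

theorem AEEqFun.coeFn_finset_sum_mul {m : Measure X} {E : Type*} [AddCommGroup E] [Module ℝ E]
    (F : E →ₗ[ℝ] (X →ₘ[m] ℝ)) (s : Finset E) (c : E → ℝ) :
    (fun x => ∑ i ∈ s, c i * F i x) =ᵐ[m] F (∑ i ∈ s, c i • i) := by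
  classical
  induction s using Finset.induction_on with
  | empty =>
    simp only [Finset.sum_empty, map_zero]
    exact AEEqFun.coeFn_zero.symm
  | insert a s ha ih =>
    simp only [Finset.sum_insert ha, map_add, map_smul]
    filter_upwards [ih, AEEqFun.coeFn_add (c a • F a) (F (∑ i ∈ s, c i • i)),
      AEEqFun.coeFn_smul (c a) (F a)] with x h1 h2 h3
    rw [h1, h2, Pi.add_apply, h3, Pi.smul_apply, smul_eq_mul]

/-- By the Riesz representation a continuous affine function is a constant plus some `innerAffine o
v`. A linear combination of the variables `F f` is again of this form, so the laws of the single
coordinates `W v` already control all linear combinations, which is what separation of measures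
needs. -/
theorem IsGaussianDensity.exists_isIsonormal [CompleteSpace V] {m : Measure X} {μ : P → Measure X}
    (h : IsGaussianDensity m μ) (o : P) : ∃ W : V → X → ℝ, IsIsonormal m μ o W := by
  obtain ⟨F, hlaw, hgen⟩ := h.exists_linearMap
  have hprob := h.isProbabilityMeasure
  have hadd : ∀ f f', F (f + f') =ᵐ[m] fun x => F f x + F f' x := fun f f' => by
    rw [map_add]; exact AEEqFun.coeFn_add _ _
  -- A constant has zero linear part, so its variable has law N(c, 0), a Dirac mass.
  have hconst : ∀ c : ℝ, F (ContinuousAffineMap.const ℝ P c) =ᵐ[m] fun _ => c := by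
    intro c
    refine (h.absolutelyContinuous' o).ae_eq
      (ae_eq_const_of_map_eq_dirac (AEEqFun.measurable _) ?_)
    rw [hlaw]
    simp
  have hF : ∀ f : P →ᴬ[ℝ] ℝ, ∃ v : V,
      F f =ᵐ[m] fun x => f o + F (innerAffine o v) x := by
    intro f
    refine ⟨(InnerProductSpace.toDual ℝ V).symm f.contLinear, ?_⟩
    set v := (InnerProductSpace.toDual ℝ V).symm f.contLinear
    have hf : f = ContinuousAffineMap.const ℝ P (f o) + innerAffine o v := by
      ext x
      have h1 := f.contLinear_map_vsub x o
      have h2 : ⟪v, x -ᵥ o⟫ = f.contLinear (x -ᵥ o) := by simp [v]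
      simp only [ContinuousAffineMap.add_apply, ContinuousAffineMap.coe_const,
        Function.const_apply, innerAffine_apply, h2, h1, vsub_eq_sub]
      ring
    have h3 := hadd (ContinuousAffineMap.const ℝ P (f o)) (innerAffine o v)
    rw [← hf] at h3
    filter_upwards [h3, hconst (f o)] with x hx hc
    rw [hx, hc]
  refine ⟨fun v => F (innerAffine o v), h.isProbabilityMeasure, h.absolutelyContinuous,
    h.absolutelyContinuous', fun v => AEEqFun.measurable _, fun v w => ?_, fun c v => ?_,
    fun x v => ?_, fun ν₁ ν₂ _ _ h₁ h₂ hν => ?_⟩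
  · have : innerAffine o (v + w) = innerAffine o v + innerAffine o w := by
      ext x; simp [inner_add_left]
    rw [this]
    exact hadd _ _
  · have : innerAffine o (c • v) = c • innerAffine o v := by
      ext x; simp [inner_smul_left]
    rw [this, map_smul]
    exact AEEqFun.coeFn_smul _ _
  · rw [hlaw]
    congr 2
    rw [innerAffine_contLinear]
    exact NNReal.eq (innerSL_apply_norm ℝ v)
  · refine measure_eq_of_forall_map_sum_eq (Y := fun f => F f) (fun f => AEEqFun.measurable _)
      hgen h₁ h₂ fun s c => ?_
    obtain ⟨v, hv⟩ := hF (∑ i ∈ s, c i • i)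
    have hs := (AEEqFun.coeFn_finset_sum_mul F s c).trans hv
    rw [Measure.map_congr (h₁.ae_eq hs), Measure.map_congr (h₂.ae_eq hs)]
    have hcomp : (fun x => (∑ i ∈ s, c i • i : P →ᴬ[ℝ] ℝ) o + F (innerAffine o v) x) =
        (fun y => (∑ i ∈ s, c i • i : P →ᴬ[ℝ] ℝ) o + y) ∘ F (innerAffine o v) := rfl
    rw [hcomp, ← Measure.map_map (by fun_prop) (AEEqFun.measurable _),
      ← Measure.map_map (by fun_prop) (AEEqFun.measurable _), hν v]

end Isonormal

/-! ### The Cameron–Martin formula and its numerical consequences -/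

section Isonormal

variable {V : Type u} [NormedAddCommGroup V] {X : Type z}

/-- The density `exp (W v - ‖v‖² / 2)` of the translated Gaussian measure. -/
def cameronMartin (W : V → X → ℝ) (v : V) (ω : X) : ℝ := Real.exp (W v ω - ‖v‖ ^ 2 / 2)

theorem cameronMartin_pos (W : V → X → ℝ) (v : V) (ω : X) : 0 < cameronMartin W v ω :=
  Real.exp_pos _

namespace IsIsonormal

variable [InnerProductSpace ℝ V]
  {P : Type w} [MetricSpace P] [NormedAddTorsor V P] [MeasurableSpace X]

variable {m : Measure X} {μ : P → Measure X} {o : P} {W : V → X → ℝ}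

theorem congr_measure (I : IsIsonormal m μ o W) {m' : Measure X} (h : m' ≪ m) (h' : m ≪ m') :
    IsIsonormal m' μ o W where
  prob := I.prob
  ac x := (I.ac x).trans h'
  ac' x := h.trans (I.ac' x)
  meas := I.meas
  add v w := h.ae_eq (I.add v w)
  smul c v := h.ae_eq (I.smul c v)
  law := I.law
  separating ν₁ ν₂ i₁ i₂ h₁ h₂ hν := I.separating ν₁ ν₂ i₁ i₂ (h₁.trans h) (h₂.trans h) hν

theorem zero (I : IsIsonormal m μ o W) : W 0 =ᵐ[m] fun _ => 0 := by
  have := I.smul 0 0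
  simp only [zero_smul, zero_mul] at this
  exact this

/-- Change of base point. -/
theorem rebase (I : IsIsonormal m μ o W) (y : P) :
    IsIsonormal m μ y (fun v ω => W v ω - ⟪v, y -ᵥ o⟫) where
  prob := I.prob
  ac := I.ac
  ac' := I.ac'
  meas v := (I.meas v).sub_const _
  add v w := by
    filter_upwards [I.add v w] with x h
    rw [h, inner_add_left]; ring
  smul c v := by
    filter_upwards [I.smul c v] with x h
    rw [h, inner_smul_left]; simp; ring
  law x v := by
    have : (fun ω => W v ω - ⟪v, y -ᵥ o⟫) = (fun t => t - ⟪v, y -ᵥ o⟫) ∘ W v := rfl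
    rw [this, ← Measure.map_map (by fun_prop) (I.meas v), I.law, gaussianReal_map_sub_const,
      ← inner_sub_right, vsub_sub_vsub_cancel_right]
  separating ν₁ ν₂ i₁ i₂ h₁ h₂ hν := by
    refine I.separating ν₁ ν₂ i₁ i₂ h₁ h₂ fun v => ?_
    have : W v = (fun t => t + ⟪v, y -ᵥ o⟫) ∘ (fun ω => W v ω - ⟪v, y -ᵥ o⟫) := by
      funext ω; simp
    rw [this, ← Measure.map_map (by fun_prop) ((I.meas v).sub_const _),
      ← Measure.map_map (by fun_prop) ((I.meas v).sub_const _), hν v]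

theorem integrable_exp_mul (I : IsIsonormal m μ o W) (x : P) (v : V) (t : ℝ) :
    Integrable (fun ω => Real.exp (t * W v ω)) (μ x) := by
  have h := integrable_exp_mul_gaussianReal (μ := ⟪v, x -ᵥ o⟫) (v := ‖v‖₊ ^ 2) t
  rw [← I.law x v] at h
  exact h.comp_measurable (I.meas v)

theorem integral_exp_mul (I : IsIsonormal m μ o W) (x : P) (v : V) (t : ℝ) :
    ∫ ω, Real.exp (t * W v ω) ∂(μ x) = Real.exp (⟪v, x -ᵥ o⟫ * t + ‖v‖ ^ 2 * t ^ 2 / 2) := by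
  have h := mgf_gaussianReal (I.law x v) t
  simpa [mgf] using h

theorem integrable_exp (I : IsIsonormal m μ o W) (x : P) (v : V) :
    Integrable (fun ω => Real.exp (W v ω)) (μ x) := by
  simpa using I.integrable_exp_mul x v 1

theorem integral_exp (I : IsIsonormal m μ o W) (x : P) (v : V) :
    ∫ ω, Real.exp (W v ω) ∂(μ x) = Real.exp (⟪v, x -ᵥ o⟫ + ‖v‖ ^ 2 / 2) := by
  simpa using I.integral_exp_mul x v 1

theorem measurable_cameronMartin (I : IsIsonormal m μ o W) (v : V) :
    Measurable (cameronMartin W v) := by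
  have := I.meas v
  unfold cameronMartin
  fun_prop

/-- The Cameron–Martin formula. -/
theorem measure_eq_withDensity (I : IsIsonormal m μ o W) (x : P) :
    μ x = (μ o).withDensity (fun ω => ENNReal.ofReal (cameronMartin W (x -ᵥ o) ω)) := by
  have := I.prob o
  have := I.prob x
  set ξ := x -ᵥ o with hξ
  have hm : Measurable (fun ω => ENNReal.ofReal (cameronMartin W ξ ω)) :=
    (I.measurable_cameronMartin ξ).ennreal_ofReal
  have hcm : ∀ ω, cameronMartin W ξ ω = Real.exp (-(‖ξ‖ ^ 2 / 2)) * Real.exp (W ξ ω) := by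
    intro ω; rw [← Real.exp_add, cameronMartin]; congr 1; ring
  have hint : Integrable (cameronMartin W ξ) (μ o) := by
    simp_rw [show cameronMartin W ξ = fun ω => Real.exp (-(‖ξ‖ ^ 2 / 2)) * Real.exp (W ξ ω) from
      funext hcm]
    exact (I.integrable_exp o ξ).const_mul _
  have hfin : IsFiniteMeasure ((μ o).withDensity
      (fun ω => ENNReal.ofReal (cameronMartin W ξ ω))) :=
    isFiniteMeasure_withDensity_ofReal hint.2
  refine I.separating _ _ inferInstance hfin (I.ac x)
    ((withDensity_absolutelyContinuous _ _).trans (I.ac o)) fun v => ?_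
  refine map_eq_map_of_mgf_eq (I.meas v).aemeasurable (I.meas v).aemeasurable
    (fun t => I.integrable_exp_mul x v t) fun t => ?_
  rw [I.integral_exp_mul x v t, integral_withDensity_eq_integral_toReal_smul hm (by simp)]
  -- The density times exp(t W v) is again the exponential of a single coordinate, that of ξ + t v.
  -- Its integral is known, and expanding ‖ξ + t v‖² produces the mean shift ⟪v, ξ⟫.
  have h1 : ∀ᵐ ω ∂(μ o), (ENNReal.ofReal (cameronMartin W ξ ω)).toReal • Real.exp (t * W v ω) =
      Real.exp (-(‖ξ‖ ^ 2 / 2)) * Real.exp (W (ξ + t • v) ω) := by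
    filter_upwards [(I.ac o).ae_eq (I.add ξ (t • v)), (I.ac o).ae_eq (I.smul t v)] with ω h1 h2
    rw [ENNReal.toReal_ofReal (cameronMartin_pos _ _ _).le, hcm, h1, h2, Real.exp_add, smul_eq_mul,
      mul_assoc]
  rw [integral_congr_ae h1, integral_const_mul, I.integral_exp, vsub_self, inner_zero_right,
    ← Real.exp_add]
  congr 1
  rw [norm_add_sq_real, inner_smul_right, norm_smul, real_inner_comm]
  rw [mul_pow, Real.norm_eq_abs, sq_abs]
  ring

theorem integral_eq (I : IsIsonormal m μ o W) (x : P) (f : X → ℝ) :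
    ∫ ω, f ω ∂(μ x) = ∫ ω, cameronMartin W (x -ᵥ o) ω * f ω ∂(μ o) := by
  rw [I.measure_eq_withDensity x, integral_withDensity_eq_integral_toReal_smul
    (I.measurable_cameronMartin _).ennreal_ofReal (by simp)]
  refine integral_congr_ae (ae_of_all _ fun ω => ?_)
  simp [ENNReal.toReal_ofReal (cameronMartin_pos _ _ _).le]

theorem integrable_iff (I : IsIsonormal m μ o W) (x : P) (f : X → ℝ) :
    Integrable f (μ x) ↔ Integrable (fun ω => cameronMartin W (x -ᵥ o) ω * f ω) (μ o) := by
  rw [I.measure_eq_withDensity x, integrable_withDensity_iff_integrable_smul'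
    (I.measurable_cameronMartin _).ennreal_ofReal (by simp)]
  simp [ENNReal.toReal_ofReal (cameronMartin_pos _ _ _).le]

theorem integrable_cameronMartin_mul (I : IsIsonormal m μ o W) (v w : V) :
    Integrable (fun ω => cameronMartin W v ω * cameronMartin W w ω) (μ o) := by
  have h := (I.integrable_exp o (v + w)).const_mul (Real.exp (-(‖v‖ ^ 2 / 2) - ‖w‖ ^ 2 / 2))
  refine h.congr ?_
  filter_upwards [(I.ac o).ae_eq (I.add v w)] with ω h
  rw [h, cameronMartin, cameronMartin, ← Real.exp_add, ← Real.exp_add]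
  congr 1; ring

theorem integrable_cameronMartin (I : IsIsonormal m μ o W) (v : V) :
    Integrable (cameronMartin W v) (μ o) := by
  have h := (I.integrable_exp o v).const_mul (Real.exp (-(‖v‖ ^ 2 / 2)))
  refine h.congr (ae_of_all _ fun ω => ?_)
  simp only [cameronMartin, ← Real.exp_add]
  congr 1; ring

theorem integral_cameronMartin_mul (I : IsIsonormal m μ o W) (v w : V) :
    ∫ ω, cameronMartin W v ω * cameronMartin W w ω ∂(μ o) = Real.exp ⟪v, w⟫ := by
  have h : (fun ω => cameronMartin W v ω * cameronMartin W w ω) =ᵐ[μ o]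
      fun ω => Real.exp (-(‖v‖ ^ 2 / 2) - ‖w‖ ^ 2 / 2) * Real.exp (W (v + w) ω) := by
    filter_upwards [(I.ac o).ae_eq (I.add v w)] with ω h
    rw [h, cameronMartin, cameronMartin, ← Real.exp_add, ← Real.exp_add]
    congr 1; ring
  rw [integral_congr_ae h, integral_const_mul, I.integral_exp, vsub_self, inner_zero_right,
    ← Real.exp_add, norm_add_sq_real]
  congr 1; ring

theorem integral_cameronMartin (I : IsIsonormal m μ o W) (v : V) :
    ∫ ω, cameronMartin W v ω ∂(μ o) = 1 := by
  have h : (cameronMartin W v) =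
      fun ω => Real.exp (-(‖v‖ ^ 2 / 2)) * Real.exp (W v ω) := by
    funext ω
    rw [cameronMartin, ← Real.exp_add]
    congr 1; ring
  rw [h, integral_const_mul, I.integral_exp, vsub_self, inner_zero_right, ← Real.exp_add]
  simp

/-- The `L¹` distance of two translates is at most `√(exp ‖v‖² - 1)`. -/
theorem integral_abs_cameronMartin_sub_one_le (I : IsIsonormal m μ o W) (v : V) :
    ∫ ω, |cameronMartin W v ω - 1| ∂(μ o) ≤ √(Real.exp (‖v‖ ^ 2) - 1) := by
  have := I.prob o
  have hsq : Integrable (fun ω => (cameronMartin W v ω - 1) ^ 2) (μ o) := by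
    have := ((I.integrable_cameronMartin_mul v v).sub
      ((I.integrable_cameronMartin v).const_mul 2)).add (integrable_const (1 : ℝ))
    refine this.congr (ae_of_all _ fun ω => ?_)
    simp only [Pi.add_apply, Pi.sub_apply]
    ring
  have hmem : MemLp (fun ω => cameronMartin W v ω - 1) 2 (μ o) :=
    (memLp_two_iff_integrable_sq
      ((I.measurable_cameronMartin v).sub_const 1).aestronglyMeasurable).2 hsq
  have hval : ∫ ω, (cameronMartin W v ω - 1) ^ 2 ∂(μ o) = Real.exp (‖v‖ ^ 2) - 1 := by
    have h1 : (fun ω => (cameronMartin W v ω - 1) ^ 2) = fun ω =>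
        (cameronMartin W v ω * cameronMartin W v ω - 2 * cameronMartin W v ω) + 1 := by
      funext ω; ring
    have h2 : Integrable (fun ω =>
        cameronMartin W v ω * cameronMartin W v ω - 2 * cameronMartin W v ω) (μ o) :=
      (I.integrable_cameronMartin_mul v v).sub ((I.integrable_cameronMartin v).const_mul 2)
    rw [h1, integral_add h2 (integrable_const _),
      integral_sub (I.integrable_cameronMartin_mul v v) ((I.integrable_cameronMartin v).const_mul 2),
      I.integral_cameronMartin_mul, integral_const_mul, I.integral_cameronMartin]
    simp
    ring
  have hint : Integrable (fun ω => |cameronMartin W v ω - 1|) (μ o) :=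
    (hmem.integrable (by norm_num)).abs
  have hnn : 0 ≤ ∫ ω, |cameronMartin W v ω - 1| ∂(μ o) :=
    integral_nonneg fun _ => abs_nonneg _
  rw [← hval]
  refine Real.le_sqrt_of_sq_le ?_
  -- Nonnegativity of the variance is the Cauchy–Schwarz inequality between first and second
  -- absolute moments.
  have hvar := variance_nonneg (fun ω => |cameronMartin W v ω - 1|) (μ o)
  have habs : MemLp (fun ω => |cameronMartin W v ω - 1|) 2 (μ o) := hmem.abs
  rw [variance_eq_sub habs] at hvar
  simp only [Pi.pow_apply, sq_abs] at hvar
  linarith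

/-- By the Cameron–Martin formula the difference of the two means is the mean of f times (density -
1). The bound depends on the distance alone; combined with `rebase` it compares any two points,
uniformly over the affine space. -/
theorem abs_integral_sub_integral_le (I : IsIsonormal m μ o W) (x : P) {f : X → ℝ}
    (hf : AEStronglyMeasurable f m) {M : ℝ} (hM : ∀ᵐ ω ∂m, |f ω| ≤ M) :
    |∫ ω, f ω ∂(μ x) - ∫ ω, f ω ∂(μ o)| ≤ M * √(Real.exp (dist x o ^ 2) - 1) := by
  have := I.prob o
  have := I.prob x
  have hint : ∀ y, Integrable f (μ y) := fun y => by
    have := I.prob y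
    exact Integrable.of_bound (hf.mono_ac (I.ac y)) M ((I.ac y).ae_le hM)
  have hM0 : 0 ≤ M := by
    have hM' : ∀ᵐ ω ∂(μ o), |f ω| ≤ M := (I.ac o).ae_le hM
    obtain ⟨ω, hω⟩ := hM'.exists
    exact (abs_nonneg _).trans hω
  rw [I.integral_eq x f, ← integral_sub ((I.integrable_iff x f).1 (hint x)) (hint o)]
  calc |∫ ω, (cameronMartin W (x -ᵥ o) ω * f ω - f ω) ∂(μ o)|
      ≤ ∫ ω, |cameronMartin W (x -ᵥ o) ω * f ω - f ω| ∂(μ o) := abs_integral_le_integral_abs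
    _ ≤ ∫ ω, M * |cameronMartin W (x -ᵥ o) ω - 1| ∂(μ o) := by
        refine integral_mono_ae (((I.integrable_iff x f).1 (hint x)).sub (hint o)).abs
          ((((I.integrable_cameronMartin _).sub (integrable_const 1)).abs).const_mul M) ?_
        filter_upwards [(I.ac o).ae_le hM] with ω hω
        have : cameronMartin W (x -ᵥ o) ω * f ω - f ω =
          f ω * (cameronMartin W (x -ᵥ o) ω - 1) := by ring
        rw [this, abs_mul]
        exact mul_le_mul_of_nonneg_right hω (abs_nonneg _)
    _ ≤ M * √(Real.exp (dist x o ^ 2) - 1) := by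
        rw [integral_const_mul, dist_eq_norm_vsub V x o]
        exact mul_le_mul_of_nonneg_left (I.integral_abs_cameronMartin_sub_one_le _) hM0

theorem memLp_coord (I : IsIsonormal m μ o W) (x : P) (v : V) (p : ℝ≥0) :
    MemLp (W v) p (μ x) := by
  have h := memLp_id_gaussianReal (μ := ⟪v, x -ᵥ o⟫) (v := ‖v‖₊ ^ 2) p
  rw [← I.law x v] at h
  exact (memLp_map_measure_iff (by fun_prop) (I.meas v).aemeasurable).1 h

theorem integral_coord (I : IsIsonormal m μ o W) (x : P) (v : V) :
    ∫ ω, W v ω ∂(μ x) = ⟪v, x -ᵥ o⟫ := by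
  have h := integral_id_gaussianReal (μ := ⟪v, x -ᵥ o⟫) (v := ‖v‖₊ ^ 2)
  rw [← I.law x v, integral_map (I.meas v).aemeasurable (by fun_prop)] at h
  exact h

/-- The logarithm of the density is W(x - o) - ‖x - o‖²/2, and W(x - o) has mean ‖x - o‖² under `μ
x`. -/
theorem klDiv_eq (I : IsIsonormal m μ o W) (x : P) :
    InformationTheory.klDiv (μ x) (μ o) = ENNReal.ofReal (dist x o ^ 2 / 2) := by
  have := I.prob o
  have := I.prob x
  have hac : μ x ≪ μ o := (I.ac x).trans (I.ac' o)
  have hllr : llr (μ x) (μ o) =ᵐ[μ x] fun ω => W (x -ᵥ o) ω - ‖x -ᵥ o‖ ^ 2 / 2 := by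
    have h1 : (μ x).rnDeriv (μ o) =ᵐ[μ o]
        fun ω => ENNReal.ofReal (cameronMartin W (x -ᵥ o) ω) := by
      conv_lhs => rw [I.measure_eq_withDensity x]
      exact Measure.rnDeriv_withDensity _ (I.measurable_cameronMartin _).ennreal_ofReal
    filter_upwards [hac.ae_eq h1] with ω hω
    rw [llr, hω, ENNReal.toReal_ofReal (cameronMartin_pos _ _ _).le, cameronMartin, Real.log_exp]
  have hW : Integrable (W (x -ᵥ o)) (μ x) := by
    simpa using (I.memLp_coord x (x -ᵥ o) 1).integrable (by norm_num)
  have hint : Integrable (llr (μ x) (μ o)) (μ x) :=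
    (hW.sub (integrable_const (‖x -ᵥ o‖ ^ 2 / 2))).congr hllr.symm
  rw [InformationTheory.klDiv_of_ac_of_integrable hac hint, integral_congr_ae hllr,
    integral_sub hW (integrable_const _), I.integral_coord]
  simp [dist_eq_norm_vsub V x o]
  congr 1; ring

theorem integrable_mul_exp_mul {f : X → ℝ} {v : V} (I : IsIsonormal m μ o W)
    (hint : ∀ v, Integrable (fun ω => f ω * Real.exp (W v ω)) m) (t : ℝ) :
    Integrable (fun ω => f ω * Real.exp (t * W v ω)) m := by
  refine (hint (t • v)).congr ?_
  filter_upwards [I.smul t v] with ω h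
  rw [h]

/-- The exponentials `exp (W v)` are total. -/
theorem ae_eq_zero_of_integral_mul_exp_eq_zero (I : IsIsonormal m μ o W) {f : X → ℝ}
    (hf : Measurable f)
    (hint : ∀ v, Integrable (fun ω => f ω * Real.exp (W v ω)) m)
    (h : ∀ v, ∫ ω, f ω * Real.exp (W v ω) ∂m = 0) : f =ᵐ[m] 0 := by
  have hf0 : Integrable f m := by
    refine (hint 0).congr ?_
    filter_upwards [I.zero] with ω h
    rw [h]; simp
  have hfin : ∀ g : X → ℝ, Integrable g m →
      IsFiniteMeasure (m.withDensity fun ω => ENNReal.ofReal (g ω)) :=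
    fun g hg => isFiniteMeasure_withDensity_ofReal hg.2
  have hfn : Measurable (fun ω => -f ω) := hf.neg
  have i1 := hfin f hf0
  have i2 := hfin (fun ω => -f ω) hf0.neg
  have hintd : ∀ g : X → ℝ, Measurable g →
      (∀ v, Integrable (fun ω => g ω * Real.exp (W v ω)) m) → ∀ v (t : ℝ),
      Integrable (fun ω => (ENNReal.ofReal (g ω)).toReal • Real.exp (t * W v ω)) m := by
    intro g hg hgi v t
    have hm := I.meas v
    refine (I.integrable_mul_exp_mul (v := v) hgi t).mono
      (Measurable.aestronglyMeasurable (by fun_prop)) (ae_of_all _ fun ω => ?_)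
    rw [smul_eq_mul, norm_mul, norm_mul]
    refine mul_le_mul_of_nonneg_right ?_ (norm_nonneg _)
    rw [ENNReal.toReal_ofReal']
    simp only [Real.norm_eq_abs]
    rw [abs_of_nonneg (le_max_right _ _)]
    exact max_le (le_abs_self _) (abs_nonneg _)
  have hneg : ∀ v, Integrable (fun ω => -f ω * Real.exp (W v ω)) m := fun v => by
    simpa using (hint v).neg
  -- The positive and negative parts of f are densities of two finite measures. Vanishing of the
  -- integrals of f exp(t W v) says that every coordinate has the same moment generating function
  -- under both, so they coincide and f = 0.
  have heq : m.withDensity (fun ω => ENNReal.ofReal (f ω)) =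
      m.withDensity (fun ω => ENNReal.ofReal (-f ω)) := by
    refine I.separating _ _ i1 i2 (withDensity_absolutelyContinuous _ _)
      (withDensity_absolutelyContinuous _ _) fun v => ?_
    refine map_eq_map_of_mgf_eq (I.meas v).aemeasurable (I.meas v).aemeasurable
      (fun t => ?_) fun t => ?_
    · rw [integrable_withDensity_iff_integrable_smul' hf.ennreal_ofReal (by simp)]
      exact hintd f hf hint v t
    · rw [integral_withDensity_eq_integral_toReal_smul hf.ennreal_ofReal (by simp),
        integral_withDensity_eq_integral_toReal_smul hfn.ennreal_ofReal (by simp),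
        ← sub_eq_zero, ← integral_sub (hintd f hf hint v t) (hintd _ hfn hneg v t)]
      rw [← h (t • v)]
      refine integral_congr_ae ?_
      filter_upwards [I.smul t v] with ω hω
      rw [hω, ENNReal.toReal_ofReal', ENNReal.toReal_ofReal', smul_eq_mul, smul_eq_mul, ← sub_mul]
      congr 1
      rcases le_total 0 (f ω) with h0 | h0
      · rw [max_eq_left h0, max_eq_right (by linarith)]; ring
      · rw [max_eq_right h0, max_eq_left (by linarith)]; ring
  have hA : ∀ A : Set X, MeasurableSet A → ∫ ω in A, f ω ∂m = 0 := by
    intro A hA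
    rw [integral_eq_lintegral_pos_part_sub_lintegral_neg_part hf0.integrableOn,
      ← withDensity_apply _ hA, ← withDensity_apply _ hA, heq, sub_self]
  exact hf0.ae_eq_zero_of_forall_setIntegral_eq_zero fun A hA' _ => hA A hA'

end IsIsonormal

end Isonormal

/-! ### Maps acting on the Gaussian measures, totality, and continuity in total variation -/

section Isonormal

variable {V : Type u} [NormedAddCommGroup V] [InnerProductSpace ℝ V]
  {P : Type w} [MetricSpace P] [NormedAddTorsor V P] {X : Type z} [MeasurableSpace X]

/-- The two sets of a Hahn decomposition contribute at most c each. -/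
theorem totalVariation_univ_le {s : SignedMeasure X} {c : ℝ}
    (h : ∀ A, MeasurableSet A → |s A| ≤ c) :
    s.totalVariation Set.univ ≤ ENNReal.ofReal (2 * c) := by
  obtain ⟨i, hi₁, hi₂, hi₃, hp, hn⟩ := s.toJordanDecomposition_spec
  have hc : 0 ≤ c := (abs_nonneg _).trans (h _ hi₁)
  rw [SignedMeasure.totalVariation, Measure.add_apply, hp, hn,
    SignedMeasure.toMeasureOfZeroLE_apply _ _ _ MeasurableSet.univ,
    SignedMeasure.toMeasureOfLEZero_apply _ _ _ MeasurableSet.univ, two_mul,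
    ENNReal.ofReal_add hc hc]
  gcongr
  · rw [← ENNReal.ofReal_coe_nnreal]
    refine ENNReal.ofReal_le_ofReal ?_
    simpa using (le_abs_self _).trans (h i hi₁)
  · rw [← ENNReal.ofReal_coe_nnreal]
    refine ENNReal.ofReal_le_ofReal ?_
    simpa using (neg_le_abs _).trans (h iᶜ hi₁.compl)

theorem coeFn_finsuppSum_toLp {ι : Type*} {p : ℝ≥0∞} {m : Measure X} {f : ι → X → ℝ}
    (hf : ∀ i, MemLp (f i) p m) (c : ι →₀ ℝ) :
    (c.sum fun i a => a • (hf i).toLp : Lp ℝ p m) =ᵐ[m]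
      fun ω => ∑ i ∈ c.support, c i * f i ω := by
  rw [Finsupp.sum]
  have h1 : ∀ᵐ ω ∂m, ∀ i ∈ c.support, (c i • (hf i).toLp : Lp ℝ p m) ω = c i * f i ω := by
    refine (Finset.eventually_all c.support).2 fun i _ => ?_
    filter_upwards [Lp.coeFn_smul (c i) (hf i).toLp, (hf i).coeFn_toLp] with ω h1 h2
    rw [h1, Pi.smul_apply, h2, smul_eq_mul]
  filter_upwards [h1, Lp.coeFn_fun_finsetSum c.support (fun i => c i • (hf i).toLp)] with ω h1 h2
  rw [h2]
  exact Finset.sum_congr rfl h1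

theorem exists_finsupp_norm_toLp_sub_lt {ι : Type*} {m : Measure X} {f : ι → X → ℝ}
    (hf : ∀ i, MemLp (f i) 2 m)
    (h : (Submodule.span ℝ (Set.range fun i => (hf i).toLp)).topologicalClosure = ⊤)
    (ξ : Lp ℝ 2 m) {ε : ℝ} (hε : 0 < ε) :
    ∃ c : ι →₀ ℝ, ‖ξ - c.sum fun i a => a • (hf i).toLp‖ < ε := by
  have hξ : ξ ∈ closure (Submodule.span ℝ (Set.range fun i => (hf i).toLp) : Set (Lp ℝ 2 m)) := by
    rw [← Submodule.topologicalClosure_coe, h]; trivial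
  obtain ⟨ζ, hζ, hd⟩ := Metric.mem_closure_iff.1 hξ ε hε
  obtain ⟨c, rfl⟩ := Finsupp.mem_span_range_iff_exists_finsupp.1 hζ
  exact ⟨c, by rwa [← dist_eq_norm]⟩

namespace IsIsonormal

variable {m : Measure X} {μ : P → Measure X} {o : P} {W : V → X → ℝ}

/-- A map of `X` that acts on the measures `μ x` as an affine isometry acts on the coordinate
process in the same way. -/
theorem coord_comp_ae_eq (I : IsIsonormal m μ o W) {a : P ≃ᵃⁱ[ℝ] P} {τ : X → X}
    (hτ : Measurable τ) (h : ∀ x, (μ x).map τ = μ (a x)) (v : V) :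
    (fun ω => W v (τ ω)) =ᵐ[m]
      fun ω => W (a.linearIsometryEquiv.symm v) ω + ⟪v, a o -ᵥ o⟫ := by
  set w := a.linearIsometryEquiv.symm v with hw
  have hnw : ‖w‖ = ‖v‖ := by simp [hw]
  set W' : V → X → ℝ := fun v ω => W v ω - ⟪v, a o -ᵥ o⟫ with hW'
  have I' : IsIsonormal m μ (a o) W' := I.rebase (a o)
  have hx : a (w +ᵥ o) = v +ᵥ a o := by simp [hw]
  -- `D` is the density of `μ (w +ᵥ o)` relative to `μ o`, and `D'` that of the image measures,
  -- relative to `μ (a o)`. The integrals of D², of (D' ∘ τ)² and of D · (D' ∘ τ) against `μ o` all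
  -- equal exp ‖v‖², so D = D' ∘ τ almost everywhere, and taking logarithms gives the claim.
  set D := cameronMartin W w
  set D' := cameronMartin W' v
  have hD : Measurable D := I.measurable_cameronMartin w
  have hD' : Measurable D' := I'.measurable_cameronMartin v
  have hDD : ∫ ω, D ω * D ω ∂(μ o) = Real.exp (‖v‖ ^ 2) := by
    rw [I.integral_cameronMartin_mul, real_inner_self_eq_norm_sq, hnw]
  have hDDi : Integrable (fun ω => D ω * D ω) (μ o) := I.integrable_cameronMartin_mul w w
  have hD'D' : ∫ ω, D' (τ ω) * D' (τ ω) ∂(μ o) = Real.exp (‖v‖ ^ 2) := by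
    have := integral_map (μ := μ o) hτ.aemeasurable
      (f := fun ω => D' ω * D' ω) (hD'.mul hD').aestronglyMeasurable
    rw [← this, h o, I'.integral_cameronMartin_mul, real_inner_self_eq_norm_sq]
  have hD'D'i : Integrable (fun ω => D' (τ ω) * D' (τ ω)) (μ o) := by
    have := I'.integrable_cameronMartin_mul v v
    rw [← h o] at this
    exact this.comp_measurable hτ
  have hvx : (w +ᵥ o) -ᵥ o = w := by simp
  have hvx' : a (w +ᵥ o) -ᵥ a o = v := by rw [hx]; simp
  have hDD' : ∫ ω, D ω * D' (τ ω) ∂(μ o) = Real.exp (‖v‖ ^ 2) := by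
    have h1 := I.integral_eq (w +ᵥ o) (fun ω => D' (τ ω))
    rw [hvx] at h1
    rw [← h1, ← integral_map hτ.aemeasurable hD'.aestronglyMeasurable, h,
      I'.integral_eq, hvx', I'.integral_cameronMartin_mul, real_inner_self_eq_norm_sq]
  have hDD'i : Integrable (fun ω => D ω * D' (τ ω)) (μ o) := by
    have h1 := I.integrable_iff (w +ᵥ o) (fun ω => D' (τ ω))
    rw [hvx] at h1
    rw [← h1]
    have h2 : Integrable D' (μ (a (w +ᵥ o))) := by
      rw [I'.integrable_iff, hvx']
      exact I'.integrable_cameronMartin_mul v v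
    rw [← h] at h2
    exact h2.comp_measurable hτ
  have hzero : ∫ ω, (D ω - D' (τ ω)) ^ 2 ∂(μ o) = 0 := by
    have h1 : (fun ω => (D ω - D' (τ ω)) ^ 2) = fun ω =>
        (D ω * D ω - 2 * (D ω * D' (τ ω))) + D' (τ ω) * D' (τ ω) := by
      funext ω; ring
    have h2 : Integrable (fun ω => D ω * D ω - 2 * (D ω * D' (τ ω))) (μ o) :=
      hDDi.sub (hDD'i.const_mul 2)
    rw [h1, integral_add h2 hD'D'i, integral_sub hDDi (hDD'i.const_mul 2), integral_const_mul,
      hDD, hDD', hD'D']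
    ring
  have hint : Integrable (fun ω => (D ω - D' (τ ω)) ^ 2) (μ o) := by
    refine ((hDDi.sub (hDD'i.const_mul 2)).add hD'D'i).congr (ae_of_all _ fun ω => ?_)
    simp only [Pi.add_apply, Pi.sub_apply]
    ring
  rw [integral_eq_zero_iff_of_nonneg (fun ω => sq_nonneg _) hint] at hzero
  filter_upwards [(I.ac' o).ae_eq hzero] with ω hω
  have h1 : D ω = D' (τ ω) := by
    have : D ω - D' (τ ω) = 0 := by simpa using hω
    linarith
  have h2 := Real.exp_injective h1
  simp only [hW', hnw] at h2
  linarith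

theorem memLp_exp (I : IsIsonormal m μ o W) (x : P) (v : V) :
    MemLp (fun ω => Real.exp (W v ω)) 2 (μ x) := by
  have hm := I.meas v
  refine (memLp_two_iff_integrable_sq (Measurable.aestronglyMeasurable (by fun_prop))).2 ?_
  refine (I.integrable_exp_mul x v 2).congr (ae_of_all _ fun ω => ?_)
  simp only [← Real.exp_nat_mul]
  norm_num

/-- Exponentials multiplied by an almost everywhere nonzero function are total in `L²`. -/
theorem topologicalClosure_span_eq_top (I : IsIsonormal m μ o W) {k : X → ℝ} (hk : Measurable k)
    (hk0 : ∀ᵐ ω ∂m, k ω ≠ 0) (hmem : ∀ v, MemLp (fun ω => k ω * Real.exp (W v ω)) 2 m) :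
    (Submodule.span ℝ (Set.range fun v => (hmem v).toLp)).topologicalClosure = ⊤ := by
  rw [Submodule.topologicalClosure_eq_top_iff, Submodule.eq_bot_iff]
  intro f hf
  have hv : ∀ v, ∫ ω, f ω * (k ω * Real.exp (W v ω)) ∂m = 0 := by
    intro v
    have h1 := (Submodule.mem_orthogonal _ _).1 hf _ (Submodule.subset_span ⟨v, rfl⟩)
    rw [L2.inner_def] at h1
    rw [← h1]
    refine integral_congr_ae ?_
    filter_upwards [(hmem v).coeFn_toLp] with ω hω
    rw [hω]
    simp
  have hi : ∀ v, Integrable (fun ω => f ω * (k ω * Real.exp (W v ω))) m := fun v =>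
    (Lp.memLp f).integrable_mul (hmem v)
  have hfk : (fun ω => f ω * k ω) =ᵐ[m] 0 := by
    refine I.ae_eq_zero_of_integral_mul_exp_eq_zero
      ((Lp.stronglyMeasurable f).measurable.mul hk) (fun v => ?_) fun v => ?_
    · simpa only [mul_assoc] using hi v
    · simpa only [mul_assoc] using hv v
  rw [Lp.eq_zero_iff_ae_eq_zero]
  filter_upwards [hfk, hk0] with ω h1 h2
  simpa [h2] using h1

/-- Linear combinations of the densities of the measures `μ x` are dense in `L¹`. -/
theorem exists_integral_abs_sub_lt (I : IsIsonormal m μ o W) {f : X → ℝ}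
    (hf : Integrable f (μ o)) {ε : ℝ} (hε : 0 < ε) :
    ∃ (s : Finset V) (c : V → ℝ),
      ∫ ω, |f ω - ∑ v ∈ s, c v * cameronMartin W v ω| ∂(μ o) < ε := by
  have := I.prob o
  obtain ⟨g, hg, -⟩ := (memLp_one_iff_integrable.2 hf).exists_simpleFunc_eLpNorm_sub_lt
    (by simp) (ε := ENNReal.ofReal (ε / 2)) (by simpa using hε)
  have Io : IsIsonormal (μ o) μ o W := I.congr_measure (I.ac o) (I.ac' o)
  have hmem : ∀ v, MemLp (fun ω => 1 * Real.exp (W v ω)) 2 (μ o) := by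
    simpa using I.memLp_exp o
  have hg2 : MemLp g 2 (μ o) := g.memLp_of_isFiniteMeasure 2 _
  obtain ⟨c, hc⟩ := exists_finsupp_norm_toLp_sub_lt hmem
    (Io.topologicalClosure_span_eq_top (k := fun _ => 1) measurable_const (by simp) hmem)
    hg2.toLp (ε := ε / 2) (by positivity)
  set H : X → ℝ := fun ω => ∑ v ∈ c.support, c v * (1 * Real.exp (W v ω)) with hH
  -- The factor exp(‖v‖²/2) undoes the normalisation of `cameronMartin`.
  refine ⟨c.support, fun v => c v * Real.exp (‖v‖ ^ 2 / 2), ?_⟩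
  have hsum : ∀ ω, ∑ v ∈ c.support, c v * Real.exp (‖v‖ ^ 2 / 2) * cameronMartin W v ω = H ω := by
    intro ω
    refine Finset.sum_congr rfl fun v _ => ?_
    rw [cameronMartin, mul_assoc, ← Real.exp_add, one_mul]
    congr 2; ring
  simp only [hsum]
  have hHae := coeFn_finsuppSum_toLp hmem c
  have hH2 : MemLp H 2 (μ o) := (memLp_congr_ae hHae).1 (Lp.memLp _)
  have h2 : eLpNorm (fun ω => g ω - H ω) 1 (μ o) < ENNReal.ofReal (ε / 2) := by
    have hgH : MemLp (fun ω => g ω - H ω) 2 (μ o) := hg2.sub hH2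
    refine (eLpNorm_le_eLpNorm_of_exponent_le (q := 2) (by norm_num)
      hgH.aestronglyMeasurable).trans_lt ?_
    rw [Lp.norm_def] at hc
    rw [← ENNReal.ofReal_toReal hgH.eLpNorm_ne_top]
    refine (ENNReal.ofReal_lt_ofReal_iff (by positivity)).2 ?_
    refine lt_of_eq_of_lt ?_ hc
    congr 1
    refine eLpNorm_congr_ae ?_
    filter_upwards [hg2.coeFn_toLp, hHae, Lp.coeFn_sub hg2.toLp
      (c.sum fun i a => a • (hmem i).toLp)] with ω h1 h2 h3
    rw [h3, Pi.sub_apply, h1, h2]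
  have hHi : Integrable H (μ o) := hH2.integrable (by norm_num)
  have hgi : Integrable g (μ o) := hg2.integrable (by norm_num)
  have e1 : ∀ k : X → ℝ, Integrable k (μ o) → eLpNorm k 1 (μ o) < ENNReal.ofReal (ε / 2) →
      ∫ ω, |k ω| ∂(μ o) < ε / 2 := by
    intro k hk hlt
    rw [eLpNorm_one_eq_lintegral_enorm, ← ofReal_integral_norm_eq_lintegral_enorm hk] at hlt
    exact (ENNReal.ofReal_lt_ofReal_iff (by positivity)).1 hlt
  calc ∫ ω, |f ω - H ω| ∂(μ o)
      ≤ ∫ ω, (|f ω - g ω| + |g ω - H ω|) ∂(μ o) :=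
        integral_mono (hf.sub hHi).abs ((hf.sub hgi).abs.add (hgi.sub hHi).abs)
          fun ω => abs_sub_le _ _ _
    _ = ∫ ω, |f ω - g ω| ∂(μ o) + ∫ ω, |g ω - H ω| ∂(μ o) :=
        integral_add (hf.sub hgi).abs (hgi.sub hHi).abs
    _ < ε / 2 + ε / 2 := add_lt_add (e1 _ (hf.sub hgi) hg) (e1 _ (hgi.sub hHi) h2)
    _ = ε := by ring

/-- Continuity in total variation of a family of maps that acts on the measures `μ x` as an affine
isometric action does. -/
theorem tendsto_totalVariation (I : IsIsonormal m μ o W) {G : Type*} [Group G]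
    [TopologicalSpace G] {α : G →* (P ≃ᵃⁱ[ℝ] P)} (hα : ∀ x : P, Continuous fun g => α g x)
    {act : G → X → X} (hact : ∀ g, Measurable (act g)) (h : ∀ g x, (μ x).map (act g) = μ (α g x))
    (η : Measure X) [IsProbabilityMeasure η] (hη : η ≪ m) :
    Tendsto (fun g => ((η.map (act g)).toSignedMeasure - η.toSignedMeasure).totalVariation
      Set.univ) (𝓝 1) (𝓝 0) := by
  have := I.prob o
  have hηo : η ≪ μ o := hη.trans (I.ac' o)
  rw [ENNReal.tendsto_nhds_zero]
  intro ε hε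
  rcases eq_or_ne ε ∞ with rfl | hεt
  · exact Eventually.of_forall fun _ => le_top
  -- Three errors of size δ are made on each measurable set: η is replaced by a combination of
  -- measures `μ (v +ᵥ o)` before and after applying g, and g moves those measures slightly. Passing
  -- to total variation doubles the sum.
  set δ : ℝ := ε.toReal / 6 with hδ
  have hδ0 : 0 < δ := by have := ENNReal.toReal_pos hε.ne' hεt; positivity
  set f : X → ℝ := fun ω => (η.rnDeriv (μ o) ω).toReal with hf
  have hfi : Integrable f (μ o) := Measure.integrable_toReal_rnDeriv
  obtain ⟨s, c, hsc⟩ := I.exists_integral_abs_sub_lt hfi hδ0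
  set H : X → ℝ := fun ω => ∑ v ∈ s, c v * cameronMartin W v ω with hH
  have hHi : Integrable H (μ o) :=
    integrable_finsetSum _ fun v _ => (I.integrable_cameronMartin v).const_mul _
  have hind : ∀ B : Set X, MeasurableSet B →
      |η.real B - ∑ v ∈ s, c v * (μ (v +ᵥ o)).real B| ≤ δ := by
    intro B hB
    have h1 : η.real B = ∫ ω in B, f ω ∂(μ o) := by
      rw [Measure.setIntegral_toReal_rnDeriv hηo]
    have h2 : ∑ v ∈ s, c v * (μ (v +ᵥ o)).real B = ∫ ω in B, H ω ∂(μ o) := by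
      rw [hH, integral_finsetSum _ fun v _ =>
        ((I.integrable_cameronMartin v).const_mul _).integrableOn]
      refine Finset.sum_congr rfl fun v _ => ?_
      have := I.prob (v +ᵥ o)
      rw [integral_const_mul]
      congr 1
      have h3 := I.integral_eq (v +ᵥ o) (B.indicator 1)
      rw [integral_indicator_one hB, vadd_vsub] at h3
      rw [h3, ← integral_indicator hB]
      refine integral_congr_ae (ae_of_all _ fun ω => ?_)
      by_cases hω : ω ∈ B <;> simp [hω]
    rw [h1, h2, ← integral_sub hfi.integrableOn hHi.integrableOn]
    refine (abs_integral_le_integral_abs).trans (le_trans ?_ hsc.le)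
    exact setIntegral_le_integral (hfi.sub hHi).abs (ae_of_all _ fun _ => abs_nonneg _)
  have hlim : Tendsto (fun g => ∑ v ∈ s, |c v| * √(Real.exp
      (dist (α g (v +ᵥ o)) (v +ᵥ o) ^ 2) - 1)) (𝓝 1) (𝓝 0) := by
    have h0 : (0 : ℝ) = ∑ v ∈ s, |c v| * √(Real.exp
      (dist (α 1 (v +ᵥ o)) (v +ᵥ o) ^ 2) - 1) := by
      simp only [map_one, AffineIsometryEquiv.coe_one, id, dist_self]
      simp
    rw [h0]
    refine Continuous.tendsto ?_ 1
    refine continuous_finsetSum _ fun v _ => ?_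
    have := hα (v +ᵥ o)
    fun_prop
  filter_upwards [hlim.eventually (gt_mem_nhds hδ0)] with g hg
  have hε' : ε = ENNReal.ofReal (2 * (3 * δ)) := by
    rw [hδ, show 2 * (3 * (ε.toReal / 6)) = ε.toReal by ring, ENNReal.ofReal_toReal hεt]
  rw [hε']
  refine totalVariation_univ_le fun A hA => ?_
  have : IsProbabilityMeasure (η.map (act g)) :=
    Measure.isProbabilityMeasure_map (hact g).aemeasurable
  rw [Measure.toSignedMeasure_sub_apply hA, map_measureReal_apply (hact g) hA]
  have h1 := hind _ (hact g hA)
  have h2 := hind _ hA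
  have h3 : |∑ v ∈ s, c v * (μ (v +ᵥ o)).real (act g ⁻¹' A) -
      ∑ v ∈ s, c v * (μ (v +ᵥ o)).real A| ≤ δ := by
    rw [← Finset.sum_sub_distrib]
    refine (Finset.abs_sum_le_sum_abs _ _).trans (le_trans (Finset.sum_le_sum fun v _ => ?_) hg.le)
    rw [← mul_sub, abs_mul]
    refine mul_le_mul_of_nonneg_left ?_ (abs_nonneg _)
    have h4 := (I.rebase (v +ᵥ o)).abs_integral_sub_integral_le (α g (v +ᵥ o))
      (f := A.indicator 1) (M := 1)
      (stronglyMeasurable_one.indicator hA).aestronglyMeasurable (ae_of_all _ fun ω => by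
        by_cases hω : ω ∈ A <;> simp [hω])
    rw [integral_indicator_one hA, integral_indicator_one hA, one_mul, ← h,
      map_measureReal_apply (hact g) hA] at h4
    exact h4
  rw [abs_le] at h1 h2 h3 ⊢
  constructor <;> linarith [h1.1, h1.2, h2.1, h2.2, h3.1, h3.2]

end IsIsonormal

end Isonormal

/-! ### Construction of Gaussian densities and Gaussian actions -/

section Existence

variable {V : Type u} [NormedAddCommGroup V] [InnerProductSpace ℝ V]

/-- Orthonormal vectors are at mutual distance √2 > 1, so the balls of radius 1/2 around them are
disjoint nonempty open sets. -/
theorem _root_.Orthonormal.countable_of_separableSpace [TopologicalSpace.SeparableSpace V]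
    {ι : Type*} {b : ι → V} (hb : Orthonormal ℝ b) : Countable ι := by
  have hdist : ∀ i j, i ≠ j → 1 < dist (b i) (b j) := by
    intro i j hij
    have h1 : dist (b i) (b j) ^ 2 = 2 := by
      rw [dist_eq_norm, norm_sub_sq_real, hb.1, hb.1, hb.2 hij]; norm_num
    nlinarith [dist_nonneg (x := b i) (y := b j)]
  have hdisj : (Set.univ : Set ι).PairwiseDisjoint fun i => Metric.ball (b i) (1 / 2) := by
    intro i _ j _ hij
    refine Metric.ball_disjoint_ball ?_
    linarith [hdist i j hij]
  exact Set.countable_univ_iff.1 (hdisj.countable_of_isOpen (fun i _ => Metric.isOpen_ball)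
    fun i _ => ⟨b i, Metric.mem_ball_self (by norm_num)⟩)

/-- The standard Gaussian measure on `ι → ℝ`. -/
def stdGaussianPi (ι : Type*) : Measure (ι → ℝ) := Measure.infinitePi fun _ => gaussianReal 0 1

instance (ι : Type*) : IsProbabilityMeasure (stdGaussianPi ι) := by
  unfold stdGaussianPi; infer_instance

theorem map_eval_stdGaussianPi {ι : Type*} (i : ι) :
    (stdGaussianPi ι).map (fun ω => ω i) = gaussianReal 0 1 :=
  Measure.infinitePi_map_eval (fun _ => gaussianReal 0 1) i

theorem iIndepFun_stdGaussianPi {ι : Type*} (c : ι → ℝ) :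
    iIndepFun (fun i (ω : ι → ℝ) => c i * ω i) (stdGaussianPi ι) :=
  iIndepFun_infinitePi (X := fun i x => c i * x) fun i => by fun_prop

theorem map_sum_stdGaussianPi {ι : Type*} (s : Finset ι) (c : ι → ℝ) :
    (stdGaussianPi ι).map (fun ω => ∑ i ∈ s, c i * ω i) =
      gaussianReal 0 (∑ i ∈ s, ‖c i‖₊ ^ 2) := by
  classical
  induction s using Finset.induction_on with
  | empty => simp [gaussianReal_zero_var, Measure.map_const]
  | insert a s ha ih =>
    have h1 : (stdGaussianPi ι).map (fun ω => c a * ω a) = gaussianReal 0 (‖c a‖₊ ^ 2) := by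
      have : (fun ω : ι → ℝ => c a * ω a) = (fun x => c a * x) ∘ fun ω => ω a := rfl
      rw [this, ← Measure.map_map (by fun_prop) (by fun_prop), map_eval_stdGaussianPi,
        gaussianReal_map_const_mul]
      congr 1
      · simp
      · ext; simp
    have hind := ((iIndepFun_stdGaussianPi c).indepFun_finsetSum_of_notMem (fun i => by fun_prop)
      ha).symm
    have ih' : (stdGaussianPi ι).map (∑ i ∈ s, fun ω : ι → ℝ => c i * ω i) =
        gaussianReal 0 (∑ i ∈ s, ‖c i‖₊ ^ 2) := by
      rw [← ih]; congr 1; funext ω; simp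
    have := gaussianReal_add_gaussianReal_of_indepFun hind h1 ih'
    rw [Finset.sum_insert ha]
    rw [add_zero] at this
    rw [← this]
    congr 1
    funext ω
    simp [Finset.sum_insert ha]

theorem memLp_eval_stdGaussianPi {ι : Type*} (i : ι) :
    MemLp (fun ω : ι → ℝ => ω i) 2 (stdGaussianPi ι) := by
  have h := memLp_id_gaussianReal (μ := 0) (v := 1) 2
  have hm : AEMeasurable (fun ω : ι → ℝ => ω i) (stdGaussianPi ι) :=
    (measurable_pi_apply i).aemeasurable
  rw [← map_eval_stdGaussianPi i] at h
  exact (memLp_map_measure_iff (by fun_prop) hm).1 h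

/-- Independence and mean zero give orthogonality, variance one gives the norm. This is what lets
the assignment of coordinates to basis vectors extend to an isometry of `V` into L². -/
theorem orthonormal_eval_stdGaussianPi (ι : Type*) :
    Orthonormal ℝ fun i : ι => (memLp_eval_stdGaussianPi i).toLp := by
  classical
  have hi : ∀ i : ι, Integrable (fun ω : ι → ℝ => ω i) (stdGaussianPi ι) := fun i =>
    (memLp_eval_stdGaussianPi i).integrable (by norm_num)
  have hmean : ∀ i : ι, ∫ ω, ω i ∂(stdGaussianPi ι) = 0 := fun i => by
    have h := integral_id_gaussianReal (μ := 0) (v := 1)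
    rw [← map_eval_stdGaussianPi i, integral_map (measurable_pi_apply i).aemeasurable (by fun_prop)] at h
    exact h
  have hinner : ∀ i j : ι, ⟪(memLp_eval_stdGaussianPi i).toLp, (memLp_eval_stdGaussianPi j).toLp⟫ =
      ∫ ω, ω i * ω j ∂(stdGaussianPi ι) := by
    intro i j
    rw [L2.inner_def]
    refine integral_congr_ae ?_
    filter_upwards [(memLp_eval_stdGaussianPi i).coeFn_toLp,
      (memLp_eval_stdGaussianPi j).coeFn_toLp] with ω h1 h2
    rw [h1, h2]; simp [mul_comm]
  rw [orthonormal_iff_ite]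
  intro i j
  rw [hinner]
  split_ifs with hij
  · subst hij
    have hm : AEMeasurable (fun ω : ι → ℝ => ω i) (stdGaussianPi ι) :=
      (measurable_pi_apply i).aemeasurable
    have hvar := variance_id_gaussianReal (μ := 0) (v := 1)
    rw [← map_eval_stdGaussianPi i, variance_map (by fun_prop) hm, Function.id_comp,
      variance_eq_sub (memLp_eval_stdGaussianPi i)] at hvar
    simp only [Pi.pow_apply, hmean] at hvar
    simpa [pow_two] using hvar
  · have hind := (iIndepFun_stdGaussianPi (fun _ : ι => (1 : ℝ))).indepFun hij
    simp only [one_mul] at hind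
    have := hind.integral_fun_mul_eq_mul_integral (hi i).aestronglyMeasurable
      (hi j).aestronglyMeasurable
    rw [this, hmean, zero_mul]

/-- The isonormal process indexed by a Hilbert space with an orthonormal basis. -/
def isonormalMap [CompleteSpace V] {ι : Type*} (b : HilbertBasis ι ℝ V) :
    V →ₗᵢ[ℝ] Lp ℝ 2 (stdGaussianPi ι) :=
  (orthonormal_eval_stdGaussianPi ι).orthogonalFamily.linearIsometry.comp
    b.repr.toLinearIsometry

theorem isonormalMap_basis [CompleteSpace V] {ι : Type*} (b : HilbertBasis ι ℝ V) (i : ι) :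
    isonormalMap b (b i) =ᵐ[stdGaussianPi ι] fun ω => ω i := by
  classical
  have : isonormalMap b (b i) = (memLp_eval_stdGaussianPi i).toLp := by
    simp [isonormalMap, HilbertBasis.repr_self, OrthogonalFamily.linearIsometry_apply_single]
  rw [this]
  exact (memLp_eval_stdGaussianPi i).coeFn_toLp

theorem isonormalMap_sum [CompleteSpace V] {ι : Type*} (b : HilbertBasis ι ℝ V) (s : Finset ι)
    (c : ι → ℝ) :
    isonormalMap b (∑ i ∈ s, c i • b i) =ᵐ[stdGaussianPi ι] fun ω => ∑ i ∈ s, c i * ω i := by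
  rw [map_sum]
  have h1 : ∀ᵐ ω ∂(stdGaussianPi ι), ∀ i ∈ s, (isonormalMap b (c i • b i)) ω = c i * ω i := by
    refine (Finset.eventually_all s).2 fun i _ => ?_
    rw [map_smul]
    filter_upwards [Lp.coeFn_smul (c i) (isonormalMap b (b i)), isonormalMap_basis b i]
      with ω h1 h2
    rw [h1, Pi.smul_apply, h2, smul_eq_mul]
  filter_upwards [h1, Lp.coeFn_fun_finsetSum s fun i => isonormalMap b (c i • b i)] with ω h1 h2
  rw [h2]
  exact Finset.sum_congr rfl h1

/-- From |exp(ia) - exp(ib)| ≤ |a - b| and the domination of the L¹ norm by the L² norm on a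
probability space. It makes laws depend continuously on the variable, so a law known on a dense set
is known everywhere. -/
theorem norm_charFun_map_sub_le {X : Type*} [MeasurableSpace X] {p : Measure X}
    [IsProbabilityMeasure p] (f g : Lp ℝ 2 p) (t : ℝ) :
    ‖charFun (p.map f) t - charFun (p.map g) t‖ ≤ |t| * ‖f - g‖ := by
  have hm : ∀ f : Lp ℝ 2 p, Measurable f := fun f => (Lp.stronglyMeasurable f).measurable
  have hval : ∀ f : Lp ℝ 2 p, charFun (p.map f) t = ∫ ω, Complex.exp (t * f ω * Complex.I) ∂p := by
    intro f
    rw [charFun_apply_real, integral_map (hm f).aemeasurable (by fun_prop)]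
  have hi : ∀ f : Lp ℝ 2 p, Integrable (fun ω => Complex.exp (t * f ω * Complex.I)) p := by
    intro f
    have := hm f
    refine Integrable.of_bound (Measurable.aestronglyMeasurable (by fun_prop)) 1
      (ae_of_all _ fun ω => ?_)
    rw [← Complex.ofReal_mul, Complex.norm_exp_ofReal_mul_I]
  have hfg : Integrable (fun ω => f ω - g ω) p :=
    ((Lp.memLp f).sub (Lp.memLp g)).integrable (by norm_num)
  rw [hval, hval, ← integral_sub (hi f) (hi g)]
  calc ‖∫ ω, (Complex.exp (t * f ω * Complex.I) - Complex.exp (t * g ω * Complex.I)) ∂p‖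
      ≤ ∫ ω, ‖Complex.exp (t * f ω * Complex.I) - Complex.exp (t * g ω * Complex.I)‖ ∂p :=
        norm_integral_le_integral_norm _
    _ ≤ ∫ ω, |t| * |f ω - g ω| ∂p := by
        refine integral_mono ((hi f).sub (hi g)).norm (hfg.abs.const_mul _) fun ω => ?_
        have h1 := Real.norm_exp_I_mul_ofReal_sub_one_le (x := t * f ω - t * g ω)
        have h2 : Complex.exp (t * f ω * Complex.I) - Complex.exp (t * g ω * Complex.I) =
            Complex.exp ((t * g ω : ℝ) * Complex.I) *
              (Complex.exp (Complex.I * (t * f ω - t * g ω : ℝ)) - 1) := by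
          rw [mul_sub, ← Complex.exp_add]
          push_cast
          ring_nf
        dsimp only
        rw [h2, norm_mul, Complex.norm_exp_ofReal_mul_I, one_mul, ← abs_mul, mul_sub]
        exact h1
    _ ≤ |t| * ‖f - g‖ := by
        rw [integral_const_mul]
        refine mul_le_mul_of_nonneg_left ?_ (abs_nonneg _)
        have hae : ⇑(f - g) =ᵐ[p] fun ω => f ω - g ω := Lp.coeFn_sub f g
        have h2 := eLpNorm_le_eLpNorm_of_exponent_le (p := 1) (q := 2) (μ := p) (by norm_num)
          (Lp.memLp (f - g)).aestronglyMeasurable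
        have h3 := ENNReal.toReal_mono (Lp.memLp (f - g)).eLpNorm_ne_top h2
        rw [← Lp.norm_def, eLpNorm_congr_ae hae, eLpNorm_one_eq_lintegral_enorm,
          ← ofReal_integral_norm_eq_lintegral_enorm hfg,
          ENNReal.toReal_ofReal (integral_nonneg fun _ => norm_nonneg _)] at h3
        exact h3

/-- On finite combinations of basis vectors the law is that of a sum of independent normals. Both
characteristic functions are continuous in v and the span of the basis is dense. -/
theorem map_isonormalMap [CompleteSpace V] {ι : Type*} (b : HilbertBasis ι ℝ V) (v : V) :
    (stdGaussianPi ι).map (isonormalMap b v) = gaussianReal 0 (‖v‖₊ ^ 2) := by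
  classical
  have hm : ∀ v, Measurable (isonormalMap b v) := fun v =>
    (Lp.stronglyMeasurable _).measurable
  have hprob : ∀ v, IsProbabilityMeasure ((stdGaussianPi ι).map (isonormalMap b v)) := fun v =>
    Measure.isProbabilityMeasure_map (hm v).aemeasurable
  refine Measure.ext_of_charFun (funext fun t => ?_)
  have hcont : Continuous fun v => charFun ((stdGaussianPi ι).map (isonormalMap b v)) t := by
    refine (LipschitzWith.of_dist_le_mul (K := ‖t‖₊) fun v w => ?_).continuous
    rw [dist_eq_norm, dist_eq_norm]
    refine (norm_charFun_map_sub_le _ _ t).trans ?_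
    rw [← map_sub, LinearIsometry.norm_map]
    rfl
  have hcont' : Continuous fun v : V => charFun (gaussianReal 0 (‖v‖₊ ^ 2)) t := by
    simp_rw [charFun_gaussianReal]
    have : Continuous fun v : V => ((‖v‖₊ ^ 2 : ℝ≥0) : ℝ) := by fun_prop
    fun_prop
  have hdense : Dense (Submodule.span ℝ (Set.range b) : Set V) :=
    Submodule.dense_iff_topologicalClosure_eq_top.2 b.dense_span
  refine congrFun (Continuous.ext_on hdense hcont hcont' fun v hv => ?_) v
  obtain ⟨c, rfl⟩ := Finsupp.mem_span_range_iff_exists_finsupp.1 hv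
  congr 1
  rw [Finsupp.sum, Measure.map_congr (isonormalMap_sum b c.support c), map_sum_stdGaussianPi]
  congr 1
  ext
  push_cast
  rw [← real_inner_self_eq_norm_sq, b.orthonormal.inner_sum]
  exact Finset.sum_congr rfl fun i _ => by simp [pow_two]

section Construction

variable {P : Type w} [MetricSpace P] [NormedAddTorsor V P] {X : Type z} [MeasurableSpace X]

/-- The Gaussian density built from a centered isonormal process. -/
def translatedMeasure (p : Measure X) (W : V → X → ℝ) (o x : P) : Measure X :=
  p.withDensity fun ω => ENNReal.ofReal (cameronMartin W (x -ᵥ o) ω)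

/-- The Cameron–Martin formula is read as a definition: tilting by exp W(x - o) multiplies the
moment generating function of `W v` at t by exp(t⟪v, x - o⟫), which is exactly a shift of the mean.
-/
theorem isIsonormal_translatedMeasure {p : Measure X} [IsProbabilityMeasure p] {W : V → X → ℝ}
    (o : P) (hmeas : ∀ v, Measurable (W v))
    (hadd : ∀ v w, W (v + w) =ᵐ[p] fun x => W v x + W w x)
    (hsmul : ∀ (c : ℝ) v, W (c • v) =ᵐ[p] fun x => c * W v x)
    (hlaw : ∀ v, p.map (W v) = gaussianReal 0 (‖v‖₊ ^ 2))
    (hsep : ∀ ν₁ ν₂ : Measure X, IsFiniteMeasure ν₁ → IsFiniteMeasure ν₂ → ν₁ ≪ p → ν₂ ≪ p →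
      (∀ v, ν₁.map (W v) = ν₂.map (W v)) → ν₁ = ν₂) :
    IsIsonormal p (translatedMeasure p W o) o W := by
  have hexp : ∀ v, Integrable (fun ω => Real.exp (W v ω)) p := fun v => by
    have h := integrable_exp_mul_gaussianReal (μ := 0) (v := ‖v‖₊ ^ 2) 1
    rw [← hlaw v] at h
    simpa [Function.comp_def] using h.comp_measurable (hmeas v)
  have hexpi : ∀ v, ∫ ω, Real.exp (W v ω) ∂p = Real.exp (‖v‖ ^ 2 / 2) := fun v => by
    have h := mgf_gaussianReal (hlaw v) 1
    simpa [mgf] using h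
  have hcm : ∀ v, Measurable (cameronMartin W v) := fun v => by
    have := hmeas v
    unfold cameronMartin
    fun_prop
  have hcm' : ∀ v ω, cameronMartin W v ω = Real.exp (-(‖v‖ ^ 2 / 2)) * Real.exp (W v ω) := by
    intro v ω; rw [← Real.exp_add, cameronMartin]; congr 1; ring
  have hcmi : ∀ v, Integrable (cameronMartin W v) p := fun v => by
    rw [show cameronMartin W v = fun ω => Real.exp (-(‖v‖ ^ 2 / 2)) * Real.exp (W v ω) from
      funext (hcm' v)]
    exact (hexp v).const_mul _
  have hcm1 : ∀ v, ∫ ω, cameronMartin W v ω ∂p = 1 := fun v => by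
    simp_rw [hcm', integral_const_mul, hexpi, ← Real.exp_add]
    simp
  have hprob : ∀ x, IsProbabilityMeasure (translatedMeasure p W o x) := fun x => by
    constructor
    rw [translatedMeasure, withDensity_apply _ MeasurableSet.univ, Measure.restrict_univ,
      ← ofReal_integral_eq_lintegral_ofReal (hcmi _)
        (ae_of_all _ fun ω => (cameronMartin_pos _ _ _).le), hcm1, ENNReal.ofReal_one]
  refine ⟨hprob, fun x => withDensity_absolutelyContinuous _ _, fun x => ?_, hmeas, hadd, hsmul,
    fun x v => ?_, hsep⟩
  · refine withDensity_absolutelyContinuous' (hcm _).ennreal_ofReal.aemeasurable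
      (ae_of_all _ fun ω => ?_)
    simpa using cameronMartin_pos _ _ _
  · set ξ := x -ᵥ o
    have := hprob x
    rw [← Measure.map_id (μ := gaussianReal ⟪v, ξ⟫ (‖v‖₊ ^ 2))]
    refine (map_eq_map_of_mgf_eq (X := ℝ) measurable_id.aemeasurable (hmeas v).aemeasurable
      (fun t => integrable_exp_mul_gaussianReal t) fun t => ?_).symm
    have h1 := congrFun (mgf_id_gaussianReal (μ := ⟪v, ξ⟫) (v := ‖v‖₊ ^ 2)) t
    rw [mgf] at h1
    rw [h1, translatedMeasure, integral_withDensity_eq_integral_toReal_smul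
      (hcm _).ennreal_ofReal (by simp)]
    have h2 : ∀ᵐ ω ∂p, (ENNReal.ofReal (cameronMartin W ξ ω)).toReal • Real.exp (t * W v ω) =
        Real.exp (-(‖ξ‖ ^ 2 / 2)) * Real.exp (W (ξ + t • v) ω) := by
      filter_upwards [hadd ξ (t • v), hsmul t v] with ω h1 h2
      rw [ENNReal.toReal_ofReal (cameronMartin_pos _ _ _).le, hcm', h1, h2, Real.exp_add,
        smul_eq_mul, mul_assoc]
    rw [integral_congr_ae h2, integral_const_mul, hexpi, ← Real.exp_add]
    congr 1
    rw [norm_add_sq_real, inner_smul_right, norm_smul, real_inner_comm, mul_pow, Real.norm_eq_abs,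
      sq_abs]
    simp
    ring

theorem isIsonormal_isonormalMap [CompleteSpace V] {ι : Type*} (b : HilbertBasis ι ℝ V) (o : P) :
    IsIsonormal (stdGaussianPi ι)
      (translatedMeasure (stdGaussianPi ι) (fun v => isonormalMap b v) o) o
      (fun v => isonormalMap b v) := by
  refine isIsonormal_translatedMeasure o (fun v => (Lp.stronglyMeasurable _).measurable)
    (fun v w => ?_) (fun c v => ?_) (fun v => map_isonormalMap b v)
    fun ν₁ ν₂ _ _ h₁ h₂ hν => ?_
  · rw [map_add]; exact Lp.coeFn_add _ _
  · rw [map_smul]; exact Lp.coeFn_smul _ _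
  · have h := map_pi_eq_of_forall_map_sum_eq (Y := fun i (ω : ι → ℝ) => ω i)
      (fun i => measurable_pi_apply i) (ν₁ := ν₁) (ν₂ := ν₂) fun s c => by
        have hs := isonormalMap_sum b s c
        rw [← Measure.map_congr (h₁.ae_eq hs), ← Measure.map_congr (h₂.ae_eq hs)]
        exact hν _
    simpa using h

/-- The random variable attached to a continuous affine function. -/
def affineVariable [CompleteSpace V] {ι : Type*} (b : HilbertBasis ι ℝ V) (o : P) :
    (P →ᴬ[ℝ] ℝ) →ₗ[ℝ] ((ι → ℝ) →ₘ[stdGaussianPi ι] ℝ) where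
  toFun f := f o • (1 : (ι → ℝ) →ₘ[stdGaussianPi ι] ℝ) +
    (isonormalMap b ((InnerProductSpace.toDual ℝ V).symm f.contLinear) :
      (ι → ℝ) →ₘ[stdGaussianPi ι] ℝ)
  map_add' f f' := by
    simp only [ContinuousAffineMap.add_apply, ContinuousAffineMap.add_contLinear, map_add,
      add_smul, AddSubgroup.coe_add]
    abel
  map_smul' c f := by
    simp only [ContinuousAffineMap.smul_apply, ContinuousAffineMap.smul_contLinear,
      RingHom.id_apply, smul_add, smul_eq_mul, mul_smul, map_smul]
    rfl

theorem affineVariable_ae_eq [CompleteSpace V] {ι : Type*} (b : HilbertBasis ι ℝ V) (o : P)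
    (f : P →ᴬ[ℝ] ℝ) :
    affineVariable b o f =ᵐ[stdGaussianPi ι] fun ω =>
      f o + isonormalMap b ((InnerProductSpace.toDual ℝ V).symm f.contLinear) ω := by
  filter_upwards [AEEqFun.coeFn_add (f o • (1 : (ι → ℝ) →ₘ[stdGaussianPi ι] ℝ))
    (isonormalMap b ((InnerProductSpace.toDual ℝ V).symm f.contLinear) :
      (ι → ℝ) →ₘ[stdGaussianPi ι] ℝ),
    AEEqFun.coeFn_smul (f o) (1 : (ι → ℝ) →ₘ[stdGaussianPi ι] ℝ),
    AEEqFun.coeFn_one (α := ι → ℝ) (β := ℝ) (μ := stdGaussianPi ι)] with ω h1 h2 h3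
  change (f o • (1 : (ι → ℝ) →ₘ[stdGaussianPi ι] ℝ) + _ : (ι → ℝ) →ₘ[stdGaussianPi ι] ℝ) ω = _
  rw [h1, Pi.add_apply, h2, Pi.smul_apply, h3]
  simp

theorem isGaussianDensity_translatedMeasure [CompleteSpace V] {ι : Type*} [Countable ι]
    (b : HilbertBasis ι ℝ V) (o : P) :
    IsGaussianDensity (stdGaussianPi ι)
      (translatedMeasure (stdGaussianPi ι) (fun v => isonormalMap b v) o) := by
  have I := isIsonormal_isonormalMap b o
  refine ⟨I.prob, I.ac, I.ac', affineVariable b o, fun x f => ?_, fun A hA => ?_⟩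
  · set v := (InnerProductSpace.toDual ℝ V).symm f.contLinear with hv
    rw [Measure.map_congr ((I.ac x).ae_eq (affineVariable_ae_eq b o f))]
    have hcomp : (fun ω => f o + isonormalMap b v ω) =
        (fun t => f o + t) ∘ isonormalMap b v := rfl
    rw [← hv, hcomp, ← Measure.map_map (by fun_prop) (I.meas v), I.law,
      gaussianReal_map_const_add]
    have h2 : ⟪v, x -ᵥ o⟫ = f.contLinear (x -ᵥ o) := by simp [v]
    congr 1
    · rw [h2, f.contLinear_map_vsub, vsub_eq_sub]; ring
    · congr 1
      ext
      simp [hv]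
  -- The chosen representatives of the basis coordinates form a map that is measurable for the
  -- generated σ-algebra and, countably many null sets being discarded, almost everywhere the
  -- identity. The preimage of A under it is the required set.
  · refine ⟨(fun ω i => affineVariable b o (innerAffine o (b i)) ω) ⁻¹' A, ?_, ?_⟩
    · have hψ : @Measurable _ _ (⨆ f, MeasurableSpace.comap (affineVariable b o f) (borel ℝ))
          MeasurableSpace.pi (fun ω i => affineVariable b o (innerAffine o (b i)) ω) := by
        refine @measurable_pi_lambda _ _ _
          (⨆ f, MeasurableSpace.comap (affineVariable b o f) (borel ℝ)) _ _ fun i => ?_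
        exact measurable_iff_comap_le.2 (le_iSup (fun f : P →ᴬ[ℝ] ℝ =>
          MeasurableSpace.comap (affineVariable b o f) (borel ℝ)) (innerAffine o (b i)))
      exact hψ hA
    · have h : ∀ᵐ ω ∂(stdGaussianPi ι), ∀ i,
          affineVariable b o (innerAffine o (b i)) ω = ω i := by
        refine ae_all_iff.2 fun i => ?_
        filter_upwards [affineVariable_ae_eq b o (innerAffine o (b i)), isonormalMap_basis b i]
          with ω h1 h2
        have h3 : (InnerProductSpace.toDual ℝ V).symm (innerSL ℝ (b i)) = b i :=
          (InnerProductSpace.toDual ℝ V).symm_apply_apply (b i)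
        rw [h1, innerAffine_contLinear, h3, h2]
        simp
      filter_upwards [h] with ω hω
      refine eq_iff_iff.2 ?_
      change ω ∈ A ↔ (fun i => affineVariable b o (innerAffine o (b i)) ω) ∈ A
      rw [show (fun i => affineVariable b o (innerAffine o (b i)) ω) = ω from funext hω]

/-- The map of `ι → ℝ` induced by an affine isometry. -/
def gaussianMap [CompleteSpace V] {ι : Type*} (b : HilbertBasis ι ℝ V) (o : P)
    (a : P ≃ᵃⁱ[ℝ] P) (ω : ι → ℝ) (i : ι) : ℝ :=
  isonormalMap b (a.linearIsometryEquiv.symm (b i)) ω + ⟪b i, a o -ᵥ o⟫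

theorem measurable_gaussianMap [CompleteSpace V] {ι : Type*} (b : HilbertBasis ι ℝ V) (o : P)
    (a : P ≃ᵃⁱ[ℝ] P) : Measurable (gaussianMap b o a) :=
  measurable_pi_iff.2 fun _ => (Lp.stronglyMeasurable _).measurable.add_const _

/-- A combination of coordinates belonging to v is pulled back to the variable of the vector a⁰⁻¹ v
plus the constant ⟪v, a o - o⟫. Its mean under the measure of x is ⟪v, a x - o⟫ and its variance is
unchanged, and such laws determine the measure. -/
theorem map_gaussianMap [CompleteSpace V] {ι : Type*} (b : HilbertBasis ι ℝ V) (o : P)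
    (a : P ≃ᵃⁱ[ℝ] P) (x : P) :
    (translatedMeasure (stdGaussianPi ι) (fun v => isonormalMap b v) o x).map (gaussianMap b o a) =
      translatedMeasure (stdGaussianPi ι) (fun v => isonormalMap b v) o (a x) := by
  have I := isIsonormal_isonormalMap b o
  set μ := translatedMeasure (stdGaussianPi ι) (fun v => isonormalMap b v) o
  have hτ := measurable_gaussianMap b o a
  have := I.prob x
  have := I.prob (a x)
  have hp := Measure.isProbabilityMeasure_map (μ := μ x) hτ.aemeasurable
  have h := map_pi_eq_of_forall_map_sum_eq (Y := fun i (ω : ι → ℝ) => ω i)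
    (fun i => measurable_pi_apply i) (ν₁ := (μ x).map (gaussianMap b o a)) (ν₂ := μ (a x)) ?_
  · simpa using h
  intro s c
  set v := ∑ i ∈ s, c i • b i with hv
  have hsm : Measurable fun ω : ι → ℝ => ∑ i ∈ s, c i * ω i := by fun_prop
  rw [← Measure.map_congr ((I.ac (a x)).ae_eq (isonormalMap_sum b s c)), I.law,
    Measure.map_map hsm hτ]
  set w := a.linearIsometryEquiv.symm v with hw
  have hae : ((fun ω : ι → ℝ => ∑ i ∈ s, c i * ω i) ∘ gaussianMap b o a) =ᵐ[stdGaussianPi ι]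
      (fun t => t + ⟪v, a o -ᵥ o⟫) ∘ (isonormalMap b w) := by
    have h1 : isonormalMap b w =
        ∑ i ∈ s, c i • isonormalMap b (a.linearIsometryEquiv.symm (b i)) := by
      simp [hw, hv, map_sum]
    have h2 : ∀ᵐ ω ∂(stdGaussianPi ι), ∀ i ∈ s,
        (c i • isonormalMap b (a.linearIsometryEquiv.symm (b i)) : Lp ℝ 2 (stdGaussianPi ι)) ω =
          c i * isonormalMap b (a.linearIsometryEquiv.symm (b i)) ω := by
      refine (Finset.eventually_all s).2 fun i _ => ?_
      filter_upwards [Lp.coeFn_smul (c i) (isonormalMap b (a.linearIsometryEquiv.symm (b i)))]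
        with ω h1
      rw [h1, Pi.smul_apply, smul_eq_mul]
    filter_upwards [h2, Lp.coeFn_fun_finsetSum s
      fun i => c i • isonormalMap b (a.linearIsometryEquiv.symm (b i))] with ω h2 h3
    rw [← h1] at h3
    simp only [Function.comp_apply]
    rw [h3, Finset.sum_congr rfl h2, hv, sum_inner, ← Finset.sum_add_distrib]
    refine Finset.sum_congr rfl fun i _ => ?_
    rw [gaussianMap, inner_smul_left]
    simp
    ring
  rw [Measure.map_congr ((I.ac x).ae_eq hae), ← Measure.map_map (by fun_prop) (I.meas w), I.law,
    gaussianReal_map_add_const]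
  congr 1
  · have h1 : ⟪w, x -ᵥ o⟫ = ⟪v, a x -ᵥ a o⟫ := by
      rw [← a.map_vsub, hw, ← LinearIsometryEquiv.inner_map_map a.linearIsometryEquiv]
      simp
    rw [h1, ← inner_add_right, vsub_add_vsub_cancel]
  · have hn : ‖w‖₊ = ‖v‖₊ := NNReal.eq (LinearIsometryEquiv.norm_map _ v)
    rw [hn]

/-- The maps are defined coordinatewise from representatives, so the group law holds only almost
everywhere. `coord_comp_ae_eq` settles each coordinate, and countability of the index set settles
all of them at once. -/
theorem gaussianMap_mul [CompleteSpace V] {ι : Type*} [Countable ι] (b : HilbertBasis ι ℝ V)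
    (o : P) (a a' : P ≃ᵃⁱ[ℝ] P) :
    gaussianMap b o (a * a') =ᵐ[stdGaussianPi ι] gaussianMap b o a ∘ gaussianMap b o a' := by
  have I := isIsonormal_isonormalMap b o
  have h : ∀ᵐ ω ∂(stdGaussianPi ι), ∀ i, gaussianMap b o (a * a') ω i =
      gaussianMap b o a (gaussianMap b o a' ω) i := by
    refine ae_all_iff.2 fun i => ?_
    filter_upwards [I.coord_comp_ae_eq (measurable_gaussianMap b o a') (map_gaussianMap b o a')
      (a.linearIsometryEquiv.symm (b i))] with ω hω
    rw [gaussianMap, gaussianMap, hω]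
    have h1 : ⟪a.linearIsometryEquiv.symm (b i), a' o -ᵥ o⟫ = ⟪b i, a (a' o) -ᵥ a o⟫ := by
      rw [← a.map_vsub, ← LinearIsometryEquiv.inner_map_map a.linearIsometryEquiv]
      simp
    rw [h1, add_assoc, ← inner_add_right, vsub_add_vsub_cancel]
    rfl
  filter_upwards [h] with ω hω
  exact funext hω

/-- Every affine isometric action has a Gaussian action on a Gaussian density. -/
theorem exists_gaussianAction [CompleteSpace V] [TopologicalSpace.SeparableSpace V]
    {G : Type v} [Group G] [TopologicalSpace G] (α : G →* (P ≃ᵃⁱ[ℝ] P))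
    (hα : ∀ x : P, Continuous fun g => α g x) :
    ∃ (X : Type u) (_ : MeasurableSpace X) (_ : StandardBorelSpace X) (m : Measure X)
      (_ : SigmaFinite m) (μ : P → Measure X) (σ : NonsingularAction G X m),
      IsGaussianDensity m μ ∧ IsGaussianAction μ α σ := by
  obtain ⟨w, b, -⟩ := exists_hilbertBasis ℝ V
  have hcount : Countable w := b.orthonormal.countable_of_separableSpace
  obtain ⟨o⟩ : Nonempty P := inferInstance
  have I := isIsonormal_isonormalMap b o
  have hzero : translatedMeasure (stdGaussianPi w) (fun v => isonormalMap b v) o o ≪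
      stdGaussianPi w := I.ac o
  refine ⟨w → ℝ, inferInstance, inferInstance, stdGaussianPi w, inferInstance,
    translatedMeasure (stdGaussianPi w) (fun v => isonormalMap b v) o,
    { act := fun g => gaussianMap b o (α g)
      quasiMeasurePreserving := fun g => ⟨measurable_gaussianMap b o _, ?_⟩
      act_one := ?_
      act_mul := fun g h => by
        rw [map_mul]
        exact gaussianMap_mul b o _ _
      tendsto_totalVariation := fun η _ hη => I.tendsto_totalVariation hα
        (fun g => measurable_gaussianMap b o _) (fun g x => map_gaussianMap b o (α g) x) η hη },
    isGaussianDensity_translatedMeasure b o, fun g x => map_gaussianMap b o (α g) x⟩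
  · refine ((I.ac' o).map (measurable_gaussianMap b o (α g))).trans ?_
    rw [map_gaussianMap]
    exact I.ac _
  · have h : ∀ᵐ ω ∂(stdGaussianPi w), ∀ i, gaussianMap b o (α 1) ω i = ω i := by
      refine ae_all_iff.2 fun i => ?_
      filter_upwards [isonormalMap_basis b i] with ω hω
      rw [gaussianMap, map_one]
      have h1 : (1 : P ≃ᵃⁱ[ℝ] P).linearIsometryEquiv.symm (b i) = b i := rfl
      rw [h1, hω]
      simp [AffineIsometryEquiv.coe_one]
    filter_upwards [h] with ω hω
    exact funext hω

end Construction

end Existence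

/-! ### Fixed points and weak limits -/

section FixedPoint

variable {G : Type v} [Group G] {V : Type u} [NormedAddCommGroup V] [InnerProductSpace ℝ V]
  {P : Type w} [MetricSpace P] [NormedAddTorsor V P]

/-- An affine isometric action with a bounded orbit has a fixed point. -/
theorem hasFixedPoint_of_bounded_orbit [CompleteSpace V] (α : G →* (P ≃ᵃⁱ[ℝ] P)) (o : P) (C : ℝ)
    (h : ∀ g, dist (α g o) o ≤ C) : HasFixedPoint α := by
  have hP : CompleteSpace P := (IsometryEquiv.vaddConst o).symm.completeSpace
  -- The squared radii of closed balls containing the orbit. Their infimum ρ is attained at a unique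
  -- point, the circumcentre of the orbit, which the group must fix.
  set S : Set ℝ := {r | ∃ x : P, ∀ g, dist (α g o) x ^ 2 ≤ r} with hS
  have hne : S.Nonempty := ⟨C ^ 2, o, fun g => pow_le_pow_left₀ dist_nonneg (h g) 2⟩
  have hbdd : BddBelow S := ⟨0, fun r ⟨x, hx⟩ => (sq_nonneg _).trans (hx 1)⟩
  set ρ := sInf S
  -- Parallelogram law: if two points have radius² r, their midpoint has radius² r - d²/4, and this
  -- is at least ρ. It yields the Cauchy property, uniqueness of the centre, and hence invariance.
  have key : ∀ (r : ℝ) (x y : P), (∀ g, dist (α g o) x ^ 2 ≤ r) → (∀ g, dist (α g o) y ^ 2 ≤ r) →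
      dist x y ^ 2 ≤ 4 * (r - ρ) := by
    intro r x y hx hy
    have : r - dist x y ^ 2 / 4 ∈ S := by
      refine ⟨midpoint ℝ x y, fun g => ?_⟩
      have := EuclideanGeometry.dist_sq_add_dist_sq_eq_two_mul_dist_midpoint_sq_add_half_dist_sq
        (α g o) x y
      have h1 := hx g
      have h2 := hy g
      ring_nf at this ⊢
      linarith
    have := csInf_le hbdd this
    linarith
  have hex : ∀ n : ℕ, ∃ x : P, ∀ g, dist (α g o) x ^ 2 ≤ ρ + 1 / ((n : ℝ) + 1) := by
    intro n
    obtain ⟨r, ⟨x, hx⟩, hr⟩ := exists_lt_of_csInf_lt hne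
      (lt_add_of_pos_right ρ (Nat.one_div_pos_of_nat (n := n) (α := ℝ)))
    exact ⟨x, fun g => (hx g).trans hr.le⟩
  choose x hx using hex
  have hmono : ∀ N n : ℕ, N ≤ n → 1 / ((n : ℝ) + 1) ≤ 1 / ((N : ℝ) + 1) := fun N n hn =>
    Nat.one_div_le_one_div hn
  have hcauchy : CauchySeq x := by
    refine cauchySeq_of_le_tendsto_0 (fun N : ℕ => √(4 * (1 / ((N : ℝ) + 1))))
      (fun n k N hn hk => ?_) ?_
    · refine Real.le_sqrt_of_sq_le ?_
      have := key (ρ + 1 / ((N : ℝ) + 1)) (x n) (x k)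
        (fun g => (hx n g).trans (by linarith [hmono N n hn]))
        (fun g => (hx k g).trans (by linarith [hmono N k hk]))
      simpa using this
    · have : Tendsto (fun N : ℕ => √(4 * (1 / ((N : ℝ) + 1)))) atTop (𝓝 √(4 * 0)) :=
        (tendsto_one_div_add_atTop_nhds_zero_nat.const_mul 4).sqrt
      simpa using this
  obtain ⟨y, hy⟩ := cauchySeq_tendsto_of_complete hcauchy
  have hyρ : ∀ g, dist (α g o) y ^ 2 ≤ ρ := by
    intro g
    have h1 : Tendsto (fun n => dist (α g o) (x n) ^ 2) atTop (𝓝 (dist (α g o) y ^ 2)) :=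
      (tendsto_const_nhds.dist hy).pow 2
    have h2 : Tendsto (fun n : ℕ => ρ + 1 / ((n : ℝ) + 1)) atTop (𝓝 (ρ + 0)) :=
      tendsto_one_div_add_atTop_nhds_zero_nat.const_add ρ
    rw [add_zero] at h2
    exact le_of_tendsto_of_tendsto' h1 h2 fun n => hx n g
  refine ⟨y, fun k => ?_⟩
  have h1 : ∀ g, dist (α g o) (α k y) ^ 2 ≤ ρ := by
    intro g
    have h2 : α g o = α k (α (k⁻¹ * g) o) := by
      conv_lhs => rw [← mul_inv_cancel_left k g, map_mul]
      rfl
    rw [h2, AffineIsometryEquiv.dist_map]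
    exact hyρ _
  have := key ρ (α k y) y h1 hyρ
  rw [sub_self, mul_zero] at this
  exact dist_eq_zero.1 (pow_eq_zero_iff two_ne_zero |>.1 (le_antisymm this (sq_nonneg _)))

end FixedPoint

section WeakLimit

theorem tendsto_clm_apply_zero_of_total {ι S H : Type*} [NormedAddCommGroup H]
    [InnerProductSpace ℝ H] {l : Filter ι} {e : S → H}
    (he : (Submodule.span ℝ (Set.range e)).topologicalClosure = ⊤)
    {φ : ι → H →L[ℝ] ℝ} {C : ℝ} (hC : ∀ i, ‖φ i‖ ≤ C)
    (h : ∀ s, Tendsto (fun i => φ i (e s)) l (𝓝 0)) (ξ : H) :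
    Tendsto (fun i => φ i ξ) l (𝓝 0) := by
  have hspan : ∀ ζ ∈ Submodule.span ℝ (Set.range e), Tendsto (fun i => φ i ζ) l (𝓝 0) := by
    intro ζ hζ
    induction hζ using Submodule.span_induction with
    | mem x hx => obtain ⟨s, rfl⟩ := hx; exact h s
    | zero => simpa using tendsto_const_nhds
    | add x y _ _ hx hy => simpa using hx.add hy
    | smul c x _ hx => simpa using hx.const_mul c
  have hξ : ξ ∈ closure (Submodule.span ℝ (Set.range e) : Set H) := by
    rw [← Submodule.topologicalClosure_coe, he]; trivial
  rw [Metric.tendsto_nhds]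
  intro ε hε
  obtain ⟨ζ, hζ, hd⟩ := Metric.mem_closure_iff.1 hξ (ε / (2 * (|C| + 1))) (by positivity)
  filter_upwards [(Metric.tendsto_nhds.1 (hspan ζ hζ)) (ε / 2) (by positivity)] with i hi
  rw [dist_zero_right] at hi ⊢
  calc ‖φ i ξ‖ = ‖φ i (ξ - ζ) + φ i ζ‖ := by simp
    _ ≤ ‖φ i (ξ - ζ)‖ + ‖φ i ζ‖ := norm_add_le _ _
    _ ≤ (|C| + 1) * ‖ξ - ζ‖ + ‖φ i ζ‖ := by
        gcongr
        refine ((φ i).le_opNorm _).trans ?_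
        gcongr
        exact (hC i).trans ((le_abs_self _).trans (by linarith))
    _ < (|C| + 1) * (ε / (2 * (|C| + 1))) + ε / 2 := by
        rw [dist_eq_norm] at hd
        gcongr
    _ = ε := by field_simp; ring

/-- The isometries keep the functionals bounded, so the extension from a total set to all vectors
can be carried out in one argument of the inner product after the other. -/
theorem tendsto_inner_zero_of_total {ι S H : Type*} [NormedAddCommGroup H]
    [InnerProductSpace ℝ H] {l : Filter ι} {e : S → H}
    (he : (Submodule.span ℝ (Set.range e)).topologicalClosure = ⊤) {U : ι → H →ₗᵢ[ℝ] H}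
    (h : ∀ s t, Tendsto (fun i => ⟪U i (e s), e t⟫) l (𝓝 0)) (ξ η : H) :
    Tendsto (fun i => ⟪U i ξ, η⟫) l (𝓝 0) := by
  have h1 : ∀ s, Tendsto (fun i => ⟪U i (e s), η⟫) l (𝓝 0) := by
    intro s
    refine tendsto_clm_apply_zero_of_total he (φ := fun i => innerSL ℝ (U i (e s))) (C := ‖e s‖)
      (fun i => ?_) (fun t => h s t) η
    rw [innerSL_apply_norm, LinearIsometry.norm_map]
  have h2 := tendsto_clm_apply_zero_of_total he
    (φ := fun i => (innerSL ℝ η).comp (U i).toContinuousLinearMap) (C := ‖η‖)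
    (fun i => ContinuousLinearMap.opNorm_le_bound _ (norm_nonneg _) fun ζ => ?_)
    (fun s => ?_) ξ (l := l)
  · refine h2.congr fun i => ?_
    simp [real_inner_comm]
  · simpa using norm_inner_le_norm (𝕜 := ℝ) η (U i ζ)
  · refine (h1 s).congr fun i => ?_
    simp [real_inner_comm]

end WeakLimit

/-! ### The Koopman representation -/

section Koopman

variable {G : Type v} [Group G] [TopologicalSpace G] {X : Type z} [MeasurableSpace X]
  {m : Measure X}

namespace NonsingularAction

variable (σ : NonsingularAction G X m)

theorem measurable_act (g : G) : Measurable (σ.act g) := (σ.quasiMeasurePreserving g).measurable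

theorem map_act_ac (g : G) : m.map (σ.act g) ≪ m := (σ.quasiMeasurePreserving g).absolutelyContinuous

theorem act_inv_act (g : G) : ∀ᵐ ω ∂m, σ.act g⁻¹ (σ.act g ω) = ω := by
  have h := σ.act_mul g⁻¹ g
  rw [inv_mul_cancel] at h
  filter_upwards [h, σ.act_one] with ω h1 h2
  rw [h2] at h1
  exact h1.symm

/-- Here invertibility up to null sets enters: act g⁻¹ undoes act g almost everywhere. It also
transfers σ-finiteness from m to its image and lets integrals be changed back along g. -/
theorem measurePreserving_act_inv (g : G) :
    MeasurePreserving (σ.act g⁻¹) (m.map (σ.act g)) m := by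
  refine ⟨σ.measurable_act _, ?_⟩
  rw [Measure.map_map (σ.measurable_act _) (σ.measurable_act _)]
  have : σ.act g⁻¹ ∘ σ.act g =ᵐ[m] id := σ.act_inv_act g
  rw [Measure.map_congr this, Measure.map_id]

/-- The same action, with respect to an equivalent measure. -/
def congrMeasure {m' : Measure X} (h : m' ≪ m) (h' : m ≪ m') : NonsingularAction G X m' where
  act := σ.act
  quasiMeasurePreserving g := ⟨σ.measurable_act g,
    (h.map (σ.measurable_act g)).trans ((σ.map_act_ac g).trans h')⟩
  act_one := h.ae_eq σ.act_one
  act_mul g k := h.ae_eq (σ.act_mul g k)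
  tendsto_totalVariation η _ hη := σ.tendsto_totalVariation η (hη.trans h)

theorem sigmaFinite_map [SigmaFinite m] (g : G) : SigmaFinite (m.map (σ.act g)) :=
  (σ.measurePreserving_act_inv g).sigmaFinite

/-- The density of `g_* m` with respect to `m`. -/
def jac (g : G) (ω : X) : ℝ := ((m.map (σ.act g)).rnDeriv m ω).toReal

theorem jac_nonneg (g : G) (ω : X) : 0 ≤ σ.jac g ω := ENNReal.toReal_nonneg

theorem measurable_jac (g : G) : Measurable (σ.jac g) :=
  (Measure.measurable_rnDeriv _ _).ennreal_toReal

theorem integral_jac_mul [SigmaFinite m] (g : G) {f : X → ℝ} (hf : AEStronglyMeasurable f m) :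
    ∫ ω, σ.jac g ω * f (σ.act g⁻¹ ω) ∂m = ∫ ω, f ω ∂m := by
  have := σ.sigmaFinite_map g
  have h1 := integral_rnDeriv_smul (μ := m.map (σ.act g)) (ν := m) (σ.map_act_ac g)
    (f := fun ω => f (σ.act g⁻¹ ω))
  simp only [smul_eq_mul] at h1
  refine h1.trans ?_
  have hmp := σ.measurePreserving_act_inv g
  conv_rhs => rw [← hmp.map_eq]
  rw [integral_map hmp.measurable.aemeasurable (by rwa [hmp.map_eq])]

theorem integrable_jac_mul [SigmaFinite m] (g : G) {f : X → ℝ} (hf : Integrable f m) :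
    Integrable (fun ω => σ.jac g ω * f (σ.act g⁻¹ ω)) m := by
  have := σ.sigmaFinite_map g
  have h1 := integrable_rnDeriv_smul_iff (μ := m.map (σ.act g)) (ν := m) (σ.map_act_ac g)
    (f := fun ω => f (σ.act g⁻¹ ω))
  simp only [smul_eq_mul] at h1
  refine h1.2 ?_
  have hmp := σ.measurePreserving_act_inv g
  rw [← hmp.map_eq] at hf
  exact hf.comp_measurable hmp.measurable

/-- The density of a transported measure. -/
theorem rnDeriv_map_act [SigmaFinite m] {ν : Measure X} [IsFiniteMeasure ν] (hν : ν ≪ m) (g : G) :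
    (fun ω => ((ν.map (σ.act g)).rnDeriv m ω).toReal) =ᵐ[m]
      fun ω => σ.jac g ω * (ν.rnDeriv m (σ.act g⁻¹ ω)).toReal := by
  have hτ := σ.measurable_act g
  have hτ' := σ.measurable_act g⁻¹
  have hh := Measure.measurable_rnDeriv ν m
  have hhτ : Measurable fun ω => ν.rnDeriv m (σ.act g⁻¹ ω) := hh.comp hτ'
  have hd : ν.map (σ.act g) = m.withDensity
      (fun ω => (m.map (σ.act g)).rnDeriv m ω * ν.rnDeriv m (σ.act g⁻¹ ω)) := by
    ext A hA
    rw [withDensity_apply _ hA, setLIntegral_rnDeriv_mul (σ.map_act_ac g)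
      hhτ.aemeasurable hA, setLIntegral_map hA hhτ hτ, Measure.map_apply hτ hA]
    have : ∫⁻ ω in σ.act g ⁻¹' A, ν.rnDeriv m (σ.act g⁻¹ (σ.act g ω)) ∂m =
        ∫⁻ ω in σ.act g ⁻¹' A, ν.rnDeriv m ω ∂m := by
      refine lintegral_congr_ae (ae_restrict_of_ae ?_)
      filter_upwards [σ.act_inv_act g] with ω hω
      rw [hω]
    rw [this, Measure.setLIntegral_rnDeriv hν]
  have h2 := Measure.rnDeriv_withDensity m
    ((Measure.measurable_rnDeriv (m.map (σ.act g)) m).mul hhτ)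
  rw [hd]
  filter_upwards [h2] with ω hω
  rw [jac, ← ENNReal.toReal_mul]
  exact congrArg ENNReal.toReal hω

theorem koopman_congr (g : G) {f f' : X → ℝ} (h : f =ᵐ[m] f') :
    koopman σ g f =ᵐ[m] koopman σ g f' := by
  filter_upwards [(σ.quasiMeasurePreserving g⁻¹).ae_eq h] with ω hω
  simp only [Function.comp_apply] at hω
  rw [koopman, koopman, hω]

theorem aestronglyMeasurable_koopman (g : G) {f : X → ℝ} (hf : AEStronglyMeasurable f m) :
    AEStronglyMeasurable (koopman σ g f) m :=
  (σ.measurable_jac g).sqrt.aestronglyMeasurable.mul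
    (hf.comp_quasiMeasurePreserving (σ.quasiMeasurePreserving g⁻¹))

/-- The two square roots multiply to the density itself, so products of Koopman images are covered
by the change of variables for integrable functions. The isometry property follows from this. -/
theorem koopman_mul_koopman (g : G) (f f' : X → ℝ) (ω : X) :
    koopman σ g f ω * koopman σ g f' ω =
      σ.jac g ω * (fun ω => f ω * f' ω) (σ.act g⁻¹ ω) := by
  have : √(σ.jac g ω) * √(σ.jac g ω) = σ.jac g ω := Real.mul_self_sqrt (σ.jac_nonneg g ω)
  simp only [koopman]
  change √(σ.jac g ω) * _ * (√(σ.jac g ω) * _) = _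
  linear_combination (f (σ.act g⁻¹ ω) * f' (σ.act g⁻¹ ω)) * this

theorem memLp_koopman [SigmaFinite m] (g : G) {f : X → ℝ} (hf : MemLp f 2 m) : MemLp (koopman σ g f) 2 m := by
  rw [memLp_two_iff_integrable_sq (σ.aestronglyMeasurable_koopman g hf.1)]
  have h := σ.integrable_jac_mul g ((memLp_two_iff_integrable_sq hf.1).1 hf)
  refine h.congr (ae_of_all _ fun ω => ?_)
  simp only [pow_two]
  rw [koopman_mul_koopman]

/-- The Koopman representation as a family of linear isometries. -/
def koopmanIsometry [SigmaFinite m] (g : G) : Lp ℝ 2 m →ₗᵢ[ℝ] Lp ℝ 2 m :=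
  LinearMap.isometryOfInner
    { toFun := fun ξ => (σ.memLp_koopman g (Lp.memLp ξ)).toLp
      map_add' := fun ξ η => by
        rw [← MemLp.toLp_add]
        refine MemLp.toLp_congr _ _ ?_
        filter_upwards [σ.koopman_congr g (Lp.coeFn_add ξ η)] with ω hω
        rw [hω]
        simp [koopman, mul_add]
      map_smul' := fun c ξ => by
        rw [← MemLp.toLp_const_smul]
        refine MemLp.toLp_congr _ _ ?_
        filter_upwards [σ.koopman_congr g (Lp.coeFn_smul c ξ)] with ω hω
        rw [hω]
        simp [koopman]
        ring }
    (fun ξ η => by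
      rw [L2.inner_def, L2.inner_def]
      have h := σ.integral_jac_mul g (f := fun ω => ξ ω * η ω)
        ((Lp.aestronglyMeasurable ξ).mul (Lp.aestronglyMeasurable η))
      have h1 : ∫ ω, inner ℝ (ξ ω) (η ω) ∂m = ∫ ω, ξ ω * η ω ∂m := by simp [mul_comm]
      rw [h1, ← h]
      refine integral_congr_ae ?_
      filter_upwards [(σ.memLp_koopman g (Lp.memLp ξ)).coeFn_toLp,
        (σ.memLp_koopman g (Lp.memLp η)).coeFn_toLp] with ω h1 h2
      simp only [LinearMap.coe_mk, AddHom.coe_mk]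
      rw [h1, h2, ← koopman_mul_koopman]
      simp [mul_comm])

theorem koopmanIsometry_ae_eq [SigmaFinite m] (g : G) (ξ : Lp ℝ 2 m) :
    σ.koopmanIsometry g ξ =ᵐ[m] koopman σ g ξ :=
  (σ.memLp_koopman g (Lp.memLp ξ)).coeFn_toLp

theorem koopmanIsometry_toLp [SigmaFinite m] (g : G) {f f' : X → ℝ} (hf : MemLp f 2 m) (hf' : MemLp f' 2 m)
    (h : koopman σ g f =ᵐ[m] f') : σ.koopmanIsometry g hf.toLp = hf'.toLp := by
  exact MemLp.toLp_congr (σ.memLp_koopman g (Lp.memLp hf.toLp)) hf'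
    ((σ.koopman_congr g hf.coeFn_toLp).trans h)

theorem inner_koopmanIsometry [SigmaFinite m] (g : G) (ξ η : Lp ℝ 2 m) :
    ⟪σ.koopmanIsometry g ξ, η⟫ = ∫ ω, koopman σ g ξ ω * η ω ∂m := by
  rw [L2.inner_def]
  refine integral_congr_ae ?_
  filter_upwards [σ.koopmanIsometry_ae_eq g ξ] with ω hω
  rw [hω]; simp [mul_comm]

end NonsingularAction

/-- The square root of the density of `ν` with respect to `m`. -/
def sqrtDensity (m ν : Measure X) (ω : X) : ℝ := √(ν.rnDeriv m ω).toReal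

theorem memLp_sqrtDensity (m ν : Measure X) [IsFiniteMeasure ν] :
    MemLp (sqrtDensity m ν) 2 m := by
  have hm : Measurable (sqrtDensity m ν) :=
    (Measure.measurable_rnDeriv _ _).ennreal_toReal.sqrt
  rw [memLp_two_iff_integrable_sq hm.aestronglyMeasurable]
  refine (Measure.integrable_toReal_rnDeriv (μ := ν) (ν := m)).congr (ae_of_all _ fun ω => ?_)
  exact (Real.sq_sqrt ENNReal.toReal_nonneg).symm

/-- The square root of `rnDeriv_map_act`. Movement of measures thereby becomes movement of unit
vectors in one Hilbert space. -/
theorem koopman_sqrtDensity [SigmaFinite m] (σ : NonsingularAction G X m) {ν : Measure X}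
    [IsFiniteMeasure ν] (hν : ν ≪ m) (g : G) :
    koopman σ g (sqrtDensity m ν) =ᵐ[m] sqrtDensity m (ν.map (σ.act g)) := by
  filter_upwards [σ.rnDeriv_map_act hν g] with ω hω
  rw [koopman, sqrtDensity, sqrtDensity, hω, Real.sqrt_mul (σ.jac_nonneg g ω)]
  rfl

theorem inner_sqrtDensity_self [SigmaFinite m] {ν : Measure X} [IsProbabilityMeasure ν]
    (hν : ν ≪ m) : ⟪(memLp_sqrtDensity m ν).toLp, (memLp_sqrtDensity m ν).toLp⟫ = (1 : ℝ) := by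
  rw [L2.inner_def]
  have h : ∫ ω, (ν.rnDeriv m ω).toReal ∂m = 1 := by
    rw [Measure.integral_toReal_rnDeriv hν]; simp
  rw [← h]
  refine integral_congr_ae ?_
  filter_upwards [(memLp_sqrtDensity m ν).coeFn_toLp] with ω hω
  rw [hω]
  simp [sqrtDensity, Real.sq_sqrt]

end Koopman

/-! ### Half-densities of the Gaussian measures, and assertions (i), (ii), (iii) -/

section Gaussian

variable {V : Type u} [NormedAddCommGroup V] [InnerProductSpace ℝ V]
  {P : Type w} [MetricSpace P] [NormedAddTorsor V P] {X : Type z} [MeasurableSpace X]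
  {m : Measure X} {μ : P → Measure X} {o : P} {W : V → X → ℝ}

namespace IsIsonormal

theorem memLp_sqrtDensity (I : IsIsonormal m μ o W) (x : P) :
    MemLp (sqrtDensity m (μ x)) 2 m :=
  have := I.prob x
  GaussianDictionary.memLp_sqrtDensity m (μ x)

/-- The square root halves the Cameron–Martin exponent, and by linearity half of W(x - o) is the
coordinate of the halved vector. -/
theorem sqrtDensity_ae_eq [SigmaFinite m] (I : IsIsonormal m μ o W) (x : P) :
    sqrtDensity m (μ x) =ᵐ[m] fun ω => Real.exp (-(‖x -ᵥ o‖ ^ 2 / 4)) *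
      (sqrtDensity m (μ o) ω * Real.exp (W ((1 / 2 : ℝ) • (x -ᵥ o)) ω)) := by
  have := I.prob o
  have := I.prob x
  have hac : μ x ≪ μ o := (I.ac x).trans (I.ac' o)
  have h1 : (μ x).rnDeriv (μ o) =ᵐ[μ o]
      fun ω => ENNReal.ofReal (cameronMartin W (x -ᵥ o) ω) := by
    conv_lhs => rw [I.measure_eq_withDensity x]
    exact Measure.rnDeriv_withDensity _ (I.measurable_cameronMartin _).ennreal_ofReal
  filter_upwards [(I.ac' o).ae_eq h1, Measure.rnDeriv_mul_rnDeriv (κ := m) hac,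
    I.smul (1 / 2) (x -ᵥ o)] with ω h1 h2 h3
  rw [sqrtDensity, sqrtDensity, ← h2, Pi.mul_apply, h1, ENNReal.toReal_mul,
    ENNReal.toReal_ofReal (cameronMartin_pos _ _ _).le, Real.sqrt_mul (cameronMartin_pos _ _ _).le,
    h3, cameronMartin, Real.sqrt_eq_rpow, ← Real.exp_mul]
  rw [mul_comm, mul_left_comm, ← Real.exp_add]
  congr 2
  ring

theorem sqrtDensity_ne_zero [SigmaFinite m] (I : IsIsonormal m μ o W) (x : P) :
    ∀ᵐ ω ∂m, sqrtDensity m (μ x) ω ≠ 0 := by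
  have := I.prob x
  filter_upwards [Measure.rnDeriv_pos' (I.ac' x), Measure.rnDeriv_ne_top (μ x) m] with ω h1 h2
  exact (Real.sqrt_pos.2 (ENNReal.toReal_pos h1.ne' h2)).ne'

theorem measurable_sqrtDensity (m ν : Measure X) : Measurable (sqrtDensity m ν) :=
  (Measure.measurable_rnDeriv _ _).ennreal_toReal.sqrt

/-- The square roots of the densities of the `μ x` are total in `L²`. -/
theorem topologicalClosure_span_sqrtDensity [SigmaFinite m] (I : IsIsonormal m μ o W) :
    (Submodule.span ℝ (Set.range fun x => (I.memLp_sqrtDensity x).toLp)).topologicalClosure =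
      ⊤ := by
  -- Since the square root halves exponents, the exponential of `W v` arises from the point at
  -- displacement 2v. So the half-densities span the weighted exponentials, which are total.
  have hae : ∀ v, (fun ω => sqrtDensity m (μ o) ω * Real.exp (W v ω)) =ᵐ[m]
      fun ω => Real.exp (‖(2 : ℝ) • v‖ ^ 2 / 4) * sqrtDensity m (μ ((2 : ℝ) • v +ᵥ o)) ω := by
    intro v
    filter_upwards [I.sqrtDensity_ae_eq ((2 : ℝ) • v +ᵥ o)] with ω hω
    rw [hω, vadd_vsub, smul_smul, ← mul_assoc, ← Real.exp_add]
    norm_num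
  have hmem : ∀ v, MemLp (fun ω => sqrtDensity m (μ o) ω * Real.exp (W v ω)) 2 m := fun v =>
    (memLp_congr_ae (hae v)).2 ((I.memLp_sqrtDensity _).const_mul _)
  rw [eq_top_iff, ← I.topologicalClosure_span_eq_top (measurable_sqrtDensity m (μ o))
    (I.sqrtDensity_ne_zero o) hmem]
  refine Submodule.topologicalClosure_mono (Submodule.span_le.2 ?_)
  rintro _ ⟨v, rfl⟩
  have h : (hmem v).toLp = Real.exp (‖(2 : ℝ) • v‖ ^ 2 / 4) •
      (I.memLp_sqrtDensity ((2 : ℝ) • v +ᵥ o)).toLp := by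
    rw [← MemLp.toLp_const_smul]
    exact MemLp.toLp_congr _ _ (hae v)
  change (hmem v).toLp ∈ _
  rw [h]
  exact Submodule.smul_mem _ _ (Submodule.subset_span ⟨_, rfl⟩)

/-- The product of the two half-densities is the density of `μ o` times one exponential, whose
integral has exponent -(‖a‖² + ‖b‖²)/4 + ‖a + b‖²/8 = -‖a - b‖²/8. Orthogonality at infinite
distance is the source of both (i) and (ii). -/
theorem inner_sqrtDensity [SigmaFinite m] (I : IsIsonormal m μ o W) (x y : P) :
    ⟪(I.memLp_sqrtDensity x).toLp, (I.memLp_sqrtDensity y).toLp⟫ =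
      Real.exp (-(dist x y ^ 2 / 8)) := by
  have := I.prob o
  rw [L2.inner_def]
  set a := x -ᵥ o
  set b := y -ᵥ o
  set c := (1 / 2 : ℝ) • a + (1 / 2 : ℝ) • b
  have h1 : ∀ᵐ ω ∂m, inner ℝ (((I.memLp_sqrtDensity x).toLp : Lp ℝ 2 m) ω)
      (((I.memLp_sqrtDensity y).toLp : Lp ℝ 2 m) ω) =
      ((μ o).rnDeriv m ω).toReal • (Real.exp (-(‖a‖ ^ 2 / 4) - ‖b‖ ^ 2 / 4) *
        Real.exp (W c ω)) := by
    filter_upwards [(I.memLp_sqrtDensity x).coeFn_toLp, (I.memLp_sqrtDensity y).coeFn_toLp,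
      I.sqrtDensity_ae_eq x, I.sqrtDensity_ae_eq y,
      I.add ((1 / 2 : ℝ) • a) ((1 / 2 : ℝ) • b)] with ω h1 h2 h3 h4 h5
    have h6 : sqrtDensity m (μ o) ω * sqrtDensity m (μ o) ω = ((μ o).rnDeriv m ω).toReal :=
      Real.mul_self_sqrt ENNReal.toReal_nonneg
    rw [h1, h2, h3, h4, h5, ← h6, Real.exp_add, sub_eq_add_neg, Real.exp_add]
    simp only [RCLike.inner_apply, conj_trivial, smul_eq_mul]
    ring
  rw [integral_congr_ae h1, integral_rnDeriv_smul (I.ac o), integral_const_mul, I.integral_exp,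
    vsub_self, inner_zero_right, ← Real.exp_add, dist_eq_norm_vsub V x y]
  congr 1
  have h2 : x -ᵥ y = a - b := by simp [a, b]
  have h3 : c = (1 / 2 : ℝ) • (a + b) := by simp [c]
  rw [h2, h3, norm_smul, norm_sub_sq_real, mul_pow, norm_add_sq_real]
  norm_num
  ring

end IsIsonormal

variable {G : Type v} [Group G] [TopologicalSpace G] {α : G →* (P ≃ᵃⁱ[ℝ] P)}
  {σ : NonsingularAction G X m}

theorem koopmanIsometry_sqrtDensity [SigmaFinite m] (I : IsIsonormal m μ o W)
    (hσ : IsGaussianAction μ α σ) (g : G) (x : P) :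
    σ.koopmanIsometry g (I.memLp_sqrtDensity x).toLp = (I.memLp_sqrtDensity (α g x)).toLp := by
  have := I.prob x
  refine σ.koopmanIsometry_toLp g _ _ ?_
  have h := koopman_sqrtDensity σ (I.ac x) g
  rwa [hσ g x] at h

/-- Koopman coefficients vanish along any filter along which the orbits go to infinity. -/
theorem tendsto_inner_koopman_zero [SigmaFinite m] (I : IsIsonormal m μ o W)
    (hσ : IsGaussianAction μ α σ) {l : Filter G}
    (hl : Tendsto (fun g => dist (α g o) o) l atTop) (ξ η : Lp ℝ 2 m) :
    Tendsto (fun g => ⟪σ.koopmanIsometry g ξ, η⟫) l (𝓝 0) := by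
  refine tendsto_inner_zero_of_total I.topologicalClosure_span_sqrtDensity (fun x y => ?_) ξ η
  simp_rw [koopmanIsometry_sqrtDensity I hσ, I.inner_sqrtDensity]
  have h1 : Tendsto (fun g => dist (α g x) y) l atTop := by
    refine tendsto_atTop_mono (fun g => ?_)
      (tendsto_atTop_add_const_right l (-(dist x o + dist y o)) hl)
    have h2 : dist (α g o) o ≤ dist (α g o) (α g x) + dist (α g x) y + dist y o :=
      dist_triangle4 _ _ _ _
    rw [AffineIsometryEquiv.dist_map, dist_comm o x] at h2
    linarith
  refine Real.tendsto_exp_neg_atTop_nhds_zero.comp ?_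
  exact ((tendsto_pow_atTop two_ne_zero).comp h1).atTop_div_const (by norm_num)

theorem hasInvariantProbability_iff [SigmaFinite m] [CompleteSpace V] (I : IsIsonormal m μ o W)
    (hσ : IsGaussianAction μ α σ) : HasInvariantProbability σ ↔ HasFixedPoint α := by
  constructor
  · rintro ⟨η, hη, hηm, hinv⟩
    by_contra hfix
    -- The filter of orbits of `o` going to infinity. It is proper exactly because the orbit is
    -- unbounded, and no topology on `G` is involved.
    set l : Filter G := comap (fun g => dist (α g o) o) atTop with hl
    have hne : l.NeBot := by
      rw [hl, comap_neBot_iff]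
      intro t ht
      obtain ⟨C, hC⟩ := mem_atTop_sets.1 ht
      by_contra hcon
      push Not at hcon
      refine hfix (hasFixedPoint_of_bounded_orbit α o C fun g => ?_)
      by_contra hgt
      exact hcon g (hC _ (not_le.1 hgt).le)
    have hlim := tendsto_inner_koopman_zero I hσ (l := l) tendsto_comap
      (memLp_sqrtDensity m η).toLp (memLp_sqrtDensity m η).toLp
    have hconst : ∀ g, ⟪σ.koopmanIsometry g (memLp_sqrtDensity m η).toLp,
        (memLp_sqrtDensity m η).toLp⟫ = (1 : ℝ) := by
      intro g
      have h := koopman_sqrtDensity σ hηm g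
      rw [hinv g] at h
      rw [σ.koopmanIsometry_toLp g _ (memLp_sqrtDensity m η) h, inner_sqrtDensity_self hηm]
    simp_rw [hconst] at hlim
    exact one_ne_zero (tendsto_nhds_unique tendsto_const_nhds hlim)
  · rintro ⟨x, hx⟩
    exact ⟨μ x, I.prob x, I.ac x, fun g => by rw [hσ g x, hx g]⟩

theorem isZeroType_iff [SigmaFinite m] (I : IsIsonormal m μ o W)
    (hσ : IsGaussianAction μ α σ) : IsZeroType σ ↔ IsProperAction α := by
  constructor
  · intro h x
    have h1 := h (I.memLp_sqrtDensity x).toLp (I.memLp_sqrtDensity x).toLp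
    simp_rw [← σ.inner_koopmanIsometry, koopmanIsometry_sqrtDensity I hσ,
      I.inner_sqrtDensity] at h1
    have h2 : Tendsto (fun g => dist (α g x) x ^ 2 / 8) (cocompact G) atTop := by
      have h3 := Real.tendsto_exp_comp_nhds_zero.1 h1
      exact tendsto_neg_atBot_iff.1 h3
    have h4 : Tendsto (fun g => √(dist (α g x) x ^ 2 / 8 * 8)) (cocompact G) atTop :=
      Real.tendsto_sqrt_atTop.comp (h2.atTop_mul_const (by norm_num))
    refine h4.congr fun g => ?_
    rw [div_mul_cancel₀ _ (by norm_num), Real.sqrt_sq dist_nonneg]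
  · intro h ξ η
    simp_rw [← σ.inner_koopmanIsometry]
    exact tendsto_inner_koopman_zero I hσ (h o) ξ η

theorem hasAlmostVanishingEntropy_of_hasAlmostFixedPoints (I : IsIsonormal m μ o W)
    (hσ : IsGaussianAction μ α σ) (h : HasAlmostFixedPoints α) : HasAlmostVanishingEntropy σ := by
  obtain ⟨x, hx⟩ := h
  intro ε hε K hK
  -- The entropy is half the squared displacement, so a displacement below √(2ε) suffices.
  have h1 := Metric.tendstoUniformlyOn_iff.1 (hx K hK) (√(2 * ε)) (by positivity)
  obtain ⟨n, hn⟩ := h1.exists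
  refine ⟨μ (x n), I.prob _, I.ac _, I.ac' _, fun g hg => ?_⟩
  rw [hσ g (x n), relEntropy, (I.rebase (α g (x n))).klDiv_eq]
  refine ENNReal.ofReal_le_ofReal ?_
  have h2 := hn g hg
  rw [dist_zero_left, Real.norm_of_nonneg dist_nonneg, dist_comm] at h2
  have h3 := Real.lt_sqrt dist_nonneg |>.1 h2
  linarith

theorem Lp.norm_integral_le_of_ac {ν : Measure X} [IsProbabilityMeasure ν] (hν : ν ≪ m)
    (f : Lp ℝ ∞ m) : |∫ ω, f ω ∂ν| ≤ ‖f‖ := by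
  have h : ∀ᵐ ω ∂m, ‖f ω‖ ≤ ‖f‖ := by
    have h1 := ae_le_eLpNormEssSup (f := f) (μ := m)
    filter_upwards [h1] with ω hω
    rw [Lp.norm_def, eLpNorm_exponent_top]
    have h2 := ENNReal.toReal_mono (by
      rw [← eLpNorm_exponent_top]; exact (Lp.memLp f).eLpNorm_ne_top) hω
    simpa using h2
  have h2 := norm_integral_le_of_norm_le_const (μ := ν) (hν.ae_le h)
  simpa using h2

/-- Integration against a probability measure, as a functional on `L^∞`. -/
def integralLinftyCLM {ν : Measure X} [IsProbabilityMeasure ν] (hν : ν ≪ m) :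
    Lp ℝ ∞ m →L[ℝ] ℝ :=
  LinearMap.mkContinuous
    { toFun := fun f => ∫ ω, f ω ∂ν
      map_add' := fun f g => by
        have hi : ∀ f : Lp ℝ ∞ m, Integrable f ν := fun f => by
          have h1 : MemLp f ∞ ν := ⟨(Lp.memLp f).1.mono_ac hν, by
            rw [eLpNorm_exponent_top]
            refine (eLpNormEssSup_mono_measure _ hν).trans_lt ?_
            rw [← eLpNorm_exponent_top]
            exact (Lp.memLp f).2⟩
          exact h1.integrable le_top
        rw [integral_congr_ae (hν.ae_eq (Lp.coeFn_add f g)), ← integral_add (hi f) (hi g)]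
        rfl
      map_smul' := fun c f => by
        rw [integral_congr_ae (hν.ae_eq (Lp.coeFn_smul c f)), RingHom.id_apply, smul_eq_mul,
          ← integral_const_mul]
        rfl } 1
    (fun f => by simpa using Lp.norm_integral_le_of_ac hν f)

/-- Integration against `μ (x n)` is a sequence of states, which converges weakly-* along an
ultrafilter by Banach–Alaoglu. Applying g changes them by at most the L¹ distance between the
measures of g xₙ and xₙ, which tends to zero. -/
theorem hasInvariantMean_of_hasAlmostFixedPoints (I : IsIsonormal m μ o W)
    (hσ : IsGaussianAction μ α σ) (h : HasAlmostFixedPoints α) : HasInvariantMean σ := by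
  obtain ⟨x, hx⟩ := h
  have hprob := I.prob
  set ψ : ℕ → WeakDual ℝ (Lp ℝ ∞ m) := fun n =>
    StrongDual.toWeakDual (integralLinftyCLM (I.ac (x n))) with hψ
  have hball : ∀ n, ψ n ∈ WeakDual.toStrongDual ⁻¹' Metric.closedBall 0 1 := fun n => by
    change integralLinftyCLM (I.ac (x n)) ∈ Metric.closedBall 0 1
    rw [mem_closedBall_zero_iff]
    exact LinearMap.mkContinuous_norm_le _ zero_le_one _
  have hcomp := WeakDual.isCompact_closedBall (𝕜 := ℝ) (E := Lp ℝ ∞ m) 0 1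
  set F : Ultrafilter ℕ := hyperfilter ℕ
  have hF : (F : Filter ℕ) ≤ atTop := by
    rw [← Nat.cofinite_eq_atTop]; exact hyperfilter_le_cofinite
  obtain ⟨φ, -, hφ⟩ := hcomp.ultrafilter_le_nhds (F.map ψ)
    (by rw [Ultrafilter.coe_map, le_principal_iff]; exact mem_map.2 (univ_mem' hball))
  have hlim : ∀ f, Tendsto (fun n => ∫ ω, f ω ∂(μ (x n))) F (𝓝 (φ f)) := fun f => by
    have h1 : Tendsto ψ F (𝓝 φ) := hφ
    exact ((WeakDual.eval_continuous f).tendsto φ).comp h1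
  refine ⟨WeakDual.toStrongDual φ, fun f hf => ?_, fun f hf => ?_, fun g f f' hff' => ?_⟩
  · refine ge_of_tendsto' (hlim f) fun n => integral_nonneg_of_ae ?_
    have h0 : 0 ≤ᵐ[m] f := (Lp.coeFn_nonneg f).2 hf
    exact (I.ac (x n)).ae_le h0
  · refine tendsto_nhds_unique (hlim f) (tendsto_const_nhds.congr fun n => ?_)
    rw [integral_congr_ae ((I.ac (x n)).ae_eq hf)]
    simp
  · refine tendsto_nhds_unique (hlim f') ?_
    have hdiff : Tendsto (fun n => ∫ ω, f' ω ∂(μ (x n)) - ∫ ω, f ω ∂(μ (x n))) F (𝓝 0) := by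
      have hd : Tendsto (fun n => dist (α g (x n)) (x n)) atTop (𝓝 0) :=
        (hx {g} isCompact_singleton).tendsto_at (Set.mem_singleton g)
      have hb : Tendsto (fun n => ‖f‖ * √(Real.exp (dist (α g (x n)) (x n) ^ 2) - 1)) F (𝓝 0) := by
        have hc : Continuous fun t : ℝ => ‖f‖ * √(Real.exp (t ^ 2) - 1) := by fun_prop
        have := (hc.tendsto 0).comp (hd.mono_left hF)
        simpa [Function.comp_def] using this
      refine squeeze_zero_norm (fun n => ?_) hb
      have h1 : ∫ ω, f' ω ∂(μ (x n)) = ∫ ω, f ω ∂(μ (α g (x n))) := by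
        rw [integral_congr_ae ((I.ac (x n)).ae_eq hff'), ← hσ g (x n),
          integral_map (σ.measurable_act g).aemeasurable
            (Lp.stronglyMeasurable f).aestronglyMeasurable]
        rfl
      rw [h1]
      refine (I.rebase (x n)).abs_integral_sub_integral_le (α g (x n)) (Lp.aestronglyMeasurable f) ?_
      have h1 := ae_le_eLpNormEssSup (f := f) (μ := m)
      filter_upwards [h1] with ω hω
      rw [Lp.norm_def, eLpNorm_exponent_top]
      have h2 := ENNReal.toReal_mono (by
        rw [← eLpNorm_exponent_top]; exact (Lp.memLp f).eLpNorm_ne_top) hω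
      simpa using h2
    have := (hlim f).add hdiff
    simp only [add_zero, add_sub_cancel] at this
    exact this

end Gaussian

/-! ### Approximately invariant points from invariant means -/

section Reiter

variable {G : Type v} [TopologicalSpace G] [MeasurableSpace G] [BorelSpace G]
  [SecondCountableTopology G] {E : Type w} [NormedAddCommGroup E] [NormedSpace ℝ E]
  [CompleteSpace E] (l : Measure G) [IsFiniteMeasureOnCompacts l]

omit [SecondCountableTopology G] in
theorem integrable_weight_smul {F : Type*} [NormedAddCommGroup F] [NormedSpace ℝ F]
    {h : G → ℝ} (hc : Continuous h) (hs : HasCompactSupport h) {b : G → F} (hb : Continuous b) :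
    Integrable (fun t => h t • b t) l :=
  (hc.smul hb).integrable_of_hasCompactSupport hs.smul_right

/-- The average `ν ↦ ∫ h(t) B_t ν dt` of a strongly continuous family of contractions. -/
def weightedAverage {h : G → ℝ} (hc : Continuous h) (hs : HasCompactSupport h)
    (B : G → E →L[ℝ] E) (hB : ∀ ν, Continuous fun t => B t ν) (hB1 : ∀ t, ‖B t‖ ≤ 1) :
    E →L[ℝ] E :=
  LinearMap.mkContinuous
    { toFun := fun ν => ∫ t, h t • B t ν ∂l
      map_add' := fun ν ν' => by
        simp only [map_add, smul_add]
        exact integral_add (integrable_weight_smul l hc hs (hB ν))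
          (integrable_weight_smul l hc hs (hB ν'))
      map_smul' := fun c ν => by
        simp only [map_smul, RingHom.id_apply]
        rw [← integral_smul]
        congr 1 with t
        rw [smul_comm] }
    (∫ t, |h t| ∂l) fun ν => by
      refine (norm_integral_le_integral_norm _).trans ?_
      rw [← integral_mul_const]
      refine integral_mono (integrable_weight_smul l hc hs (hB ν)).norm
        ((hc.integrable_of_hasCompactSupport hs).norm.mul_const _) fun t => ?_
      simp only [norm_smul, Real.norm_eq_abs]
      gcongr
      simpa using (B t).le_of_opNorm_le (hB1 t) ν

omit [SecondCountableTopology G] [CompleteSpace E] in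
theorem weightedAverage_apply {h : G → ℝ} (hc : Continuous h) (hs : HasCompactSupport h)
    (B : G → E →L[ℝ] E) (hB : ∀ ν, Continuous fun t => B t ν) (hB1 : ∀ t, ‖B t‖ ≤ 1) (ν : E) :
    weightedAverage l hc hs B hB hB1 ν = ∫ t, h t • B t ν ∂l := rfl

-- The average is Lipschitz in its weight for the operator norm, although the family is only
-- strongly continuous. Averaging therefore turns strong continuity into norm continuity, because
-- translating the group element only translates the weight.
omit [CompleteSpace E] [SecondCountableTopology G] in
theorem norm_weightedAverage_sub_le {h h' : G → ℝ} (hc : Continuous h) (hs : HasCompactSupport h)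
    (hc' : Continuous h') (hs' : HasCompactSupport h')
    (B : G → E →L[ℝ] E) (hB : ∀ ν, Continuous fun t => B t ν) (hB1 : ∀ t, ‖B t‖ ≤ 1) :
    ‖weightedAverage l hc hs B hB hB1 - weightedAverage l hc' hs' B hB hB1‖ ≤
      ∫ t, |h t - h' t| ∂l := by
  refine ContinuousLinearMap.opNorm_le_bound _ (integral_nonneg fun t => abs_nonneg _) fun ν => ?_
  have hi := integrable_weight_smul l hc hs (hB ν)
  have hi' := integrable_weight_smul l hc' hs' (hB ν)
  rw [sub_apply, weightedAverage_apply, weightedAverage_apply,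
    ← integral_sub hi hi', ← integral_mul_const]
  refine (norm_integral_le_integral_norm _).trans ?_
  refine integral_mono (hi.sub hi').norm ((((hc.integrable_of_hasCompactSupport hs).sub
    (hc'.integrable_of_hasCompactSupport hs')).norm).mul_const _) fun t => ?_
  simp only [← sub_smul, norm_smul, Real.norm_eq_abs]
  gcongr
  simpa using (B t).le_of_opNorm_le (hB1 t) ν

omit [SecondCountableTopology G] in
theorem weightedAverage_mem {h : G → ℝ} (hc : Continuous h) (hs : HasCompactSupport h)
    (h0 : ∀ t, 0 ≤ h t) (h1 : ∫ t, h t ∂l = 1)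
    (B : G → E →L[ℝ] E) (hB : ∀ ν, Continuous fun t => B t ν) (hB1 : ∀ t, ‖B t‖ ≤ 1)
    {C : Set E} (hconv : Convex ℝ C) (hcl : IsClosed C) {ν : E} (hν : ∀ t, B t ν ∈ C) :
    weightedAverage l hc hs B hB hB1 ν ∈ C := by
  have hm : Measurable fun t => ENNReal.ofReal (h t) := hc.measurable.ennreal_ofReal
  have hfin : ∀ᵐ t ∂l, ENNReal.ofReal (h t) < ∞ := ae_of_all _ fun t => ENNReal.ofReal_lt_top
  have hprob : IsProbabilityMeasure (l.withDensity fun t => ENNReal.ofReal (h t)) := ⟨by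
    rw [withDensity_apply _ .univ, Measure.restrict_univ,
      ← ofReal_integral_eq_lintegral_ofReal (hc.integrable_of_hasCompactSupport hs)
        (ae_of_all _ h0), h1, ENNReal.ofReal_one]⟩
  have hi := integrable_weight_smul l hc hs (hB ν)
  have heq : weightedAverage l hc hs B hB hB1 ν =
      ∫ t, B t ν ∂(l.withDensity fun t => ENNReal.ofReal (h t)) := by
    rw [integral_withDensity_eq_integral_toReal_smul hm hfin, weightedAverage_apply]
    simp only [ENNReal.toReal_ofReal (h0 _)]
  rw [heq]
  refine hconv.integral_mem hcl (ae_of_all _ hν) ?_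
  rw [integrable_withDensity_iff_integrable_smul' hm hfin]
  simpa only [ENNReal.toReal_ofReal (h0 _)] using hi

omit [SecondCountableTopology G] in
theorem norm_weightedAverage_comp_sub_le {h : G → ℝ} (hc : Continuous h)
    (hs : HasCompactSupport h) (h0 : ∀ t, 0 ≤ h t) (h1 : ∫ t, h t ∂l = 1)
    (B : G → E →L[ℝ] E) (hB : ∀ ν, Continuous fun t => B t ν) (hB1 : ∀ t, ‖B t‖ ≤ 1)
    (S : E →L[ℝ] E) {δ : ℝ} (hδ : 0 ≤ δ)
    (hS : ∀ t, h t ≠ 0 → ‖(B t).comp S - S‖ ≤ δ) :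
    ‖(weightedAverage l hc hs B hB hB1).comp S - S‖ ≤ δ := by
  refine ContinuousLinearMap.opNorm_le_bound _ hδ fun ν => ?_
  have hi := integrable_weight_smul l hc hs (hB (S ν))
  have hint := hc.integrable_of_hasCompactSupport (μ := l) hs
  have h2 : S ν = ∫ t, h t • S ν ∂l := by rw [integral_smul_const, h1, one_smul]
  rw [sub_apply, ContinuousLinearMap.comp_apply, weightedAverage_apply]
  nth_rewrite 2 [h2]
  rw [← integral_sub hi (hint.smul_const _)]
  refine (norm_integral_le_integral_norm _).trans ?_
  have h3 : δ * ‖ν‖ = ∫ t, h t * (δ * ‖ν‖) ∂l := by rw [integral_mul_const, h1, one_mul]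
  rw [h3]
  refine integral_mono (hi.sub (hint.smul_const _)).norm (hint.mul_const _) fun t => ?_
  simp only [← smul_sub, norm_smul, Real.norm_eq_abs, abs_of_nonneg (h0 t)]
  by_cases ht : h t = 0
  · simp [ht]
  · gcongr
    · exact h0 t
    · exact ((B t).comp S - S).le_of_opNorm_le (hS t ht) ν

-- Norm continuity `hΛ` makes the integral of the functionals Λ ∘ B_t converge in the dual space, so
-- that φ, which is continuous for the norm only, may be moved inside.
omit [SecondCountableTopology G] in
theorem map_comp_weightedAverage {h : G → ℝ} (hc : Continuous h) (hs : HasCompactSupport h)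
    (h1 : ∫ t, h t ∂l = 1)
    (B : G → E →L[ℝ] E) (hB : ∀ ν, Continuous fun t => B t ν) (hB1 : ∀ t, ‖B t‖ ≤ 1)
    (φ : (E →L[ℝ] ℝ) →L[ℝ] ℝ) (Λ : E →L[ℝ] ℝ) (hΛ : Continuous fun t => Λ.comp (B t))
    (hφ : ∀ t, φ (Λ.comp (B t)) = φ Λ) :
    φ (Λ.comp (weightedAverage l hc hs B hB hB1)) = φ Λ := by
  have hi := integrable_weight_smul l hc hs hΛ
  have heq : Λ.comp (weightedAverage l hc hs B hB hB1) = ∫ t, h t • Λ.comp (B t) ∂l := by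
    ext ν
    rw [ContinuousLinearMap.integral_apply hi, ContinuousLinearMap.comp_apply,
      weightedAverage_apply, ← ContinuousLinearMap.integral_comp_comm _
        (integrable_weight_smul l hc hs (hB ν))]
    simp
  rw [heq, ← ContinuousLinearMap.integral_comp_comm _ hi]
  simp only [map_smul, hφ, smul_eq_mul]
  rw [integral_mul_const, h1, one_mul]

end Reiter

/-! ### Smoothing over Haar measure and the Hahn–Banach argument -/

section Reiter

open scoped Pointwise

variable {G : Type v} [Group G] [TopologicalSpace G] [IsTopologicalGroup G] [LocallyCompactSpace G]

theorem exists_weight [MeasurableSpace G] [BorelSpace G] (l : Measure G) [l.IsHaarMeasure]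
    {U : Set G} (hU : U ∈ 𝓝 (1 : G)) :
    ∃ h : G → ℝ, Continuous h ∧ HasCompactSupport h ∧ (∀ t, 0 ≤ h t) ∧ ∫ t, h t ∂l = 1 ∧
      ∀ t, h t ≠ 0 → t ∈ U := by
  obtain ⟨f, hfs, hf1⟩ : ∃ f : C(G, ℝ), HasCompactSupport f ∧ 0 ≤ f ∧ f 1 ≠ 0 ∧
      ∀ t, f t ≠ 0 → t ∈ U := by
    obtain ⟨f, h1, h0, hs, h01⟩ := exists_continuous_one_zero_of_isCompact (s := {(1 : G)})
      isCompact_singleton (isOpen_interior (s := U)).isClosed_compl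
      (by simpa [Set.disjoint_singleton_left] using mem_interior_iff_mem_nhds.2 hU)
    refine ⟨f, hs, fun t => (h01 t).1, by simp [h1 (Set.mem_singleton _)], fun t ht => ?_⟩
    by_contra hh
    exact ht (h0 fun hh' => hh (interior_subset hh'))
  obtain ⟨hf0, hf1, hfU⟩ := hf1
  have hpos : 0 < ∫ t, f t ∂l :=
    f.continuous.integral_pos_of_hasCompactSupport_nonneg_nonzero hfs hf0 hf1
  refine ⟨fun t => (∫ t, f t ∂l)⁻¹ * f t, by fun_prop, hfs.mul_left,
    fun t => mul_nonneg (inv_nonneg.2 hpos.le) (hf0 t), ?_, fun t ht => hfU t ?_⟩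
  · rw [integral_const_mul, inv_mul_cancel₀ hpos.ne']
  · exact fun h => ht (by simp [h])

theorem tendsto_integral_abs_translate_sub [MeasurableSpace G] [BorelSpace G] (l : Measure G)
    [IsFiniteMeasureOnCompacts l] {h : G → ℝ} (hc : Continuous h) (hs : HasCompactSupport h)
    (s : G) :
    Tendsto (fun r => ∫ t, |h (r * t) - h (s * t)| ∂l) (𝓝 s) (𝓝 0) := by
  obtain ⟨N, hN, hNs⟩ := exists_compact_mem_nhds s
  have hK : IsCompact (N⁻¹ * tsupport h) := hN.inv.mul hs
  have hz : ∀ r ∈ N, ∀ t ∉ N⁻¹ * tsupport h, h (r * t) = 0 := fun r hr t ht => by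
    by_contra hne
    exact ht ⟨r⁻¹, Set.inv_mem_inv.2 hr, r * t, subset_tsupport _ hne, by simp⟩
  have h1 : ContinuousOn (fun r => ∫ t, |h (r * t) - h (s * t)| ∂l) N := by
    refine continuousOn_integral_of_compact_support hK (by fun_prop) fun r t hr ht => ?_
    rw [hz r hr t ht, hz s (mem_of_mem_nhds hNs) t ht, sub_zero, abs_zero]
  have h2 := (h1.continuousAt hNs).tendsto
  simpa using h2

/-- If a convex set of an isometric Banach representation carries an invariant mean, then it has
points that are approximately invariant, uniformly on compact sets. -/
theorem exists_approx_invariant_of_invariant_mean [SecondCountableTopology G]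
    {E : Type w} [NormedAddCommGroup E]
    [NormedSpace ℝ E] [CompleteSpace E] (T : G → E →L[ℝ] E)
    (hTone : T 1 = ContinuousLinearMap.id ℝ E) (hTmul : ∀ g h, T (g * h) = (T g).comp (T h)) (hT1 : ∀ g, ‖T g‖ ≤ 1)
    (hTc : ∀ ν, Continuous fun g => T g ν) {C : Set E} (hconv : Convex ℝ C) (hcl : IsClosed C)
    {M : ℝ} (hM : ∀ ν ∈ C, ‖ν‖ ≤ M) (hC : ∀ g, ∀ ν ∈ C, T g ν ∈ C)
    (φ : (E →L[ℝ] ℝ) →L[ℝ] ℝ) (hφ : ∀ Λ g, φ (Λ.comp (T g)) = φ Λ)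
    (hφC : ∀ (Λ : E →L[ℝ] ℝ) (c : ℝ), (∀ ν ∈ C, c ≤ Λ ν) → c ≤ φ Λ)
    {K : Set G} (hK : IsCompact K) {ε : ℝ} (hε : 0 < ε) :
    ∃ ν ∈ C, ∀ g ∈ K, ‖T g ν - ν‖ ≤ ε := by
  borelize G
  set l : Measure G := Measure.haar
  obtain ⟨h, hc, hs, h0, h1, -⟩ := exists_weight l (univ_mem : Set.univ ∈ 𝓝 (1 : G))
  -- Applying `T g` to the average only translates the weight, so g ↦ T_g S is continuous in
  -- operator norm. This is what later gives uniformity on compact sets.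
  set S := weightedAverage l hc hs T hTc hT1 with hS
  have hTS : ∀ g, ∃ (hcg : Continuous fun t => h (g⁻¹ * t))
      (hsg : HasCompactSupport fun t => h (g⁻¹ * t)),
      (T g).comp S = weightedAverage l hcg hsg T hTc hT1 := fun g => by
    have hsg : HasCompactSupport fun t => h (g⁻¹ * t) :=
      hs.comp_homeomorph (Homeomorph.mulLeft g⁻¹)
    refine ⟨by fun_prop, hsg, ?_⟩
    ext ν
    rw [ContinuousLinearMap.comp_apply, hS, weightedAverage_apply, weightedAverage_apply,
      ← ContinuousLinearMap.integral_comp_comm _ (integrable_weight_smul l hc hs (hTc ν)),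
      ← integral_mul_left_eq_self (fun t => h (g⁻¹ * t) • T t ν) g]
    simp [hTmul]
  have hScont : ∀ g, Tendsto (fun r => ‖(T r).comp S - (T g).comp S‖) (𝓝 g) (𝓝 0) := fun g => by
    have h2 := (tendsto_integral_abs_translate_sub l hc hs g⁻¹).comp (continuous_inv.tendsto g)
    refine squeeze_zero (fun r => norm_nonneg _) (fun r => ?_) h2
    obtain ⟨h3, h4, h5⟩ := hTS r
    obtain ⟨h6, h7, h8⟩ := hTS g
    rw [h5, h8]
    exact norm_weightedAverage_sub_le l _ _ _ _ _ _ _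
  -- The functionals Λ T_t need not depend on t continuously in norm, so φ cannot simply be taken
  -- inside S. A second average R, inserted to the right of Λ, repairs this: φ(Λ R T_g S) = φ(Λ R)
  -- for every g. Choosing R concentrated near 1 keeps R T_g S and R S norm-close to T_g S and S,
  -- and the error δ is then sent to 0.
  have hinv : ∀ (Λ : E →L[ℝ] ℝ) g, φ (Λ.comp ((T g).comp S)) = φ (Λ.comp S) := by
    intro Λ g
    have key : ∀ δ : ℝ, 0 < δ → |φ (Λ.comp ((T g).comp S)) - φ (Λ.comp S)| ≤
        2 * (‖φ‖ * (‖Λ‖ * δ)) := fun δ hδ => by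
      have hnear : ∀ g, ∀ᶠ t in 𝓝 (1 : G), ‖(T t⁻¹).comp ((T g).comp S) - (T g).comp S‖ ≤ δ := by
        intro g
        have h3 : Tendsto (fun t : G => t⁻¹ * g) (𝓝 1) (𝓝 g) := by
          have : Continuous fun t : G => t⁻¹ * g := by fun_prop
          simpa using this.tendsto 1
        have h4 := ((hScont g).comp h3).eventually (ge_mem_nhds hδ)
        filter_upwards [h4] with t ht
        simpa only [Function.comp_apply, hTmul, ContinuousLinearMap.comp_assoc] using ht
      obtain ⟨k, kc, ks, k0, k1, kU⟩ := exists_weight l ((hnear g).and (hnear 1))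
      have hBc : ∀ ν, Continuous fun t => T t⁻¹ ν := fun ν => (hTc ν).comp continuous_inv
      set R := weightedAverage l kc ks (fun t => T t⁻¹) hBc (fun t => hT1 _) with hR
      have hRc : Continuous fun s => R.comp (T s) := by
        have hRT : ∀ g, ∃ (hcg : Continuous fun t => k (g * t))
            (hsg : HasCompactSupport fun t => k (g * t)),
            R.comp (T g) = weightedAverage l hcg hsg (fun t => T t⁻¹) hBc (fun t => hT1 _) := by
          intro g
          have hsg : HasCompactSupport fun t => k (g * t) :=
            ks.comp_homeomorph (Homeomorph.mulLeft g)
          refine ⟨by fun_prop, hsg, ?_⟩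
          ext ν
          rw [ContinuousLinearMap.comp_apply, hR, weightedAverage_apply, weightedAverage_apply,
            ← integral_mul_left_eq_self _ g]
          congr 1 with t
          rw [← ContinuousLinearMap.comp_apply, ← hTmul]
          simp
        rw [continuous_iff_continuousAt]
        intro s
        rw [ContinuousAt, tendsto_iff_norm_sub_tendsto_zero]
        refine squeeze_zero (fun r => norm_nonneg _) (fun r => ?_)
          (tendsto_integral_abs_translate_sub l kc ks s)
        obtain ⟨h3, h4, h5⟩ := hRT r
        obtain ⟨h6, h7, h8⟩ := hRT s
        rw [h5, h8]
        exact norm_weightedAverage_sub_le l _ _ _ _ _ _ _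
      have e1 : ∀ g, φ ((Λ.comp R).comp ((T g).comp S)) = φ (Λ.comp R) := fun g => by
        rw [← ContinuousLinearMap.comp_assoc, hS, map_comp_weightedAverage l hc hs h1 T hTc hT1 φ
          ((Λ.comp R).comp (T g)) ?_ ?_, hφ]
        · have h9 : Continuous fun t => (R.comp (T (g * t))) := hRc.comp (continuous_const_mul g)
          have h10 : Continuous fun t => Λ.comp (R.comp (T (g * t))) :=
            (ContinuousLinearMap.compL ℝ E E ℝ Λ).continuous.comp h9
          simpa only [hTmul, ContinuousLinearMap.comp_assoc] using h10
        · exact fun t => hφ _ _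
      have e2 : ∀ Q : E →L[ℝ] E, ‖R.comp Q - Q‖ ≤ δ →
          |φ ((Λ.comp R).comp Q) - φ (Λ.comp Q)| ≤ ‖φ‖ * (‖Λ‖ * δ) := fun Q hQ => by
        rw [← map_sub, ContinuousLinearMap.comp_assoc, ← ContinuousLinearMap.comp_sub,
          ← Real.norm_eq_abs]
        refine (φ.le_opNorm _).trans ?_
        gcongr
        refine (ContinuousLinearMap.opNorm_comp_le _ _).trans ?_
        gcongr
      have e3 := e2 _ (norm_weightedAverage_comp_sub_le l kc ks k0 k1 _ hBc _ ((T g).comp S) hδ.le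
        fun t ht => (kU t ht).1)
      have e4 := e2 _ (norm_weightedAverage_comp_sub_le l kc ks k0 k1 _ hBc _ ((T 1).comp S) hδ.le
        fun t ht => (kU t ht).2)
      rw [e1, abs_le] at e3 e4
      rw [hTone, ContinuousLinearMap.id_comp] at e4
      rw [abs_le]
      constructor <;> linarith [e3.1, e3.2, e4.1, e4.2]
    have h3 : Tendsto (fun δ : ℝ => 2 * (‖φ‖ * (‖Λ‖ * δ))) (𝓝[>] 0) (𝓝 0) := by
      have : Continuous fun δ : ℝ => 2 * (‖φ‖ * (‖Λ‖ * δ)) := by fun_prop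
      simpa using (this.tendsto 0).mono_left nhdsWithin_le_nhds
    have h4 := ge_of_tendsto h3 (eventually_nhdsWithin_of_forall fun δ hδ => key δ hδ)
    exact sub_eq_zero.1 (abs_nonpos_iff.1 h4)
  obtain ⟨δ, hδ, hδM⟩ : ∃ δ : ℝ, 0 < δ ∧ δ * |M| ≤ ε / 2 :=
    ⟨ε / 2 / (|M| + 1), by positivity, by
      rw [div_mul_eq_mul_div, div_le_iff₀ (by positivity)]
      gcongr
      linarith⟩
  -- By norm continuity finitely many group elements approximate all of `K`, uniformly on the
  -- bounded set `C`.
  obtain ⟨F, -, hF⟩ := hK.elim_nhds_subcover (fun g => {r | ‖(T r).comp S - (T g).comp S‖ ≤ δ})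
    fun g _ => (hScont g).eventually (ge_mem_nhds hδ)
  classical
  set D : E →L[ℝ] (F → E) := ContinuousLinearMap.pi fun g => (T g).comp S - S with hD
  -- If 0 were not approximated by the joint displacements T_g S ν - S ν with ν in C, a functional
  -- would be bounded below by some u > 0 on the convex set of displacements. The mean of its
  -- pullback would be at least u, while `hinv` makes it zero.
  have h0mem : (0 : F → E) ∈ closure (D '' C) := by
    by_contra hne
    obtain ⟨Λ, u, hu0, hu⟩ := geometric_hahn_banach_point_closed
      (hconv.linear_image D.toLinearMap).closure isClosed_closure hne
    have h3 : φ (Λ.comp D) = 0 := by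
      have h4 : Λ.comp D = ∑ g : F, ((Λ.comp (ContinuousLinearMap.single ℝ (fun _ : F => E) g)).comp
          ((T g).comp S) - (Λ.comp (ContinuousLinearMap.single ℝ (fun _ : F => E) g)).comp S) := by
        ext ν
        rw [ContinuousLinearMap.comp_apply, ← Finset.univ_sum_single (D ν), map_sum]
        simp only [sum_apply, sub_apply, ContinuousLinearMap.comp_apply, ← map_sub]
        rfl
      rw [h4, map_sum]
      refine Finset.sum_eq_zero fun g _ => ?_
      rw [map_sub, hinv, sub_self]
    have h5 := hφC (Λ.comp D) u fun ν hν => (hu _ (subset_closure ⟨ν, hν, rfl⟩)).le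
    rw [map_zero] at hu0
    linarith
  obtain ⟨_, ⟨ν, hν, rfl⟩, hdist⟩ := Metric.mem_closure_iff.1 h0mem (ε / 2) (by positivity)
  refine ⟨S ν, weightedAverage_mem l hc hs h0 h1 T hTc hT1 hconv hcl fun t => hC t ν hν,
    fun g hg => ?_⟩
  obtain ⟨r, hr, hgr⟩ := Set.mem_iUnion₂.1 (hF hg)
  have h3 : ‖T r (S ν) - S ν‖ ≤ ε / 2 := by
    rw [dist_zero_left] at hdist
    exact (norm_le_pi_norm (D ν) ⟨r, hr⟩).trans hdist.le
  have h4 : ‖T g (S ν) - T r (S ν)‖ ≤ ε / 2 := by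
    refine (((T g).comp S - (T r).comp S).le_of_opNorm_le hgr ν).trans (le_trans ?_ hδM)
    gcongr
    exact (hM ν hν).trans (le_abs_self M)
  calc ‖T g (S ν) - S ν‖ = ‖(T g (S ν) - T r (S ν)) + (T r (S ν) - S ν)‖ := by
        rw [sub_add_sub_cancel]
    _ ≤ ε := (norm_add_le _ _).trans (by linarith)

end Reiter

/-! ### The dual of `L¹` -/

section DualLone

variable {X : Type z} [MeasurableSpace X] {m : Measure X}

theorem integrable_mul_of_ae_abs_le {F f : X → ℝ} {M : ℝ} (hF : AEStronglyMeasurable F m)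
    (hM : ∀ᵐ ω ∂m, |F ω| ≤ M) (hf : Integrable f m) : Integrable (fun ω => F ω * f ω) m :=
  hf.bdd_mul hF hM

/-- Integration against a bounded function, as a functional on `L¹`. -/
def integralMulCLM {F : X → ℝ} {M : ℝ} (hF : AEStronglyMeasurable F m)
    (hM : ∀ᵐ ω ∂m, |F ω| ≤ M) : Lp ℝ 1 m →L[ℝ] ℝ :=
  LinearMap.mkContinuous
    { toFun := fun f => ∫ ω, F ω * f ω ∂m
      map_add' := fun f g => by
        rw [← integral_add (integrable_mul_of_ae_abs_le hF hM (L1.integrable_coeFn f))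
          (integrable_mul_of_ae_abs_le hF hM (L1.integrable_coeFn g))]
        refine integral_congr_ae ?_
        filter_upwards [Lp.coeFn_add f g] with ω hω
        rw [hω, Pi.add_apply, mul_add]
      map_smul' := fun c f => by
        rw [RingHom.id_apply, smul_eq_mul, ← integral_const_mul]
        refine integral_congr_ae ?_
        filter_upwards [Lp.coeFn_smul c f] with ω hω
        rw [hω, Pi.smul_apply, smul_eq_mul, mul_left_comm] }
    M fun f => by
      refine (norm_integral_le_integral_norm _).trans ?_
      rw [L1.norm_eq_integral_norm, ← integral_const_mul]
      refine integral_mono_ae (integrable_mul_of_ae_abs_le hF hM (L1.integrable_coeFn f)).norm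
        ((L1.integrable_coeFn f).norm.const_mul M) ?_
      filter_upwards [hM] with ω hω
      rw [norm_mul]
      gcongr
      exact hω

theorem integralMulCLM_toL1 {F f : X → ℝ} {M : ℝ} (hF : AEStronglyMeasurable F m)
    (hM : ∀ᵐ ω ∂m, |F ω| ≤ M) (hf : Integrable f m) :
    integralMulCLM hF hM hf.toL1 = ∫ ω, F ω * f ω ∂m := by
  change ∫ ω, F ω * hf.toL1 f ω ∂m = _
  refine integral_congr_ae ?_
  filter_upwards [hf.coeFn_toL1] with ω hω
  rw [hω]

theorem norm_toL1_indicator_one [IsFiniteMeasure m] {A : Set X} (hA : MeasurableSet A)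
    (h : Integrable (A.indicator fun _ => (1 : ℝ)) m) : ‖h.toL1‖ = m.real A := by
  rw [L1.norm_of_fun_eq_integral_norm]
  simp_rw [norm_indicator_eq_indicator_norm]
  simp [integral_indicator hA]

/-- On a probability space L² embeds in L¹, so Λ restricts to L² and is represented there by Riesz.
Testing on indicators bounds the representative by ‖Λ‖ almost everywhere, and density of simple
functions extends the formula to L¹. -/
theorem exists_integral_eq_of_dual_L1 [IsProbabilityMeasure m] (Λ : Lp ℝ 1 m →L[ℝ] ℝ) :
    ∃ (F : X → ℝ) (hF : AEStronglyMeasurable F m) (hM : ∀ᵐ ω ∂m, |F ω| ≤ ‖Λ‖),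
      Λ = integralMulCLM hF hM := by
  have hint : ∀ ξ : Lp ℝ 2 m, Integrable ξ m := fun ξ => (Lp.memLp ξ).integrable (by norm_num)
  have hnorm : ∀ ξ : Lp ℝ 2 m, ‖(hint ξ).toL1‖ ≤ ‖ξ‖ := fun ξ => by
    rw [Integrable.toL1, Lp.norm_toLp, Lp.norm_def]
    exact ENNReal.toReal_mono (Lp.eLpNorm_ne_top ξ)
      (eLpNorm_le_eLpNorm_of_exponent_le (by norm_num) (Lp.aestronglyMeasurable ξ))
  set ψ : Lp ℝ 2 m →L[ℝ] ℝ := LinearMap.mkContinuous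
    { toFun := fun ξ => Λ (hint ξ).toL1
      map_add' := fun ξ η => by
        rw [← map_add, ← Integrable.toL1_add]
        congr 1
        exact (Integrable.toL1_eq_toL1_iff _ _ _ _).2 (Lp.coeFn_add ξ η)
      map_smul' := fun c ξ => by
        rw [RingHom.id_apply, ← map_smul, ← Integrable.toL1_smul]
        congr 1
        exact (Integrable.toL1_eq_toL1_iff _ _ _ _).2 (Lp.coeFn_smul c ξ) }
    ‖Λ‖ (fun ξ => (Λ.le_opNorm _).trans (by gcongr; exact hnorm ξ)) with hψ
  set F := (InnerProductSpace.toDual ℝ (Lp ℝ 2 m)).symm ψ with hFdef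
  have hFint := hint F
  have hind : ∀ A : Set X, MeasurableSet A → Integrable (A.indicator fun _ => (1 : ℝ)) m :=
    fun A hA => (integrable_const 1).indicator hA
  have hFA : ∀ (A : Set X) (hA : MeasurableSet A), Λ (hind A hA).toL1 = ∫ ω in A, F ω ∂m := by
    intro A hA
    have hm : MemLp (A.indicator fun _ => (1 : ℝ)) 2 m := (memLp_const 1).indicator hA
    have h1 : Λ (hind A hA).toL1 = ψ hm.toLp := by
      change _ = Λ _
      congr 1
      exact (Integrable.toL1_eq_toL1_iff _ _ _ _).2 hm.coeFn_toLp.symm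
    have h2 : ψ hm.toLp = ⟪F, hm.toLp⟫ := by
      rw [hFdef, InnerProductSpace.toDual_symm_apply]
    rw [h1, h2, L2.inner_def, ← integral_indicator hA]
    refine integral_congr_ae ?_
    filter_upwards [hm.coeFn_toLp] with ω hω
    rw [hω]
    by_cases h : ω ∈ A <;> simp [h]
  have hbound : ∀ A : Set X, MeasurableSet A → |∫ ω in A, F ω ∂m| ≤ ‖Λ‖ * m.real A := by
    intro A hA
    rw [← hFA A hA, ← norm_toL1_indicator_one hA (hind A hA)]
    exact Λ.le_opNorm _
  have hM : ∀ᵐ ω ∂m, |F ω| ≤ ‖Λ‖ := by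
    have h1 : F ≤ᵐ[m] fun _ => ‖Λ‖ := by
      refine ae_le_of_forall_setIntegral_le hFint (integrable_const _) fun A hA _ => ?_
      refine (le_abs_self _).trans ((hbound A hA).trans ?_)
      simp [mul_comm]
    have h2 : (fun _ => -‖Λ‖) ≤ᵐ[m] F := by
      refine ae_le_of_forall_setIntegral_le (integrable_const _) hFint fun A hA _ => ?_
      have := (abs_le.1 (hbound A hA)).1
      simpa [mul_comm] using this
    filter_upwards [h1, h2] with ω h3 h4
    exact abs_le.2 ⟨h4, h3⟩
  have hF := Lp.aestronglyMeasurable F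
  refine ⟨F, hF, hM, ?_⟩
  have key : ∀ f : X → ℝ, Integrable f m → ∀ hf : Integrable f m,
      Λ hf.toL1 = integralMulCLM hF hM hf.toL1 := by
    intro f hf
    refine Integrable.induction (fun f => ∀ hf : Integrable f m,
      Λ hf.toL1 = integralMulCLM hF hM hf.toL1) (fun c A hA _ hf => ?_)
      (fun f g _ hf hg h1 h2 h => ?_) ?_ ?_ hf
    · have h1 : hf.toL1 = c • (hind A hA).toL1 := by
        rw [← Integrable.toL1_smul]
        refine (Integrable.toL1_eq_toL1_iff _ _ _ _).2 (ae_of_all _ fun ω => ?_)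
        by_cases h : ω ∈ A <;> simp [h]
      rw [h1, map_smul, map_smul, hFA A hA, integralMulCLM_toL1, ← integral_indicator hA]
      congr 2 with ω
      by_cases h : ω ∈ A <;> simp [h]
    · rw [Integrable.toL1_add _ _ hf hg, map_add, map_add, h1, h2]
    · have h1 : {f : Lp ℝ 1 m | ∀ hf : Integrable f m,
          Λ hf.toL1 = integralMulCLM hF hM hf.toL1} = {f | Λ f = integralMulCLM hF hM f} := by
        ext f
        simp only [Set.mem_ofPred_eq, Integrable.toL1_coeFn]
        exact ⟨fun h => h (L1.integrable_coeFn f), fun h _ => h⟩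
      rw [h1]
      exact isClosed_eq Λ.continuous (ContinuousLinearMap.continuous _)
    · intro f g hfg hf h hg
      rw [← (Integrable.toL1_eq_toL1_iff _ _ hf hg).2 hfg]
      exact h hf
  ext f
  have := key f (L1.integrable_coeFn f) (L1.integrable_coeFn f)
  rwa [Integrable.toL1_coeFn] at this

end DualLone

/-! ### The action on `L¹` and on `L^∞` -/

section Transfer

variable {G : Type v} [Group G] [TopologicalSpace G] {X : Type z} [MeasurableSpace X]
  {m : Measure X} (σ : NonsingularAction G X m)

namespace NonsingularAction

theorem norm_toL1_jac_mul [SigmaFinite m] (g : G) (f : Lp ℝ 1 m) :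
    ‖(σ.integrable_jac_mul g (L1.integrable_coeFn f)).toL1‖ = ‖f‖ := by
  rw [L1.norm_of_fun_eq_integral_norm, L1.norm_eq_integral_norm, ← σ.integral_jac_mul g
    (Lp.aestronglyMeasurable f).norm]
  congr 1 with ω
  rw [norm_mul, Real.norm_of_nonneg (σ.jac_nonneg g ω)]

/-- The action on densities of measures. -/
def transfer [SigmaFinite m] (g : G) : Lp ℝ 1 m →L[ℝ] Lp ℝ 1 m :=
  LinearMap.mkContinuous
    { toFun := fun f => (σ.integrable_jac_mul g (L1.integrable_coeFn f)).toL1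
      map_add' := fun f f' => by
        rw [← Integrable.toL1_add]
        refine (Integrable.toL1_eq_toL1_iff _ _ _ _).2 ?_
        filter_upwards [(σ.quasiMeasurePreserving g⁻¹).ae_eq (Lp.coeFn_add f f')] with ω hω
        simp only [Function.comp_apply, Pi.add_apply] at hω ⊢
        rw [hω, mul_add]
      map_smul' := fun c f => by
        rw [RingHom.id_apply, ← Integrable.toL1_smul]
        refine (Integrable.toL1_eq_toL1_iff _ _ _ _).2 ?_
        filter_upwards [(σ.quasiMeasurePreserving g⁻¹).ae_eq (Lp.coeFn_smul c f)] with ω hω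
        simp only [Function.comp_apply, Pi.smul_apply, smul_eq_mul] at hω ⊢
        rw [hω, mul_left_comm] }
    1 fun f => by rw [one_mul]; exact (σ.norm_toL1_jac_mul g f).le

theorem transfer_ae_eq [SigmaFinite m] (g : G) (f : Lp ℝ 1 m) :
    σ.transfer g f =ᵐ[m] fun ω => σ.jac g ω * f (σ.act g⁻¹ ω) :=
  (σ.integrable_jac_mul g (L1.integrable_coeFn f)).coeFn_toL1

theorem norm_transfer_le [SigmaFinite m] (g : G) : ‖σ.transfer g‖ ≤ 1 :=
  LinearMap.mkContinuous_norm_le _ zero_le_one _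

theorem integral_mul_transfer [SigmaFinite m] (g : G) {F : X → ℝ} (hF : AEStronglyMeasurable F m)
    (f : Lp ℝ 1 m) :
    ∫ ω, F ω * σ.transfer g f ω ∂m = ∫ ω, F (σ.act g ω) * f ω ∂m := by
  rw [← σ.integral_jac_mul g (f := fun ω => F (σ.act g ω) * f ω)
    ((hF.comp_quasiMeasurePreserving (σ.quasiMeasurePreserving g)).mul
      (Lp.aestronglyMeasurable f))]
  refine integral_congr_ae ?_
  have h := σ.act_inv_act g⁻¹
  rw [inv_inv] at h
  filter_upwards [σ.transfer_ae_eq g f, h] with ω h1 h2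
  rw [h1, h2, mul_left_comm]

theorem setIntegral_transfer [SigmaFinite m] (g : G) (f : Lp ℝ 1 m) {A : Set X}
    (hA : MeasurableSet A) :
    ∫ ω in A, σ.transfer g f ω ∂m = ∫ ω in σ.act g ⁻¹' A, f ω ∂m := by
  have h := σ.integral_mul_transfer g (F := A.indicator fun _ => 1)
    ((measurable_const.indicator hA).aestronglyMeasurable) f
  rw [← integral_indicator hA, ← integral_indicator (σ.measurable_act g hA)]
  convert h using 2 with ω
  · ext ω; by_cases hω : ω ∈ A <;> simp [hω]
  · ext ω; by_cases hω : σ.act g ω ∈ A <;> simp [hω]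

theorem L1_ext {f f' : Lp ℝ 1 m}
    (h : ∀ A, MeasurableSet A → ∫ ω in A, f ω ∂m = ∫ ω in A, f' ω ∂m) : f = f' :=
  Lp.ext ((L1.integrable_coeFn f).ae_eq_of_forall_setIntegral_eq _ _ (L1.integrable_coeFn f')
    fun A hA _ => h A hA)

theorem transfer_one [SigmaFinite m] : σ.transfer 1 = ContinuousLinearMap.id ℝ _ := by
  refine ContinuousLinearMap.ext fun f => L1_ext fun A hA => ?_
  rw [setIntegral_transfer _ _ _ hA]
  refine setIntegral_congr_set ?_
  filter_upwards [σ.act_one] with ω hω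
  exact congrArg A hω

theorem transfer_mul [SigmaFinite m] (g h : G) :
    σ.transfer (g * h) = (σ.transfer g).comp (σ.transfer h) := by
  refine ContinuousLinearMap.ext fun f => L1_ext fun A hA => ?_
  rw [setIntegral_transfer _ _ _ hA, ContinuousLinearMap.comp_apply, setIntegral_transfer _ _ _ hA,
    setIntegral_transfer _ _ _ (σ.measurable_act g hA)]
  refine setIntegral_congr_set ?_
  filter_upwards [σ.act_mul g h] with ω hω
  exact congrArg A hω

/-- This converts the total variation continuity of the action into norm continuity on L¹. The
factor 2 comes from bounding the integrals over the set where the difference is nonnegative and over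
its complement separately. -/
theorem norm_transfer_sub_le [SigmaFinite m] {f : Lp ℝ 1 m} (hf : 0 ≤ᵐ[m] f)
    {η : Measure X} [IsProbabilityMeasure η] (hη : η = m.withDensity fun ω => ENNReal.ofReal (f ω))
    (g : G) : ENNReal.ofReal ‖σ.transfer g f - f‖ ≤
      2 * ((η.map (σ.act g)).toSignedMeasure - η.toSignedMeasure).totalVariation Set.univ := by
  have : IsProbabilityMeasure (η.map (σ.act g)) :=
    Measure.isProbabilityMeasure_map (σ.measurable_act g).aemeasurable
  set s := (η.map (σ.act g)).toSignedMeasure - η.toSignedMeasure with hs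
  have hreal : ∀ A, MeasurableSet A → η.real A = ∫ ω in A, f ω ∂m := fun A hA => by
    rw [Measure.real, hη, withDensity_apply _ hA, integral_eq_lintegral_of_nonneg_ae
      (ae_restrict_of_ae hf) (Lp.aestronglyMeasurable f).restrict]
  set k := σ.transfer g f - f with hk
  have hki := L1.integrable_coeFn k
  have hsA : ∀ A, MeasurableSet A → ENNReal.ofReal |∫ ω in A, k ω ∂m| ≤
      s.totalVariation Set.univ := fun A hA => by
    have h1 : ∫ ω in A, k ω ∂m = s A := by
      rw [hs, sub_apply, Measure.toSignedMeasure_apply_measurable hA,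
        Measure.toSignedMeasure_apply_measurable hA,
        map_measureReal_apply (σ.measurable_act g) hA,
        hreal _ hA, hreal _ (σ.measurable_act g hA), ← setIntegral_transfer _ _ _ hA,
        ← integral_sub (L1.integrable_coeFn _).integrableOn (L1.integrable_coeFn _).integrableOn]
      exact integral_congr_ae (ae_restrict_of_ae (Lp.coeFn_sub _ _))
    rw [h1, ← Real.norm_eq_abs, ofReal_norm]
    exact (s.enorm_le_totalVariation A).trans (measure_mono (Set.subset_univ _))
  obtain ⟨A, hA, h1⟩ : ∃ A, MeasurableSet A ∧ ‖k‖ = ∫ ω in A, k ω ∂m - ∫ ω in Aᶜ, k ω ∂m := by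
    have hkm := (Lp.stronglyMeasurable k).measurable
    have hA : MeasurableSet {ω | 0 ≤ k ω} := measurableSet_le measurable_const hkm
    refine ⟨_, hA, ?_⟩
    rw [L1.norm_eq_integral_norm, ← integral_add_compl hA hki.norm, sub_eq_add_neg,
      ← integral_neg]
    congr 1
    · refine setIntegral_congr_fun hA fun ω hω => ?_
      exact Real.norm_of_nonneg hω
    · refine setIntegral_congr_fun hA.compl fun ω hω => ?_
      exact Real.norm_of_nonpos (le_of_lt (not_le.1 (by simpa using hω)))
  calc ENNReal.ofReal ‖k‖ ≤ ENNReal.ofReal (|∫ ω in A, k ω ∂m| + |∫ ω in Aᶜ, k ω ∂m|) := by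
        rw [h1]
        exact ENNReal.ofReal_le_ofReal (by
          linarith [le_abs_self (∫ ω in A, k ω ∂m), neg_abs_le (∫ ω in Aᶜ, k ω ∂m)])
    _ ≤ _ := by
        rw [ENNReal.ofReal_add (abs_nonneg _) (abs_nonneg _), two_mul]
        exact add_le_add (hsA A hA) (hsA _ hA.compl)

theorem tendsto_transfer_of_nonneg [SigmaFinite m] {f : Lp ℝ 1 m} (hf : 0 ≤ᵐ[m] f) :
    Tendsto (fun g => σ.transfer g f) (𝓝 1) (𝓝 f) := by
  rcases eq_or_ne f 0 with rfl | hf0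
  · simp
  have hn : ‖f‖ ≠ 0 := norm_ne_zero_iff.2 hf0
  set f' : Lp ℝ 1 m := ‖f‖⁻¹ • f with hf'
  have hae : f' =ᵐ[m] fun ω => ‖f‖⁻¹ * f ω := Lp.coeFn_smul _ _
  have hf'0 : 0 ≤ᵐ[m] f' := by
    filter_upwards [hf, hae] with ω h1 h2
    rw [h2]
    exact mul_nonneg (by positivity) h1
  set η := m.withDensity fun ω => ENNReal.ofReal (f' ω) with hη
  have hprob : IsProbabilityMeasure η := ⟨by
    have h1 : ‖f'‖ = 1 := by rw [hf', norm_smul, norm_inv, norm_norm, inv_mul_cancel₀ hn]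
    have h2 : ∫ ω, f' ω ∂m = ‖f'‖ := by
      rw [L1.norm_eq_integral_norm]
      refine integral_congr_ae ?_
      filter_upwards [hf'0] with ω hω
      exact (Real.norm_of_nonneg hω).symm
    rw [hη, withDensity_apply _ .univ, Measure.restrict_univ,
      ← ofReal_integral_eq_lintegral_ofReal (L1.integrable_coeFn _) hf'0,
      h2, h1, ENNReal.ofReal_one]⟩
  have h1 := σ.tendsto_totalVariation η (withDensity_absolutelyContinuous _ _)
  have h2 : Tendsto (fun g => ENNReal.ofReal ‖σ.transfer g f' - f'‖) (𝓝 1) (𝓝 0) := by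
    have h3 := ENNReal.Tendsto.const_mul (a := 2) h1 (Or.inr (by simp))
    rw [mul_zero] at h3
    exact tendsto_of_tendsto_of_tendsto_of_le_of_le tendsto_const_nhds h3 (fun _ => zero_le)
      fun g => σ.norm_transfer_sub_le hf'0 rfl g
  have h4 : Tendsto (fun g => σ.transfer g f') (𝓝 1) (𝓝 f') := by
    rw [tendsto_iff_norm_sub_tendsto_zero]
    have h5 := (ENNReal.tendsto_toReal ENNReal.zero_ne_top).comp h2
    simpa [Function.comp_def, ENNReal.toReal_ofReal] using h5
  have h6 : f = ‖f‖ • f' := by rw [hf', smul_smul, mul_inv_cancel₀ hn, one_smul]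
  rw [h6]
  simp only [map_smul]
  exact h4.const_smul _

/-- Positive and negative parts reduce continuity at 1 to nonnegative functions, which are multiples
of probability densities. The group law moves continuity from 1 to any g. -/
theorem continuous_transfer [SigmaFinite m] [IsTopologicalGroup G] (f : Lp ℝ 1 m) :
    Continuous fun g => σ.transfer g f := by
  have h1 : Tendsto (fun g => σ.transfer g f) (𝓝 1) (𝓝 f) := by
    have h2 : f = Lp.posPart f - Lp.negPart f := by
      ext1
      filter_upwards [Lp.coeFn_sub (Lp.posPart f) (Lp.negPart f), Lp.coeFn_posPart f,
        Lp.coeFn_negPart f] with ω h1 h2 h3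
      rw [h1, Pi.sub_apply, h2, h3]
      rcases le_total 0 (f ω) with h | h <;> simp [h]
    have h3 : 0 ≤ᵐ[m] Lp.posPart f := by
      filter_upwards [Lp.coeFn_posPart f] with ω h
      rw [h]; exact le_max_right _ _
    have h4 : 0 ≤ᵐ[m] Lp.negPart f := by
      filter_upwards [Lp.coeFn_negPart f] with ω h
      rw [h]; simp
    rw [h2]
    simp only [map_sub]
    exact (σ.tendsto_transfer_of_nonneg h3).sub (σ.tendsto_transfer_of_nonneg h4)
  rw [continuous_iff_continuousAt]
  intro g
  have h2 : Tendsto (fun r => g⁻¹ * r) (𝓝 g) (𝓝 1) := by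
    have : Continuous fun r : G => g⁻¹ * r := by fun_prop
    simpa using this.tendsto g
  have h3 := ((σ.transfer g).continuous.tendsto f).comp (h1.comp h2)
  refine h3.congr fun r => ?_
  simp only [Function.comp_apply]
  rw [← ContinuousLinearMap.comp_apply, ← transfer_mul, mul_inv_cancel_left]

end NonsingularAction

end Transfer

/-! ### Almost invariant vectors from invariant means -/

section Mean

variable {G : Type v} [Group G] [TopologicalSpace G] {X : Type z} [MeasurableSpace X]
  {m : Measure X}

theorem ae_abs_le_norm_Linfty (f : Lp ℝ ∞ m) : ∀ᵐ ω ∂m, |f ω| ≤ ‖f‖ := by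
  filter_upwards [ae_le_eLpNormEssSup (f := f) (μ := m)] with ω hω
  rw [Lp.norm_def, eLpNorm_exponent_top]
  have h2 := ENNReal.toReal_mono (by
    rw [← eLpNorm_exponent_top]; exact (Lp.memLp f).eLpNorm_ne_top) hω
  simpa using h2

theorem norm_toLp_top_le {f : X → ℝ} {M : ℝ} (hM0 : 0 ≤ M) (hf : MemLp f ∞ m)
    (hM : ∀ᵐ ω ∂m, |f ω| ≤ M) : ‖hf.toLp‖ ≤ M := by
  rw [Lp.norm_toLp, eLpNorm_exponent_top]
  exact ENNReal.toReal_le_of_le_ofReal hM0 (eLpNormEssSup_le_of_ae_bound hM)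

/-- Bounded functions modulo null sets, and their norm, depend on the measure class only. This
permits replacing m by a Gaussian probability measure. -/
theorem HasInvariantMean.congrMeasure {σ : NonsingularAction G X m} (hσ : HasInvariantMean σ)
    {m' : Measure X} (h : m' ≪ m) (h' : m ≪ m') : HasInvariantMean (σ.congrMeasure h h') := by
  obtain ⟨φ, h0, h1, hinv⟩ := hσ
  have hb : ∀ f : Lp ℝ ∞ m', ∀ᵐ ω ∂m, |f ω| ≤ ‖f‖ := fun f => h' (ae_abs_le_norm_Linfty f)
  have hmem : ∀ f : Lp ℝ ∞ m', MemLp f ∞ m := fun f =>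
    memLp_top_of_bound (Lp.stronglyMeasurable f).aestronglyMeasurable _ (hb f)
  set j : Lp ℝ ∞ m' →L[ℝ] Lp ℝ ∞ m := LinearMap.mkContinuous
    { toFun := fun f => (hmem f).toLp
      map_add' := fun f g => by
        rw [← MemLp.toLp_add]
        exact MemLp.toLp_congr _ _ (h'.ae_eq (Lp.coeFn_add f g))
      map_smul' := fun c f => by
        rw [RingHom.id_apply, ← MemLp.toLp_const_smul]
        exact MemLp.toLp_congr _ _ (h'.ae_eq (Lp.coeFn_smul c f)) }
    1 fun f => by
      rw [one_mul]
      exact norm_toLp_top_le (norm_nonneg f) (hmem f) (hb f)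
  have hj : ∀ f, j f =ᵐ[m] f := fun f => (hmem f).coeFn_toLp
  refine ⟨φ.comp j, fun f hf => h0 _ ?_, fun f hf => h1 _ ?_, fun g f f' hff' => hinv g _ _ ?_⟩
  · rw [← Lp.coeFn_nonneg] at hf ⊢
    filter_upwards [hj f, h'.ae_le hf] with ω h3 h4
    exact h4.trans h3.ge
  · exact (hj f).trans (h'.ae_eq hf)
  · refine (hj f').trans ((h'.ae_eq hff').trans ?_)
    exact (σ.quasiMeasurePreserving g).ae_eq (hj f).symm

/-- From |√a - √b| ≤ √a + √b. It turns L¹ closeness of densities into L² closeness of their square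
roots. -/
theorem sq_sqrt_sub_sqrt_le {a b : ℝ} (ha : 0 ≤ a) (hb : 0 ≤ b) : (√a - √b) ^ 2 ≤ |a - b| := by
  have h1 : |√a - √b| ≤ √a + √b := by
    rw [abs_le]; constructor <;> linarith [Real.sqrt_nonneg a, Real.sqrt_nonneg b]
  have h2 : a - b = (√a - √b) * (√a + √b) := by
    ring_nf; rw [Real.sq_sqrt ha, Real.sq_sqrt hb]
  rw [h2, abs_mul, ← sq_abs, pow_two, abs_of_nonneg (add_nonneg (Real.sqrt_nonneg a)
    (Real.sqrt_nonneg b))]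
  gcongr

variable [IsProbabilityMeasure m] {σ : NonsingularAction G X m}

/-- The bounded representatives are chosen without regard to linearity. Their integrals over sets
are linear in Λ and determine them almost everywhere, so linearity is automatic in L^∞. -/
theorem exists_dual_L1_to_Linfty : ∃ J : (Lp ℝ 1 m →L[ℝ] ℝ) →L[ℝ] Lp ℝ ∞ m,
    ∀ Λ f, Λ f = ∫ ω, J Λ ω * f ω ∂m := by
  choose F hF hM hΛ using fun Λ : Lp ℝ 1 m →L[ℝ] ℝ => exists_integral_eq_of_dual_L1 Λ
  have hmem : ∀ Λ, MemLp (F Λ) ∞ m := fun Λ => memLp_top_of_bound (hF Λ) _ (hM Λ)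
  have hint : ∀ Λ, Integrable (F Λ) m := fun Λ => (hmem Λ).integrable le_top
  have hset : ∀ Λ (A : Set X) (hA : MeasurableSet A), ∫ ω in A, F Λ ω ∂m =
      Λ ((integrable_const (1 : ℝ)).indicator hA).toL1 := fun Λ A hA => by
    conv_rhs => rw [hΛ Λ]
    rw [integralMulCLM_toL1, ← integral_indicator hA]
    congr 1 with ω
    by_cases h : ω ∈ A <;> simp [h]
  refine ⟨LinearMap.mkContinuous
    { toFun := fun Λ => (hmem Λ).toLp
      map_add' := fun Λ Λ' => by
        rw [← MemLp.toLp_add]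
        refine MemLp.toLp_congr _ _ ((hint _).ae_eq_of_forall_setIntegral_eq _ _
          ((hint _).add (hint _)) fun A hA _ => ?_)
        simp only [Pi.add_apply]
        rw [integral_add (hint Λ).integrableOn (hint Λ').integrableOn, hset _ A hA, hset _ A hA,
          hset _ A hA, add_apply]
      map_smul' := fun c Λ => by
        rw [RingHom.id_apply, ← MemLp.toLp_const_smul]
        refine MemLp.toLp_congr _ _ ((hint _).ae_eq_of_forall_setIntegral_eq _ _
          ((hint _).smul c) fun A hA _ => ?_)
        simp only [Pi.smul_apply]
        rw [integral_smul, hset _ A hA, hset _ A hA, smul_apply] }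
    1 fun Λ => ?_, fun Λ f => ?_⟩
  · rw [one_mul]
    exact norm_toLp_top_le (norm_nonneg Λ) (hmem Λ) (hM Λ)
  · conv_lhs => rw [hΛ Λ]
    change ∫ ω, F Λ ω * f ω ∂m = ∫ ω, (hmem Λ).toLp (F Λ) ω * f ω ∂m
    refine integral_congr_ae ?_
    filter_upwards [(hmem Λ).coeFn_toLp] with ω hω
    rw [hω]

/-- An invariant mean yields probability densities that are approximately invariant, uniformly
on compact sets. -/
theorem exists_norm_transfer_sub_le [IsTopologicalGroup G] [LocallyCompactSpace G]
    [SecondCountableTopology G] (h : HasInvariantMean σ) {K : Set G} (hK : IsCompact K) {ε : ℝ}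
    (hε : 0 < ε) :
    ∃ f : Lp ℝ 1 m, 0 ≤ᵐ[m] f ∧ ∫ ω, f ω ∂m = 1 ∧ ∀ g ∈ K, ‖σ.transfer g f - f‖ ≤ ε := by
  obtain ⟨φ, h0, h1, hinv⟩ := h
  obtain ⟨J, hJ⟩ := exists_dual_L1_to_Linfty (m := m)
  have hJint : ∀ Λ, Integrable (J Λ) m := fun Λ => (Lp.memLp (J Λ)).integrable le_top
  have hset : ∀ Λ (A : Set X) (hA : MeasurableSet A), ∫ ω in A, J Λ ω ∂m =
      Λ ((integrable_const (1 : ℝ)).indicator hA).toL1 := fun Λ A hA => by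
    rw [hJ, ← integral_indicator hA]
    refine integral_congr_ae ?_
    filter_upwards [((integrable_const (1 : ℝ)).indicator (μ := m) hA).coeFn_toL1] with ω hω
    rw [hω]
    by_cases h : ω ∈ A <;> simp [h]
  set I1 : Lp ℝ 1 m →L[ℝ] ℝ := L1.integralCLM with hI1
  have hI1' : ∀ f : Lp ℝ 1 m, I1 f = ∫ ω, f ω ∂m := fun f => by
    rw [hI1, ← L1.integral_eq, L1.integral_eq_integral]
  -- The convex set of probability densities. The mean, composed with the identification of the dual
  -- of L¹, acts on functionals on L¹ and behaves like a point of the closure of `C` in the bidual.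
  set C : Set (Lp ℝ 1 m) := {f | 0 ≤ f} ∩ {f | I1 f = 1} with hC
  have hconv : Convex ℝ C := by
    refine Convex.inter ?_ (convex_hyperplane I1.isLinear 1)
    intro f hf f' hf' a b ha hb _
    simp only [Set.mem_ofPred_eq, ← Lp.coeFn_nonneg] at hf hf' ⊢
    filter_upwards [hf, hf', Lp.coeFn_add (a • f) (b • f'), Lp.coeFn_smul a f,
      Lp.coeFn_smul b f'] with ω h1 h2 h3 h4 h5
    rw [h3, Pi.add_apply, h4, h5]
    exact add_nonneg (mul_nonneg ha h1) (mul_nonneg hb h2)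
  have hcl : IsClosed C := isClosed_Ici.inter (isClosed_eq I1.continuous continuous_const)
  have hae : ∀ f ∈ C, 0 ≤ᵐ[m] f := fun f hf => (Lp.coeFn_nonneg f).2 hf.1
  have hone : ∀ f ∈ C, ∫ ω, f ω ∂m = 1 := fun f hf => (hI1' f).symm.trans hf.2
  suffices hex : ∃ f ∈ C, ∀ g ∈ K, ‖σ.transfer g f - f‖ ≤ ε by
    obtain ⟨f, hf, hfK⟩ := hex
    exact ⟨f, hae f hf, hone f hf, hfK⟩
  refine exists_approx_invariant_of_invariant_mean σ.transfer σ.transfer_one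
    σ.transfer_mul σ.norm_transfer_le σ.continuous_transfer hconv hcl (M := 1) (fun f hf => ?_)
    (fun g f hf => ?_) (φ.comp J) (fun Λ g => ?_) (fun Λ c hΛ => ?_) hK hε
  · rw [L1.norm_eq_integral_norm, ← hone f hf]
    refine (integral_congr_ae ?_).le
    filter_upwards [hae f hf] with ω hω
    exact Real.norm_of_nonneg hω
  · refine ⟨(Lp.coeFn_nonneg _).1 ?_, ?_⟩
    · filter_upwards [σ.transfer_ae_eq g f,
        (σ.quasiMeasurePreserving g⁻¹).ae (hae f hf)] with ω h2 h3
      rw [h2]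
      exact mul_nonneg (σ.jac_nonneg g ω) h3
    · have h2 := σ.setIntegral_transfer g f .univ
      rw [Set.preimage_univ, setIntegral_univ, setIntegral_univ, hone f hf, ← hI1'] at h2
      exact h2
  · refine hinv g (J Λ) _ ?_
    have hb : Integrable (J Λ ∘ σ.act g) m := by
      refine Integrable.of_bound ((Lp.aestronglyMeasurable (J Λ)).comp_quasiMeasurePreserving
        (σ.quasiMeasurePreserving g)) ‖J Λ‖ ?_
      exact (σ.quasiMeasurePreserving g).ae (ae_abs_le_norm_Linfty (J Λ))
    refine (hJint _).ae_eq_of_forall_setIntegral_eq _ _ hb fun A hA _ => ?_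
    rw [hset _ A hA, ContinuousLinearMap.comp_apply, hJ,
      σ.integral_mul_transfer g (Lp.aestronglyMeasurable (J Λ)), ← integral_indicator hA]
    refine integral_congr_ae ?_
    filter_upwards [((integrable_const (1 : ℝ)).indicator (μ := m) hA).coeFn_toL1] with ω hω
    rw [hω]
    by_cases h : ω ∈ A <;> simp [h]
  · have hcm : MemLp (fun _ : X => (1 : ℝ)) ∞ m := memLp_const 1
    have h2 : (fun _ => c) ≤ᵐ[m] J Λ := by
      refine ae_le_of_forall_setIntegral_le (integrable_const _) (hJint _) fun A hA _ => ?_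
      rw [hset _ A hA, setIntegral_const, smul_eq_mul]
      rcases eq_or_ne (m.real A) 0 with hA0 | hA0
      · have h3 : ((integrable_const (1 : ℝ)).indicator (μ := m) hA).toL1 = 0 := by
          rw [← norm_eq_zero, norm_toL1_indicator_one hA, hA0]
        rw [h3, map_zero, hA0, zero_mul]
      · have hpos : 0 < m.real A := lt_of_le_of_ne measureReal_nonneg hA0.symm
        -- The normalised indicator of A is a probability density, so the lower bound for Λ on
        -- densities bounds the average of its representative over A.
        set e := ((integrable_const (1 : ℝ)).indicator (μ := m) hA).toL1 with he
        have hee : e =ᵐ[m] A.indicator fun _ => 1 := Integrable.coeFn_toL1 _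
        have h3 := hΛ ((m.real A)⁻¹ • e) ⟨(Lp.coeFn_nonneg _).1 ?_, ?_⟩
        · rw [map_smul, smul_eq_mul, inv_mul_eq_div, le_div_iff₀ hpos] at h3
          linarith
        · filter_upwards [Lp.coeFn_smul (m.real A)⁻¹ e, hee] with ω h4 h5
          rw [h4, Pi.smul_apply, h5, smul_eq_mul]
          exact mul_nonneg (inv_nonneg.2 hpos.le) (Set.indicator_nonneg (fun _ _ => zero_le_one) _)
        · change I1 _ = 1
          rw [map_smul, hI1', integral_congr_ae hee, integral_indicator hA]
          simp [hA0]
    have h3 : 0 ≤ φ (J Λ - c • hcm.toLp) := by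
      refine h0 _ ((Lp.coeFn_nonneg _).1 ?_)
      filter_upwards [Lp.coeFn_sub (J Λ) (c • hcm.toLp), Lp.coeFn_smul c hcm.toLp, hcm.coeFn_toLp,
        h2] with ω h4 h5 h6 h7
      rw [h4, Pi.sub_apply, h5, Pi.smul_apply, h6]
      simpa using h7
    rw [map_sub, map_smul, h1 _ hcm.coeFn_toLp] at h3
    simpa using h3

/-- The vector is the square root of an almost invariant density. Its squared L² displacement is at
most the L¹ displacement of the density, which is therefore requested to be at most ε². -/
theorem exists_norm_koopman_sub_le [IsTopologicalGroup G] [LocallyCompactSpace G]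
    [SecondCountableTopology G] (h : HasInvariantMean σ) {K : Set G} (hK : IsCompact K) {ε : ℝ}
    (hε : 0 < ε) :
    ∃ ξ : Lp ℝ 2 m, ‖ξ‖ = 1 ∧ ∀ g ∈ K, ‖σ.koopmanIsometry g ξ - ξ‖ ≤ ε := by
  obtain ⟨f, hf0, hf1, hfK⟩ := exists_norm_transfer_sub_le h hK (sq_pos_of_pos hε)
  have hfi := L1.integrable_coeFn f
  have hm : MemLp (fun ω => √(f ω)) 2 m := by
    rw [memLp_two_iff_integrable_sq (Real.continuous_sqrt.comp_aestronglyMeasurable hfi.1)]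
    refine hfi.congr ?_
    filter_upwards [hf0] with ω hω
    exact (Real.sq_sqrt hω).symm
  have hnsq : ∀ ζ : Lp ℝ 2 m, ‖ζ‖ ^ 2 = ∫ ω, ζ ω ^ 2 ∂m := fun ζ => by
    rw [← real_inner_self_eq_norm_sq, L2.inner_def]
    simp
  refine ⟨hm.toLp, ?_, fun g hg => ?_⟩
  · have h1 : ‖hm.toLp‖ ^ 2 = 1 := by
      rw [hnsq, ← hf1]
      refine integral_congr_ae ?_
      filter_upwards [hm.coeFn_toLp, hf0] with ω h1 h2
      rw [h1, Real.sq_sqrt h2]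
    exact (pow_eq_one_iff_of_nonneg (norm_nonneg _) two_ne_zero).1 h1
  · refine le_of_sq_le_sq ?_ hε.le
    refine le_trans ?_ (hfK g hg)
    rw [hnsq, L1.norm_eq_integral_norm]
    refine integral_mono_ae ((memLp_two_iff_integrable_sq (Lp.aestronglyMeasurable _)).1
      (Lp.memLp _)) (L1.integrable_coeFn _).norm ?_
    filter_upwards [Lp.coeFn_sub (σ.koopmanIsometry g hm.toLp) hm.toLp,
      Lp.coeFn_sub (σ.transfer g f) f, σ.koopmanIsometry_ae_eq g hm.toLp,
      σ.koopman_congr g hm.coeFn_toLp, hm.coeFn_toLp, σ.transfer_ae_eq g f, hf0,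
      (σ.quasiMeasurePreserving g⁻¹).ae hf0] with ω h1 h2 h3 h4 h5 h6 h7 h8
    rw [h1, h2, Pi.sub_apply, Pi.sub_apply, h3, h4, h5, h6, Real.norm_eq_abs, koopman,
      ← Real.sqrt_mul ENNReal.toReal_nonneg]
    exact sq_sqrt_sub_sqrt_le (mul_nonneg (σ.jac_nonneg g ω) h8) h7

end Mean

/-! ### Representations given by invariant kernels -/

section Kernel

open Finsupp (linearCombination)

/-- The stable spectral gap speaks of representations on spaces in `Type` only. A countable
orthonormal basis embeds a separable Hilbert space in ℓ²(ℕ), and the range of the embedding lives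
there. -/
theorem exists_linearIsometryEquiv_type_zero (H : Type*) [NormedAddCommGroup H]
    [InnerProductSpace ℝ H] [CompleteSpace H] [TopologicalSpace.SeparableSpace H] :
    ∃ (W : Type) (_ : NormedAddCommGroup W) (_ : InnerProductSpace ℝ W) (_ : CompleteSpace W)
      (_ : TopologicalSpace.SeparableSpace W), Nonempty (H ≃ₗᵢ[ℝ] W) := by
  obtain ⟨s, b, -⟩ := exists_hilbertBasis ℝ H
  have hc : Countable s := b.orthonormal.countable_of_separableSpace
  obtain ⟨f, hf⟩ := exists_injective_nat s
  set v : s → lp (fun _ : ℕ => ℝ) 2 := fun i => lp.single 2 (f i) 1 with hv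
  have hvo : Orthonormal ℝ v := by
    classical
    rw [orthonormal_iff_ite]
    intro i j
    rw [hv, lp.inner_single_left, lp.single_apply]
    by_cases h : i = j
    · simp [h]
    · have : f i ≠ f j := fun hh => h (hf hh)
      simp [h, this]
  set T : H →ₗᵢ[ℝ] lp (fun _ : ℕ => ℝ) 2 :=
    hvo.orthogonalFamily.linearIsometry.comp b.repr.toLinearIsometry
  set e := T.equivRange
  exact ⟨LinearMap.range T.toLinearMap, inferInstance, inferInstance,
    (completeSpace_congr (e := e.toEquiv) e.isometry.isUniformEmbedding).1 inferInstance,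
    e.surjective.denseRange.separableSpace e.continuous, ⟨e⟩⟩

variable {S : Type*}

/-- Bilinearity: a family of vectors is determined by its Gram matrix up to isometry of its span.
The argument for (iv) compares families in different Hilbert spaces only through their Gram
matrices. -/
theorem inner_linearCombination_eq_of_inner_eq {H H' : Type*} [NormedAddCommGroup H]
    [InnerProductSpace ℝ H] [NormedAddCommGroup H'] [InnerProductSpace ℝ H'] {κ : S → H}
    {κ' : S → H'} (h : ∀ s t, ⟪κ s, κ t⟫ = ⟪κ' s, κ' t⟫) (c c' : S →₀ ℝ) :
    ⟪linearCombination ℝ κ c, linearCombination ℝ κ c'⟫ =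
      ⟪linearCombination ℝ κ' c, linearCombination ℝ κ' c'⟫ := by
  simp only [Finsupp.linearCombination_apply, Finsupp.sum_inner, Finsupp.inner_sum, inner_smul_left,
    inner_smul_right, h]

theorem norm_linearCombination_eq_of_inner_eq {H H' : Type*} [NormedAddCommGroup H]
    [InnerProductSpace ℝ H] [NormedAddCommGroup H'] [InnerProductSpace ℝ H'] {κ : S → H}
    {κ' : S → H'} (h : ∀ s t, ⟪κ s, κ t⟫ = ⟪κ' s, κ' t⟫) (c : S →₀ ℝ) :
    ‖linearCombination ℝ κ c‖ = ‖linearCombination ℝ κ' c‖ := by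
  rw [norm_eq_sqrt_real_inner, norm_eq_sqrt_real_inner, inner_linearCombination_eq_of_inner_eq h]

theorem exists_total_type_zero {H : Type*} [NormedAddCommGroup H]
    [InnerProductSpace ℝ H] [CompleteSpace H] (κ : S → H)
    (hκ : TopologicalSpace.IsSeparable (Set.range κ)) :
    ∃ (W : Type) (_ : NormedAddCommGroup W) (_ : InnerProductSpace ℝ W) (_ : CompleteSpace W)
      (_ : TopologicalSpace.SeparableSpace W) (w : S → W),
      (∀ s t, ⟪w s, w t⟫ = ⟪κ s, κ t⟫) ∧ DenseRange (linearCombination ℝ w) := by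
  set M := (Submodule.span ℝ (Set.range κ)).topologicalClosure with hM
  have hsep : TopologicalSpace.SeparableSpace M := by
    have h1 : TopologicalSpace.IsSeparable (M : Set H) := by
      rw [hM, Submodule.topologicalClosure_coe]
      exact (hκ.span (R := ℝ)).closure
    exact h1.separableSpace
  have hMc : CompleteSpace M := (Submodule.isClosed_topologicalClosure _).completeSpace_coe
  set κ₀ : S → M := fun s => ⟨κ s, Submodule.le_topologicalClosure _ (Submodule.subset_span ⟨s, rfl⟩)⟩
    with hκ₀
  have hsub : ∀ c, ((linearCombination ℝ κ₀ c : M) : H) = linearCombination ℝ κ c := fun c => by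
    have := Finsupp.apply_linearCombination ℝ M.subtype κ₀ c
    exact this
  have hd : DenseRange (linearCombination ℝ κ₀) := by
    intro x
    rw [Metric.mem_closure_iff]
    intro ε hε
    have hx : (x : H) ∈ closure (Submodule.span ℝ (Set.range κ) : Set H) := by
      rw [← Submodule.topologicalClosure_coe]; exact x.2
    obtain ⟨y, hy, hxy⟩ := Metric.mem_closure_iff.1 hx ε hε
    obtain ⟨c, rfl⟩ := (Finsupp.mem_span_range_iff_exists_finsupp).1 hy
    refine ⟨_, ⟨c, rfl⟩, ?_⟩
    rw [Subtype.dist_eq, hsub]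
    exact hxy
  obtain ⟨W, i1, i2, i3, i4, ⟨e⟩⟩ := exists_linearIsometryEquiv_type_zero M
  refine ⟨W, i1, i2, i3, i4, fun s => e (κ₀ s), fun s t => ?_, ?_⟩
  · rw [LinearIsometryEquiv.inner_map_map]; rfl
  · have h1 : (linearCombination ℝ fun s => e (κ₀ s) : (S →₀ ℝ) → W) =
        e ∘ linearCombination ℝ κ₀ := by
      ext c
      exact (Finsupp.apply_linearCombination ℝ e.toLinearEquiv.toLinearMap κ₀ c).symm
    rw [h1]
    exact e.surjective.denseRange.comp hd e.continuous

variable {G : Type v} [Group G] [TopologicalSpace G]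

/-- An invariant continuous kernel of positive type yields a strongly continuous orthogonal
representation on a separable Hilbert space. -/
theorem exists_representation_of_kernel [MulAction G S] {H : Type*} [NormedAddCommGroup H]
    [InnerProductSpace ℝ H] [CompleteSpace H] (κ : S → H)
    (hκ : TopologicalSpace.IsSeparable (Set.range κ))
    (hinv : ∀ (g : G) s t, ⟪κ (g • s), κ (g • t)⟫ = ⟪κ s, κ t⟫)
    (hcont : ∀ s, Continuous fun g : G => κ (g • s)) :
    ∃ (W : Type) (_ : NormedAddCommGroup W) (_ : InnerProductSpace ℝ W) (_ : CompleteSpace W)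
      (_ : TopologicalSpace.SeparableSpace W) (ρ : G →* (W ≃ₗᵢ[ℝ] W)) (w : S → W),
      (∀ ξ, Continuous fun g => ρ g ξ) ∧ (∀ s t, ⟪w s, w t⟫ = ⟪κ s, κ t⟫) ∧
      ∀ g s, ρ g (w s) = w (g • s) := by
  obtain ⟨W, i1, i2, i3, i4, w, hw, hd⟩ := exists_total_type_zero κ hκ
  set e := linearCombination ℝ w with he
  set f : G → (S →₀ ℝ) →ₗ[ℝ] W := fun g => linearCombination ℝ fun s => w (g • s) with hf
  have hnorm : ∀ g c, ‖f g c‖ = ‖e c‖ := fun g c =>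
    norm_linearCombination_eq_of_inner_eq (fun s t => by rw [hw, hw, hinv]) c
  -- By invariance of the kernel, moving the labels by g preserves norms of linear combinations, so
  -- the operator is well defined on a dense range and extends isometrically.
  set U : G → W →L[ℝ] W := fun g => (f g).extendOfNorm e with hU
  have hUe : ∀ g c, U g (e c) = f g c := fun g c =>
    LinearMap.extendOfNorm_eq hd ⟨1, fun c => by rw [one_mul]; exact (hnorm g c).le⟩ c
  have hUw : ∀ g s, U g (w s) = w (g • s) := fun g s => by
    have := hUe g (Finsupp.single s 1)
    simpa [he, hf] using this
  have hext : ∀ A B : W →L[ℝ] W, (∀ s, A (w s) = B (w s)) → A = B := fun A B h => by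
    refine ContinuousLinearMap.coeFn_injective (hd.equalizer A.continuous B.continuous ?_)
    ext c
    have h1 := Finsupp.apply_linearCombination ℝ A.toLinearMap w c
    have h2 := Finsupp.apply_linearCombination ℝ B.toLinearMap w c
    have h3 : (A.toLinearMap ∘ w : S → W) = B.toLinearMap ∘ w := funext h
    rw [h3] at h1
    exact h1.trans h2.symm
  have hUn : ∀ g x, ‖U g x‖ = ‖x‖ := fun g x => by
    refine congrFun (hd.equalizer (U g).continuous.norm continuous_norm ?_) x
    ext c
    simp only [Function.comp_apply]
    rw [hUe, hnorm]
  have hU1 : U 1 = ContinuousLinearMap.id ℝ W := hext _ _ fun s => by rw [hUw, one_smul]; rfl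
  have hUmul : ∀ g h, U (g * h) = (U g).comp (U h) := fun g h => hext _ _ fun s => by
    rw [hUw, ContinuousLinearMap.comp_apply, hUw, hUw, mul_smul]
  have hinvU : ∀ g h x, g * h = 1 → U g (U h x) = x := fun g h x hgh => by
    rw [← ContinuousLinearMap.comp_apply, ← hUmul, hgh, hU1]; rfl
  refine ⟨W, i1, i2, i3, i4,
    { toFun := fun g =>
        { toLinearEquiv := LinearEquiv.ofLinearMap (U g).toLinearMap (U g⁻¹).toLinearMap
            (LinearMap.ext fun x => hinvU _ _ x (mul_inv_cancel g))
            (LinearMap.ext fun x => hinvU _ _ x (inv_mul_cancel g))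
          norm_map' := fun x => hUn g x }
      map_one' := LinearIsometryEquiv.ext fun x => congrArg (fun A : W →L[ℝ] W => A x) hU1
      map_mul' := fun g h =>
        LinearIsometryEquiv.ext fun x => congrArg (fun A : W →L[ℝ] W => A x) (hUmul g h) },
    w, fun ξ => ?_, hw, hUw⟩
  change Continuous fun g => U g ξ
  have hwc : ∀ s, Continuous fun g : G => w (g • s) := fun s => by
    rw [continuous_iff_continuousAt]
    intro g
    rw [ContinuousAt, tendsto_iff_norm_sub_tendsto_zero]
    have h1 := tendsto_iff_norm_sub_tendsto_zero.1 ((hcont s).tendsto g)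
    refine h1.congr fun r => ?_
    have h2 := norm_linearCombination_eq_of_inner_eq hw
      (Finsupp.single (r • s) 1 - Finsupp.single (g • s) 1)
    simpa using h2.symm
  have hec : ∀ c, Continuous fun g => U g (e c) := fun c => by
    simp only [hUe, hf, Finsupp.linearCombination_apply, Finsupp.sum]
    exact continuous_finsetSum _ fun s _ => (hwc s).const_smul _
  rw [continuous_iff_continuousAt]
  intro g
  rw [ContinuousAt, Metric.tendsto_nhds]
  intro ε hε
  obtain ⟨c, hc⟩ := hd.exists_dist_lt ξ (show 0 < ε / 3 by positivity)
  filter_upwards [Metric.tendsto_nhds.1 ((hec c).tendsto g) (ε / 3) (by positivity)] with r hr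
  have h3 : ∀ k, dist (U k ξ) (U k (e c)) < ε / 3 := fun k => by
    rw [dist_eq_norm, ← map_sub, hUn, ← dist_eq_norm]; exact hc
  calc dist (U r ξ) (U g ξ) ≤ dist (U r ξ) (U r (e c)) + dist (U r (e c)) (U g (e c)) +
        dist (U g (e c)) (U g ξ) := dist_triangle4 _ _ _ _
    _ < ε := by
        have := h3 r
        have := h3 g
        rw [dist_comm (U g (e c))]
        linarith

end Kernel

/-! ### Consequences of the stable spectral gap -/

section Gap

open Finsupp (linearCombination)

variable {G : Type v} [Group G] [TopologicalSpace G]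
  {V : Type u} [NormedAddCommGroup V] [InnerProductSpace ℝ V]

theorem HasStableSpectralGap.exists_le_norm_tensorRep_sub {π : G →* (V ≃ₗᵢ[ℝ] V)}
    (h : HasStableSpectralGap π) {W : Type} [NormedAddCommGroup W] [InnerProductSpace ℝ W]
    [CompleteSpace W] [TopologicalSpace.SeparableSpace W] (ρ : G →* (W ≃ₗᵢ[ℝ] W))
    (hρ : ∀ ξ, Continuous fun g => ρ g ξ) :
    ∃ K : Set G, IsCompact K ∧ ∃ ε : ℝ, 0 < ε ∧
      ∀ ξ, ∃ g ∈ K, ε * ‖ξ‖ ≤ ‖tensorRep π ρ g ξ - ξ‖ := by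
  have h1 := h W ρ hρ
  rw [HasAlmostInvariantVectors] at h1
  push Not at h1
  obtain ⟨K, hK, ε, hε, h2⟩ := h1
  -- The identity is added so that the zero vector also has a witness when `K` is empty.
  refine ⟨insert 1 K, hK.insert 1, ε, hε, fun ξ => ?_⟩
  rcases eq_or_ne ξ 0 with rfl | hξ
  · exact ⟨1, Set.mem_insert _ _, by simp⟩
  have hn : ‖ξ‖ ≠ 0 := norm_ne_zero_iff.2 hξ
  obtain ⟨g, hg, h3⟩ := h2 (‖ξ‖⁻¹ • ξ) (by rw [norm_smul, norm_inv, norm_norm, inv_mul_cancel₀ hn])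
  refine ⟨g, Set.mem_insert_of_mem _ hg, ?_⟩
  rw [map_smul, ← smul_sub, norm_smul, norm_inv, norm_norm, inv_mul_eq_div,
    le_div_iff₀ (norm_pos_iff.2 hξ)] at h3
  exact h3

omit [TopologicalSpace G] in
theorem tensorRep_coe_tmul {W : Type w} [NormedAddCommGroup W] [InnerProductSpace ℝ W]
    (π : G →* (V ≃ₗᵢ[ℝ] V)) (ρ : G →* (W ≃ₗᵢ[ℝ] W)) (g : G) (v : V) (w : W) :
    tensorRep π ρ g ((v ⊗ₜ[ℝ] w : V ⊗[ℝ] W) : UniformSpace.Completion (V ⊗[ℝ] W)) =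
      ((π g v ⊗ₜ[ℝ] ρ g w : V ⊗[ℝ] W) : UniformSpace.Completion (V ⊗[ℝ] W)) := by
  rw [tensorRep, ContinuousLinearMap.completion_apply_coe]
  rfl

/-- The trivial representation on ℝ is one of the admissible ρ. -/
theorem HasStableSpectralGap.exists_le_norm_sub {π : G →* (V ≃ₗᵢ[ℝ] V)}
    (h : HasStableSpectralGap π) :
    ∃ K : Set G, IsCompact K ∧ ∃ ε : ℝ, 0 < ε ∧ ∀ v, ∃ g ∈ K, ε * ‖v‖ ≤ ‖π g v - v‖ := by
  obtain ⟨K, hK, ε, hε, h1⟩ := h.exists_le_norm_tensorRep_sub (W := ℝ) 1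
    (fun ξ => continuous_const)
  refine ⟨K, hK, ε, hε, fun v => ?_⟩
  obtain ⟨g, hg, h2⟩ := h1 ((v ⊗ₜ[ℝ] (1 : ℝ) : V ⊗[ℝ] ℝ) : UniformSpace.Completion (V ⊗[ℝ] ℝ))
  refine ⟨g, hg, ?_⟩
  rw [tensorRep_coe_tmul, ← UniformSpace.Completion.coe_sub, UniformSpace.Completion.norm_coe,
    UniformSpace.Completion.norm_coe] at h2
  change ε * ‖v ⊗ₜ[ℝ] (1 : ℝ)‖ ≤ ‖π g v ⊗ₜ[ℝ] (1 : ℝ) - v ⊗ₜ[ℝ] (1 : ℝ)‖ at h2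
  rw [← TensorProduct.sub_tmul, TensorProduct.norm_tmul, TensorProduct.norm_tmul] at h2
  simpa using h2

theorem continuous_of_continuous_inner {S H : Type*} [TopologicalSpace S] [NormedAddCommGroup H]
    [InnerProductSpace ℝ H] {κ : S → H} (h1 : Continuous fun s => ⟪κ s, κ s⟫)
    (h2 : ∀ t, Continuous fun s => ⟪κ s, κ t⟫) : Continuous κ := by
  rw [continuous_iff_continuousAt]
  intro t
  rw [ContinuousAt, tendsto_iff_norm_sub_tendsto_zero]
  have h3 : Continuous fun s => √(⟪κ s, κ s⟫ - 2 * ⟪κ s, κ t⟫ + ⟪κ t, κ t⟫) :=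
    (((h1.sub ((h2 t).const_mul 2))).add continuous_const).sqrt
  have h4 := h3.tendsto t
  have h5 : ⟪κ t, κ t⟫ - 2 * ⟪κ t, κ t⟫ + ⟪κ t, κ t⟫ = 0 := by ring
  rw [h5, Real.sqrt_zero] at h4
  refine h4.congr fun s => ?_
  rw [real_inner_self_eq_norm_sq, real_inner_self_eq_norm_sq, ← norm_sub_sq_real,
    Real.sqrt_sq (norm_nonneg _)]

/-- With a = ⟪x - y, x' - y'⟫/8 this splits the factor coming from α⁰ off the off-diagonal Gram
matrix and leaves a kernel that is still of positive type. -/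
theorem mul_integral_exp_mul (a : ℝ) :
    a * ∫ t in (0 : ℝ)..1, Real.exp (t * a) = Real.exp a - 1 := by
  have h := intervalIntegral.mul_integral_comp_mul_right (a := 0) (b := 1) (f := Real.exp) a
  rw [h, integral_exp]
  simp

variable {P : Type w} [MetricSpace P] [NormedAddTorsor V P]
  {H : Type*} [NormedAddCommGroup H] [InnerProductSpace ℝ H]

theorem half_smul_vsub_vadd_midpoint (x y : P) :
    (1 / 2 : ℝ) • (x -ᵥ y) +ᵥ midpoint ℝ x y = x := by
  rw [← vsub_eq_zero_iff_eq, vadd_vsub_assoc, midpoint_vsub_left]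
  have h : y -ᵥ x = -(x -ᵥ y) := (neg_vsub_eq_vsub_rev x y).symm
  rw [h, smul_neg, invOf_eq_inv, one_div, add_neg_cancel]

theorem neg_half_smul_vsub_vadd_midpoint (x y : P) :
    -((1 / 2 : ℝ) • (x -ᵥ y)) +ᵥ midpoint ℝ x y = y := by
  have := half_smul_vsub_vadd_midpoint y x
  rwa [midpoint_comm, ← neg_vsub_eq_vsub_rev x y, smul_neg] at this

/-- Vectors with the Gram matrix of the products `u x ⊗ u y` of square roots of densities. -/
def IsGaussianPair (U : P → P → H) : Prop :=
  ∀ x y x' y', ⟪U x y, U x' y'⟫ =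
    Real.exp (-(dist x x' ^ 2 / 8)) * Real.exp (-(dist y y' ^ 2 / 8))

/-- The diagonal part of `U x y`. -/
def diagPart (U : P → P → H) (s : P × P) : H :=
  Real.exp (-(‖s.1 -ᵥ s.2‖ ^ 2 / 16)) • U (midpoint ℝ s.1 s.2) (midpoint ℝ s.1 s.2)

/-- The off-diagonal part of `U x y`. -/
def offDiagPart (U : P → P → H) (s : P × P) : H := U s.1 s.2 - diagPart U s

namespace IsGaussianPair

variable {U : P → P → H}

/-- A rotation of the product space: in terms of the midpoint z and the half-difference v the
parallelogram law separates the two variables, as for a pair of independent Gaussians. -/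
theorem inner_vadd_neg_vadd (hU : IsGaussianPair U) (z z' : P) (v v' : V) :
    ⟪U (v +ᵥ z) (-v +ᵥ z), U (v' +ᵥ z') (-v' +ᵥ z')⟫ =
      Real.exp (-(‖z -ᵥ z'‖ ^ 2 / 4) - ‖v - v'‖ ^ 2 / 4) := by
  have h1 : (v +ᵥ z) -ᵥ (v' +ᵥ z') = (z -ᵥ z') + (v - v') := by
    rw [vadd_vsub_vadd_comm]; abel
  have h2 : (-v +ᵥ z) -ᵥ (-v' +ᵥ z') = (z -ᵥ z') - (v - v') := by
    rw [vadd_vsub_vadd_comm]; abel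
  rw [hU, dist_eq_norm_vsub V, dist_eq_norm_vsub V, h1, h2, ← Real.exp_add]
  congr 1
  have := parallelogram_law_with_norm ℝ (z -ᵥ z') (v - v')
  linarith

theorem inner_pair (hU : IsGaussianPair U) (s s' : P × P) :
    ⟪U s.1 s.2, U s'.1 s'.2⟫ =
      Real.exp (-(‖midpoint ℝ s.1 s.2 -ᵥ midpoint ℝ s'.1 s'.2‖ ^ 2 / 4) -
        (‖s.1 -ᵥ s.2‖ ^ 2 + ‖s'.1 -ᵥ s'.2‖ ^ 2) / 16 + ⟪s.1 -ᵥ s.2, s'.1 -ᵥ s'.2⟫ / 8) := by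
  have h := hU.inner_vadd_neg_vadd (midpoint ℝ s.1 s.2) (midpoint ℝ s'.1 s'.2)
    ((1 / 2 : ℝ) • (s.1 -ᵥ s.2)) ((1 / 2 : ℝ) • (s'.1 -ᵥ s'.2))
  rw [half_smul_vsub_vadd_midpoint, half_smul_vsub_vadd_midpoint, neg_half_smul_vsub_vadd_midpoint,
    neg_half_smul_vsub_vadd_midpoint] at h
  rw [h, ← smul_sub, norm_smul, mul_pow, norm_sub_sq_real]
  congr 1
  norm_num
  ring

/-- Against diagonal vectors the cross term ⟪x - y, x' - y'⟫ disappears, and the value is the one in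
`inner_diagPart`. Hence the diagonal part is the orthogonal projection of `U x y` to the span of the
diagonal vectors. -/
theorem inner_pair_diagPart (hU : IsGaussianPair U) (s s' : P × P) :
    ⟪U s.1 s.2, diagPart U s'⟫ =
      Real.exp (-(‖midpoint ℝ s.1 s.2 -ᵥ midpoint ℝ s'.1 s'.2‖ ^ 2 / 4) -
        (‖s.1 -ᵥ s.2‖ ^ 2 + ‖s'.1 -ᵥ s'.2‖ ^ 2) / 16) := by
  rw [diagPart, inner_smul_right, hU.inner_pair s (midpoint ℝ s'.1 s'.2, midpoint ℝ s'.1 s'.2),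
    ← Real.exp_add]
  congr 1
  simp only [midpoint_self, vsub_self, norm_zero, inner_zero_right]
  ring

theorem inner_diagPart (hU : IsGaussianPair U) (s s' : P × P) :
    ⟪diagPart U s, diagPart U s'⟫ =
      Real.exp (-(‖midpoint ℝ s.1 s.2 -ᵥ midpoint ℝ s'.1 s'.2‖ ^ 2 / 4) -
        (‖s.1 -ᵥ s.2‖ ^ 2 + ‖s'.1 -ᵥ s'.2‖ ^ 2) / 16) := by
  nth_rewrite 1 [diagPart]
  rw [real_inner_smul_left,
    hU.inner_pair_diagPart (midpoint ℝ s.1 s.2, midpoint ℝ s.1 s.2) s', ← Real.exp_add]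
  congr 1
  simp only [midpoint_self, vsub_self, norm_zero]
  ring

theorem inner_offDiagPart_diagPart (hU : IsGaussianPair U) (s s' : P × P) :
    ⟪offDiagPart U s, diagPart U s'⟫ = 0 := by
  rw [offDiagPart, inner_sub_left, hU.inner_pair_diagPart, hU.inner_diagPart, sub_self]

theorem inner_offDiagPart (hU : IsGaussianPair U) (s s' : P × P) :
    ⟪offDiagPart U s, offDiagPart U s'⟫ =
      Real.exp (-(‖midpoint ℝ s.1 s.2 -ᵥ midpoint ℝ s'.1 s'.2‖ ^ 2 / 4) -
        (‖s.1 -ᵥ s.2‖ ^ 2 + ‖s'.1 -ᵥ s'.2‖ ^ 2) / 16) *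
        (Real.exp (⟪s.1 -ᵥ s.2, s'.1 -ᵥ s'.2⟫ / 8) - 1) := by
  nth_rewrite 2 [offDiagPart]
  rw [inner_sub_right, hU.inner_offDiagPart_diagPart, sub_zero, real_inner_comm, offDiagPart,
    inner_sub_right, hU.inner_pair, hU.inner_pair_diagPart, Real.exp_add, mul_sub, mul_one,
    real_inner_comm, ← norm_neg (midpoint ℝ s'.1 s'.2 -ᵥ _), neg_vsub_eq_vsub_rev,
    add_comm (‖s'.1 -ᵥ s'.2‖ ^ 2)]

theorem continuous_pair (hU : IsGaussianPair U) : Continuous fun s : P × P => U s.1 s.2 := by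
  refine continuous_of_continuous_inner ?_ fun t => ?_
  · simp only [hU _ _ _ _, dist_self]
    exact continuous_const
  · simp only [hU _ _ _ _]
    fun_prop

/-- The kernel that is left after the factor `⟪x - y, x' - y'⟫ / 8` is split off the Gram matrix
of the vectors `offDiagPart U`. -/
theorem exists_kernel [CompleteSpace H] (hU : IsGaussianPair U) :
    ∃ κ : P × P → Lp H 2 (volume.restrict (Set.Ioc (0 : ℝ) 1)), ∀ s s', ⟪κ s, κ s'⟫ =
      Real.exp (-(‖midpoint ℝ s.1 s.2 -ᵥ midpoint ℝ s'.1 s'.2‖ ^ 2 / 4) -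
        (‖s.1 -ᵥ s.2‖ ^ 2 + ‖s'.1 -ᵥ s'.2‖ ^ 2) / 16) *
        ∫ t in (0 : ℝ)..1, Real.exp (t * (⟪s.1 -ᵥ s.2, s'.1 -ᵥ s'.2⟫ / 8)) := by
  -- Write d, d' for the differences of the two pairs. Shrinking each pair about its midpoint by the
  -- factor √t changes the d-part of the Gram exponent to -t‖d - d'‖²/16. The scalar prefactors turn
  -- this into -(‖d‖² + ‖d'‖²)/16 + t⟪d, d'⟫/8, and viewing F s as a function of t in L² integrates
  -- over t.
  set F : P × P → ℝ → H := fun s t => Real.exp ((t - 1) * (‖s.1 -ᵥ s.2‖ ^ 2 / 16)) •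
    U ((√t / 2) • (s.1 -ᵥ s.2) +ᵥ midpoint ℝ s.1 s.2)
      (-((√t / 2) • (s.1 -ᵥ s.2)) +ᵥ midpoint ℝ s.1 s.2) with hF
  have hFc : ∀ s, Continuous (F s) := fun s => by
    refine Continuous.smul (by fun_prop) ?_
    exact hU.continuous_pair.comp (f := fun t : ℝ =>
      (((√t / 2) • (s.1 -ᵥ s.2) +ᵥ midpoint ℝ s.1 s.2 : P),
        (-((√t / 2) • (s.1 -ᵥ s.2)) +ᵥ midpoint ℝ s.1 s.2 : P))) (by fun_prop)
  have hinner : ∀ s s' t, 0 ≤ t → ⟪F s t, F s' t⟫ =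
      Real.exp (-(‖midpoint ℝ s.1 s.2 -ᵥ midpoint ℝ s'.1 s'.2‖ ^ 2 / 4) -
        (‖s.1 -ᵥ s.2‖ ^ 2 + ‖s'.1 -ᵥ s'.2‖ ^ 2) / 16) *
        Real.exp (t * (⟪s.1 -ᵥ s.2, s'.1 -ᵥ s'.2⟫ / 8)) := fun s s' t ht => by
    simp only [hF]
    rw [real_inner_smul_left, inner_smul_right, hU.inner_vadd_neg_vadd, ← smul_sub, norm_smul,
      mul_pow, norm_sub_sq_real, Real.norm_eq_abs, sq_abs, div_pow, Real.sq_sqrt ht,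
      ← Real.exp_add, ← Real.exp_add, ← Real.exp_add]
    congr 1
    ring
  have hmem : ∀ s, MemLp (F s) 2 (volume.restrict (Set.Ioc (0 : ℝ) 1)) := fun s => by
    refine MemLp.of_bound (hFc s).aestronglyMeasurable 1 ?_
    filter_upwards [ae_restrict_mem measurableSet_Ioc] with t ht
    refine le_of_sq_le_sq ?_ zero_le_one
    rw [← real_inner_self_eq_norm_sq, hinner s s t ht.1.le, ← Real.exp_add, one_pow,
      Real.exp_le_one_iff, vsub_self, norm_zero, real_inner_self_eq_norm_sq]
    nlinarith [sq_nonneg ‖s.1 -ᵥ s.2‖, ht.2]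
  refine ⟨fun s => (hmem s).toLp, fun s s' => ?_⟩
  rw [L2.inner_def, intervalIntegral.integral_of_le zero_le_one, ← integral_const_mul]
  refine integral_congr_ae ?_
  filter_upwards [(hmem s).coeFn_toLp, (hmem s').coeFn_toLp,
    ae_restrict_mem measurableSet_Ioc] with t h1 h2 ht
  rw [h1, h2, hinner s s' t ht.1.le]

/-- The diagonal action on pairs of points. -/
@[reducible]
def _root_.GaussianDictionary.pairAction (α : G →* (P ≃ᵃⁱ[ℝ] P)) : MulAction G (P × P) where
  smul g s := (α g s.1, α g s.2)
  one_smul s := by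
    change (α 1 s.1, α 1 s.2) = s
    rw [map_one]; rfl
  mul_smul g h s := by
    change (α (g * h) s.1, α (g * h) s.2) = (α g (α h s.1), α g (α h s.2))
    rw [map_mul]; rfl

/-- The kernel of `exists_kernel` is invariant and gives a representation ρ with vectors w s. The
vectors (x - y) ⊗ w s, divided by √8, have the Gram matrix of the off-diagonal parts and are
permuted by α⁰ ⊗ ρ in the same way, so the spectral gap of that tensor product carries over to all
linear combinations. -/
theorem exists_le_norm_offDiagPart_sub [CompleteSpace H] [TopologicalSpace.SeparableSpace V]
    (hU : IsGaussianPair U)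
    {α : G →* (P ≃ᵃⁱ[ℝ] P)} (hα : ∀ x : P, Continuous fun g => α g x)
    (hgap : HasStableSpectralGap (linearPart α)) :
    ∃ K : Set G, IsCompact K ∧ ∃ ε : ℝ, 0 < ε ∧ ∀ c : P × P →₀ ℝ, ∃ g ∈ K,
      ε * ‖linearCombination ℝ (offDiagPart U) c‖ ≤
        ‖linearCombination ℝ (fun s => offDiagPart U (α g s.1, α g s.2)) c -
          linearCombination ℝ (offDiagPart U) c‖ := by
  obtain ⟨κ, hκ⟩ := hU.exists_kernel
  let _ := pairAction α
  have hsmul : ∀ (g : G) (s : P × P), g • s = (α g s.1, α g s.2) := fun _ _ => rfl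
  have hmid : Continuous fun s : P × P => midpoint ℝ s.1 s.2 := by
    simp only [midpoint, AffineMap.lineMap_apply]
    fun_prop
  have hκc : Continuous κ := by
    refine continuous_of_continuous_inner ?_ fun t => ?_
    · simp only [hκ]
      refine Continuous.mul (by fun_prop) ?_
      exact intervalIntegral.continuous_parametric_intervalIntegral_of_continuous' (by fun_prop) _ _
    · simp only [hκ]
      refine Continuous.mul (by fun_prop) ?_
      exact intervalIntegral.continuous_parametric_intervalIntegral_of_continuous' (by fun_prop) _ _
  have hsepP : TopologicalSpace.SeparableSpace P := by
    obtain ⟨o⟩ : Nonempty P := inferInstance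
    exact (AffineIsometryEquiv.vaddConst ℝ o).surjective.denseRange.separableSpace
      (AffineIsometryEquiv.vaddConst ℝ o).continuous
  have hv : ∀ (g : G) (x y : P), α g x -ᵥ α g y = linearPart α g (x -ᵥ y) := fun g x y =>
    ((α g).map_vsub x y).symm
  have hm : ∀ (g : G) (x y : P), midpoint ℝ (α g x) (α g y) = α g (midpoint ℝ x y) := fun g x y =>
    ((α g).toAffineEquiv.toAffineMap.map_midpoint x y).symm
  obtain ⟨W, i1, i2, i3, i4, ρ, w, hρ, hw, hρw⟩ := exists_representation_of_kernel (G := G) κ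
    (TopologicalSpace.isSeparable_range hκc)
    (fun g s t => by simp only [hκ, hsmul, hv, hm, LinearIsometryEquiv.norm_map,
      LinearIsometryEquiv.inner_map_map])
    (fun s => hκc.comp ((hα s.1).prodMk (hα s.2)))
  obtain ⟨K, hK, ε, hε, h1⟩ := hgap.exists_le_norm_tensorRep_sub ρ hρ
  set b : P × P → UniformSpace.Completion (V ⊗[ℝ] W) := fun s =>
    (√8)⁻¹ • (((s.1 -ᵥ s.2) ⊗ₜ[ℝ] w s : V ⊗[ℝ] W) : UniformSpace.Completion (V ⊗[ℝ] W)) with hb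
  have hbb : ∀ s t, ⟪b s, b t⟫ = ⟪offDiagPart U s, offDiagPart U t⟫ := fun s t => by
    have h8 : (√8)⁻¹ * (√8)⁻¹ = (8⁻¹ : ℝ) := by
      rw [← mul_inv, Real.mul_self_sqrt (by norm_num)]
    rw [hU.inner_offDiagPart, ← mul_integral_exp_mul]
    simp only [hb]
    rw [real_inner_smul_left, inner_smul_right, UniformSpace.Completion.inner_coe,
      TensorProduct.inner_tmul, hw, hκ, ← mul_assoc, h8]
    ring
  have hTb : ∀ g s, tensorRep (linearPart α) ρ g (b s) = b (g • s) := fun g s => by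
    simp only [hb]
    rw [map_smul, tensorRep_coe_tmul, hρw, hsmul, hv]
  refine ⟨K, hK, ε, hε, fun c => ?_⟩
  obtain ⟨g, hg, h2⟩ := h1 (linearCombination ℝ b c)
  refine ⟨g, hg, ?_⟩
  have h3 : ∀ {E : Type _} [NormedAddCommGroup E] [InnerProductSpace ℝ E] (k : P × P → E),
      linearCombination ℝ k (Finsupp.mapDomain (g • ·) c - c) =
        linearCombination ℝ (fun s => k (g • s)) c - linearCombination ℝ k c := fun k => by
    rw [map_sub, Finsupp.linearCombination_mapDomain]; rfl
  have h4 : tensorRep (linearPart α) ρ g (linearCombination ℝ b c) =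
      linearCombination ℝ (fun s => b (g • s)) c := by
    have := Finsupp.apply_linearCombination ℝ (tensorRep (linearPart α) ρ g).toLinearMap b c
    refine this.trans ?_
    congr 2
    exact funext (hTb g)
  -- A displacement is the linear combination with coefficients g c - c, so the Gram comparison
  -- covers both sides of the inequality.
  have h5 := norm_linearCombination_eq_of_inner_eq hbb
  rw [h4, ← h3, h5, h5, map_sub, Finsupp.linearCombination_mapDomain] at h2
  exact h2

end IsGaussianPair

end Gap

/-! ### Products of square-integrable functions -/

section Product

variable {X : Type z} [MeasurableSpace X] {m : Measure X}

theorem memLp_mul_prod {f g : X → ℝ} (hf : MemLp f 2 m) (hg : MemLp g 2 m) :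
    MemLp (fun ω : X × X => f ω.1 * g ω.2) 2 (m.prod m) := by
  have h1 : AEStronglyMeasurable (fun ω : X × X => f ω.1 * g ω.2) (m.prod m) :=
    (hf.1.comp_quasiMeasurePreserving Measure.quasiMeasurePreserving_fst).mul
      (hg.1.comp_quasiMeasurePreserving Measure.quasiMeasurePreserving_snd)
  rw [memLp_two_iff_integrable_sq h1]
  refine (((memLp_two_iff_integrable_sq hf.1).1 hf).mul_prod
    ((memLp_two_iff_integrable_sq hg.1).1 hg)).congr (ae_of_all _ fun ω => ?_)
  simp only [mul_pow]

theorem mul_prod_ae_congr {f f' g g' : X → ℝ} (hf : f =ᵐ[m] f') (hg : g =ᵐ[m] g') :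
    (fun ω : X × X => f ω.1 * g ω.2) =ᵐ[m.prod m] fun ω => f' ω.1 * g' ω.2 := by
  filter_upwards [Measure.quasiMeasurePreserving_fst.ae_eq hf,
    Measure.quasiMeasurePreserving_snd.ae_eq hg] with ω h1 h2
  simp only [Function.comp_apply] at h1 h2
  rw [h1, h2]

variable [SigmaFinite m]

/-- The function `f(x) g(y)` as an element of `L²` of the product. -/
def mulProd : Lp ℝ 2 m →ₗ[ℝ] Lp ℝ 2 m →ₗ[ℝ] Lp ℝ 2 (m.prod m) :=
  LinearMap.mk₂ ℝ (fun f g => (memLp_mul_prod (Lp.memLp f) (Lp.memLp g)).toLp)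
    (fun f f' g => by
      rw [← MemLp.toLp_add]
      refine MemLp.toLp_congr _ _ ((mul_prod_ae_congr (Lp.coeFn_add f f') ae_eq_rfl).trans ?_)
      exact ae_of_all _ fun ω => add_mul _ _ _)
    (fun c f g => by
      rw [← MemLp.toLp_const_smul]
      refine MemLp.toLp_congr _ _ ((mul_prod_ae_congr (Lp.coeFn_smul c f) ae_eq_rfl).trans ?_)
      exact ae_of_all _ fun ω => mul_assoc _ _ _)
    (fun f g g' => by
      rw [← MemLp.toLp_add]
      refine MemLp.toLp_congr _ _ ((mul_prod_ae_congr ae_eq_rfl (Lp.coeFn_add g g')).trans ?_)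
      exact ae_of_all _ fun ω => mul_add _ _ _)
    (fun c f g => by
      rw [← MemLp.toLp_const_smul]
      refine MemLp.toLp_congr _ _ ((mul_prod_ae_congr ae_eq_rfl (Lp.coeFn_smul c g)).trans ?_)
      exact ae_of_all _ fun ω => mul_left_comm _ _ _)

omit [SigmaFinite m] in
theorem mulProd_ae_eq (f g : Lp ℝ 2 m) :
    mulProd f g =ᵐ[m.prod m] fun ω => f ω.1 * g ω.2 :=
  (memLp_mul_prod (Lp.memLp f) (Lp.memLp g)).coeFn_toLp

theorem inner_mulProd (f g f' g' : Lp ℝ 2 m) :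
    ⟪mulProd f g, mulProd f' g'⟫ = ⟪f, f'⟫ * ⟪g, g'⟫ := by
  rw [L2.inner_def, L2.inner_def, L2.inner_def, ← integral_prod_mul]
  refine integral_congr_ae ?_
  filter_upwards [mulProd_ae_eq f g, mulProd_ae_eq f' g'] with ω h1 h2
  rw [h1, h2]
  simp only [RCLike.inner_apply, conj_trivial]
  ring

theorem norm_mulProd (f g : Lp ℝ 2 m) : ‖mulProd f g‖ = ‖f‖ * ‖g‖ := by
  rw [← sq_eq_sq₀ (norm_nonneg _) (by positivity), mul_pow, ← real_inner_self_eq_norm_sq,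
    inner_mulProd, real_inner_self_eq_norm_sq, real_inner_self_eq_norm_sq]

theorem norm_mulProd_sub_le (f g : Lp ℝ 2 m) :
    ‖mulProd f f - mulProd g g‖ ≤ (‖f‖ + ‖g‖) * ‖f - g‖ := by
  have h : mulProd f f - mulProd g g = mulProd f (f - g) + mulProd (f - g) g := by
    simp only [map_sub, LinearMap.sub_apply]; abel
  rw [h]
  refine (norm_add_le _ _).trans ?_
  rw [norm_mulProd, norm_mulProd]
  linarith

omit [SigmaFinite m] in
theorem norm_sq_eq_integral_sq (f : Lp ℝ 2 m) : ‖f‖ ^ 2 = ∫ ω, f ω ^ 2 ∂m := by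
  rw [← real_inner_self_eq_norm_sq, L2.inner_def]
  simp

omit [SigmaFinite m] in
theorem lintegral_ofReal_sq_eq (f : Lp ℝ 2 m) :
    ∫⁻ ω, ENNReal.ofReal (f ω ^ 2) ∂m = ENNReal.ofReal (‖f‖ ^ 2) := by
  rw [norm_sq_eq_integral_sq, ofReal_integral_eq_lintegral_ofReal
    ((memLp_two_iff_integrable_sq (Lp.aestronglyMeasurable f)).1 (Lp.memLp f))
    (ae_of_all _ fun ω => sq_nonneg _)]

end Product

/-! ### Coordinates weighted by square roots of densities -/

section Weighted

open Finsupp (linearCombination)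

variable {V : Type u} [NormedAddCommGroup V] [InnerProductSpace ℝ V]
  {P : Type w} [MetricSpace P] [NormedAddTorsor V P] {X : Type z} [MeasurableSpace X]
  {m : Measure X} {μ : P → Measure X} {o : P} {W : V → X → ℝ}

namespace IsIsonormal

theorem integral_coord_sq (I : IsIsonormal m μ o W) (x : P) (v : V) :
    ∫ ω, W v ω ^ 2 ∂(μ x) = ⟪v, x -ᵥ o⟫ ^ 2 + ‖v‖ ^ 2 := by
  have := I.prob x
  have h := variance_id_gaussianReal (μ := ⟪v, x -ᵥ o⟫) (v := ‖v‖₊ ^ 2)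
  rw [← I.law x v, variance_map (by fun_prop) (I.meas v).aemeasurable, Function.id_comp,
    variance_eq_sub (I.memLp_coord x v 2), I.integral_coord] at h
  simp only [Pi.pow_apply] at h
  simp only [NNReal.coe_pow, coe_nnnorm] at h
  linarith

variable [SigmaFinite m]

/-- The halved exponents at x and y add up to the exponent at the midpoint, so the product of the
two half-densities is exp(-d²/8) times the density of the Gaussian measure at the midpoint. -/
theorem integral_mul_sqrtDensity_mul (I : IsIsonormal m μ o W) (x y : P) (f : X → ℝ) :
    ∫ ω, f ω * (sqrtDensity m (μ x) ω * sqrtDensity m (μ y) ω) ∂m =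
      Real.exp (-(dist x y ^ 2 / 8)) * ∫ ω, f ω ∂(μ (midpoint ℝ x y)) := by
  have := I.prob o
  set a := x -ᵥ o
  set b := y -ᵥ o
  have hmid : midpoint ℝ x y -ᵥ o = (1 / 2 : ℝ) • a + (1 / 2 : ℝ) • b := by
    conv_lhs => rw [← midpoint_self ℝ o]
    rw [midpoint_vsub_midpoint, midpoint_eq_smul_add, invOf_eq_inv, smul_add, one_div]
  have hxy : x -ᵥ y = a - b := by simp [a, b]
  have h1 : ∀ᵐ ω ∂m, f ω * (sqrtDensity m (μ x) ω * sqrtDensity m (μ y) ω) =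
      ((μ o).rnDeriv m ω).toReal • (Real.exp (-(dist x y ^ 2 / 8)) *
        (cameronMartin W (midpoint ℝ x y -ᵥ o) ω * f ω)) := by
    filter_upwards [I.sqrtDensity_ae_eq x, I.sqrtDensity_ae_eq y,
      I.add ((1 / 2 : ℝ) • a) ((1 / 2 : ℝ) • b)] with ω h3 h4 h5
    have h6 : sqrtDensity m (μ o) ω * sqrtDensity m (μ o) ω = ((μ o).rnDeriv m ω).toReal :=
      Real.mul_self_sqrt ENNReal.toReal_nonneg
    have h7 : Real.exp (-(dist x y ^ 2 / 8)) * cameronMartin W (midpoint ℝ x y -ᵥ o) ω =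
        Real.exp (-(‖a‖ ^ 2 / 4)) * Real.exp (-(‖b‖ ^ 2 / 4)) *
        (Real.exp (W ((1 / 2 : ℝ) • a) ω) * Real.exp (W ((1 / 2 : ℝ) • b) ω)) := by
      rw [cameronMartin, hmid, h5, dist_eq_norm_vsub V x y, hxy, ← smul_add, norm_smul, mul_pow,
        norm_sub_sq_real, norm_add_sq_real, ← Real.exp_add, ← Real.exp_add, ← Real.exp_add,
        ← Real.exp_add]
      congr 1
      norm_num
      ring
    rw [← mul_assoc (Real.exp (-(dist x y ^ 2 / 8))), h7, h3, h4, ← h6]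
    simp only [smul_eq_mul]
    ring
  rw [integral_congr_ae h1, integral_rnDeriv_smul (I.ac o), integral_const_mul, ← I.integral_eq]

theorem memLp_coord_mul_sqrtDensity (I : IsIsonormal m μ o W) (v : V) (x : P) :
    MemLp (fun ω => W v ω * sqrtDensity m (μ x) ω) 2 m := by
  have := I.prob x
  have hm : Measurable fun ω => W v ω * sqrtDensity m (μ x) ω :=
    (I.meas v).mul (measurable_sqrtDensity m (μ x))
  rw [memLp_two_iff_integrable_sq hm.aestronglyMeasurable]
  have h1 := (integrable_rnDeriv_smul_iff (I.ac x) (f := fun ω => W v ω ^ 2)).2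
    ((memLp_two_iff_integrable_sq (I.meas v).aestronglyMeasurable).1 (I.memLp_coord x v 2))
  refine h1.congr (ae_of_all _ fun ω => ?_)
  simp only [smul_eq_mul, mul_pow]
  rw [sqrtDensity, Real.sq_sqrt ENNReal.toReal_nonneg, mul_comm]

/-- The square root of the density of `μ x` as an element of `L²`. -/
def sqrtVec (I : IsIsonormal m μ o W) (x : P) : Lp ℝ 2 m := (I.memLp_sqrtDensity x).toLp

/-- The coordinate `W v` times the square root of the density of `μ x`. -/
def coordVec (I : IsIsonormal m μ o W) (v : V) (x : P) : Lp ℝ 2 m :=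
  (I.memLp_coord_mul_sqrtDensity v x).toLp

omit [SigmaFinite m] in
theorem sqrtVec_ae_eq (I : IsIsonormal m μ o W) (x : P) :
    I.sqrtVec x =ᵐ[m] sqrtDensity m (μ x) := (I.memLp_sqrtDensity x).coeFn_toLp

theorem coordVec_ae_eq (I : IsIsonormal m μ o W) (v : V) (x : P) :
    I.coordVec v x =ᵐ[m] fun ω => W v ω * I.sqrtVec x ω := by
  filter_upwards [(I.memLp_coord_mul_sqrtDensity v x).coeFn_toLp, I.sqrtVec_ae_eq x] with ω h1 h2
  rw [h2]
  exact h1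

theorem inner_sqrtVec (I : IsIsonormal m μ o W) (x y : P) :
    ⟪I.sqrtVec x, I.sqrtVec y⟫ = Real.exp (-(dist x y ^ 2 / 8)) := I.inner_sqrtDensity x y

theorem inner_coordVec_sqrtVec (I : IsIsonormal m μ o W) (v : V) (x y : P) :
    ⟪I.coordVec v x, I.sqrtVec y⟫ =
      Real.exp (-(dist x y ^ 2 / 8)) * ⟪v, midpoint ℝ x y -ᵥ o⟫ := by
  rw [← I.integral_coord, ← I.integral_mul_sqrtDensity_mul x y, L2.inner_def]
  refine integral_congr_ae ?_
  filter_upwards [I.coordVec_ae_eq v x, I.sqrtVec_ae_eq x, I.sqrtVec_ae_eq y] with ω h1 h2 h3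
  rw [h1, h2, h3]
  simp only [RCLike.inner_apply, conj_trivial]
  ring

theorem inner_coordVec (I : IsIsonormal m μ o W) (v : V) (x y : P) :
    ⟪I.coordVec v x, I.coordVec v y⟫ =
      Real.exp (-(dist x y ^ 2 / 8)) * (⟪v, midpoint ℝ x y -ᵥ o⟫ ^ 2 + ‖v‖ ^ 2) := by
  rw [← I.integral_coord_sq, ← I.integral_mul_sqrtDensity_mul x y, L2.inner_def]
  refine integral_congr_ae ?_
  filter_upwards [I.coordVec_ae_eq v x, I.coordVec_ae_eq v y, I.sqrtVec_ae_eq x,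
    I.sqrtVec_ae_eq y] with ω h1 h2 h3 h4
  rw [h1, h2, h3, h4]
  simp only [RCLike.inner_apply, conj_trivial]
  ring

theorem norm_coordVec_le (I : IsIsonormal m μ o W) (v : V) (x : P) :
    ‖I.coordVec v x‖ ≤ (‖x -ᵥ o‖ + 1) * ‖v‖ := by
  refine le_of_sq_le_sq ?_ (by positivity)
  rw [← real_inner_self_eq_norm_sq, inner_coordVec, dist_self, midpoint_self]
  have h1 : ⟪v, x -ᵥ o⟫ ^ 2 ≤ (‖v‖ * ‖x -ᵥ o‖) ^ 2 :=
    sq_le_sq' (neg_le_of_abs_le (abs_real_inner_le_norm _ _)) (real_inner_le_norm _ _)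
  have h2 : 0 ≤ ‖x -ᵥ o‖ * ‖v‖ ^ 2 := by positivity
  norm_num
  nlinarith

/-- The products of the vectors `sqrtVec`. -/
def pairVec (I : IsIsonormal m μ o W) (x y : P) : Lp ℝ 2 (m.prod m) :=
  mulProd (I.sqrtVec x) (I.sqrtVec y)

theorem isGaussianPair_pairVec (I : IsIsonormal m μ o W) : IsGaussianPair I.pairVec :=
  fun x y x' y' => by rw [pairVec, pairVec, inner_mulProd, inner_sqrtVec, inner_sqrtVec]

/-- The vectors `(W v (ω) - W v (ω')) u_z(ω) u_z(ω')`. -/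
def diffVec (I : IsIsonormal m μ o W) (v : V) (z : P) : Lp ℝ 2 (m.prod m) :=
  mulProd (I.coordVec v z) (I.sqrtVec z) - mulProd (I.sqrtVec z) (I.coordVec v z)

theorem diffVec_ae_eq (I : IsIsonormal m μ o W) (v : V) (z : P) :
    I.diffVec v z =ᵐ[m.prod m] fun ω => (W v ω.1 - W v ω.2) * I.pairVec z z ω := by
  rw [diffVec, pairVec]
  filter_upwards [Lp.coeFn_sub (mulProd (I.coordVec v z) (I.sqrtVec z))
      (mulProd (I.sqrtVec z) (I.coordVec v z)), mulProd_ae_eq (I.coordVec v z) (I.sqrtVec z),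
    mulProd_ae_eq (I.sqrtVec z) (I.coordVec v z), mulProd_ae_eq (I.sqrtVec z) (I.sqrtVec z),
    mul_prod_ae_congr (I.coordVec_ae_eq v z) (ae_eq_rfl (f := I.sqrtVec z)),
    mul_prod_ae_congr (ae_eq_rfl (f := I.sqrtVec z)) (I.coordVec_ae_eq v z)]
    with ω h1 h2 h3 h4 h5 h6
  rw [h1, Pi.sub_apply, h2, h3, h4, h5, h6]
  ring

/-- The mean of `W v` at the midpoint of z and z' appears squared with both signs and cancels. What
remains is the variance 2‖v‖² of a difference of two independent coordinates, so on diagonal vectors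
multiplication by this difference is √2 ‖v‖ times an isometry. -/
theorem inner_diffVec (I : IsIsonormal m μ o W) (v : V) (z z' : P) :
    ⟪I.diffVec v z, I.diffVec v z'⟫ = 2 * ‖v‖ ^ 2 * ⟪I.pairVec z z, I.pairVec z' z'⟫ := by
  simp only [diffVec, pairVec, inner_sub_left, inner_sub_right, inner_mulProd, inner_coordVec,
    inner_coordVec_sqrtVec, inner_sqrtVec]
  rw [real_inner_comm (I.coordVec v z') (I.sqrtVec z), inner_coordVec_sqrtVec, dist_comm z' z,
    midpoint_comm z' z]
  ring

/-- The mean square of `W v (ω) - W v (ω')` against a combination of diagonal vectors. -/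
theorem lintegral_sq_mul_diagPart (I : IsIsonormal m μ o W) (v : V) (c : P × P →₀ ℝ) :
    ∫⁻ ω, ENNReal.ofReal (((W v ω.1 - W v ω.2) *
      linearCombination ℝ (diagPart I.pairVec) c ω) ^ 2) ∂(m.prod m) =
      ENNReal.ofReal (2 * ‖v‖ ^ 2 * ‖linearCombination ℝ (diagPart I.pairVec) c‖ ^ 2) := by
  -- These are the diagonal parts multiplied by W v(ω) - W v(ω'). Their Gram matrix is 2‖v‖² times
  -- that of the diagonal parts, hence so are the squared norms of combinations.
  set D : P × P → Lp ℝ 2 (m.prod m) := fun s =>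
    Real.exp (-(‖s.1 -ᵥ s.2‖ ^ 2 / 16)) • I.diffVec v (midpoint ℝ s.1 s.2) with hD
  have hDae : ∀ c, linearCombination ℝ D c =ᵐ[m.prod m] fun ω => (W v ω.1 - W v ω.2) *
      linearCombination ℝ (diagPart I.pairVec) c ω := by
    intro c
    induction c using Finsupp.induction_linear with
    | zero =>
      simp only [map_zero]
      filter_upwards [Lp.coeFn_zero ℝ 2 (m.prod m)] with ω h
      rw [h]; simp
    | add c c' h h' =>
      simp only [map_add]
      filter_upwards [Lp.coeFn_add (linearCombination ℝ D c) (linearCombination ℝ D c'),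
        Lp.coeFn_add (linearCombination ℝ (diagPart I.pairVec) c)
          (linearCombination ℝ (diagPart I.pairVec) c'), h, h'] with ω h1 h2 h3 h4
      rw [h1, h2, Pi.add_apply, Pi.add_apply, h3, h4, mul_add]
    | single s a =>
      simp only [Finsupp.linearCombination_single, hD, diagPart, smul_smul]
      filter_upwards [Lp.coeFn_smul (a * Real.exp (-(‖s.1 -ᵥ s.2‖ ^ 2 / 16)))
          (I.diffVec v (midpoint ℝ s.1 s.2)),
        Lp.coeFn_smul (a * Real.exp (-(‖s.1 -ᵥ s.2‖ ^ 2 / 16)))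
          (I.pairVec (midpoint ℝ s.1 s.2) (midpoint ℝ s.1 s.2)),
        I.diffVec_ae_eq v (midpoint ℝ s.1 s.2)] with ω h1 h2 h3
      rw [h1, h2, Pi.smul_apply, Pi.smul_apply, h3, smul_eq_mul, smul_eq_mul]
      ring
  have hnorm : ‖linearCombination ℝ D c‖ ^ 2 =
      2 * ‖v‖ ^ 2 * ‖linearCombination ℝ (diagPart I.pairVec) c‖ ^ 2 := by
    have h1 := norm_linearCombination_eq_of_inner_eq (κ := D)
      (κ' := fun s => (√2 * ‖v‖) • diagPart I.pairVec s) (fun s t => by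
        simp only [hD, diagPart, real_inner_smul_left, inner_smul_right, inner_diffVec]
        have : √2 * √2 = (2 : ℝ) := Real.mul_self_sqrt (by norm_num)
        linear_combination (-(‖v‖ ^ 2 * Real.exp (-(‖s.1 -ᵥ s.2‖ ^ 2 / 16)) *
          Real.exp (-(‖t.1 -ᵥ t.2‖ ^ 2 / 16)) *
          ⟪I.pairVec (midpoint ℝ s.1 s.2) (midpoint ℝ s.1 s.2),
            I.pairVec (midpoint ℝ t.1 t.2) (midpoint ℝ t.1 t.2)⟫)) * this) c
    have h2 : linearCombination ℝ (fun s => (√2 * ‖v‖) • diagPart I.pairVec s) c =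
        (√2 * ‖v‖) • linearCombination ℝ (diagPart I.pairVec) c := by
      simp only [Finsupp.linearCombination_apply, Finsupp.smul_sum, smul_comm (√2 * ‖v‖)]
    rw [h1, h2, norm_smul, mul_pow, Real.norm_eq_abs, sq_abs, mul_pow,
      Real.sq_sqrt (by norm_num)]
  rw [← hnorm, ← lintegral_ofReal_sq_eq]
  refine lintegral_congr_ae ?_
  filter_upwards [hDae c] with ω hω
  rw [hω]

end IsIsonormal

end Weighted

/-! ### Concentration -/

section Concentration

variable {X : Type z} [MeasurableSpace X] {ν : Measure X} [IsProbabilityMeasure ν]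

theorem ofReal_sq_sub_le (a b c : ℝ) : ENNReal.ofReal ((a - b) ^ 2) ≤
    2 * ENNReal.ofReal ((a - c) ^ 2) + 2 * ENNReal.ofReal ((b - c) ^ 2) := by
  rw [← ENNReal.ofReal_ofNat, ← ENNReal.ofReal_mul (by norm_num), ← ENNReal.ofReal_mul (by norm_num),
    ← ENNReal.ofReal_add (by positivity) (by positivity)]
  refine ENNReal.ofReal_le_ofReal ?_
  nlinarith [sq_nonneg (a - c + (b - c))]

/-- If most pairs of points lie in `Γ`, then there is a large set on which the mean square of
`f x - f y` is controlled by its mean square on `Γ`, for all `f`. -/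
theorem exists_set_lintegral_sq_sub_le {Γ : Set (X × X)} (hΓ : MeasurableSet Γ)
    (h : (ν.prod ν) Γᶜ ≤ 1 / 64) :
    ∃ A, MeasurableSet A ∧ ν Aᶜ ≤ 1 / 16 ∧ ∀ f : X → ℝ, Measurable f → ∀ C : ℝ≥0∞,
      ∫⁻ ω in Γ, ENNReal.ofReal ((f ω.1 - f ω.2) ^ 2) ∂(ν.prod ν) ≤ C →
      ∫⁻ x in A, ∫⁻ y in A, ENNReal.ofReal ((f x - f y) ^ 2) ∂ν ∂ν ≤ 8 * C := by
  have hsec : ∀ x, MeasurableSet (Prod.mk x ⁻¹' Γ) := fun x => measurable_prodMk_left hΓ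
  have hmeas : Measurable fun x => ν (Prod.mk x ⁻¹' Γᶜ) := measurable_measure_prodMk_left hΓ.compl
  -- `A` consists of the points that are paired well, in the sense of Γ, with more than three
  -- quarters of the space. Markov's inequality bounds its complement by 4 · 1/64 = 1/16. The choice
  -- depends on Γ only, so one set serves all f.
  refine ⟨{x | ν (Prod.mk x ⁻¹' Γᶜ) < 1 / 4}, measurableSet_lt hmeas measurable_const, ?_,
    fun f hf C hC => ?_⟩
  · have h1 : {x | ν (Prod.mk x ⁻¹' Γᶜ) < 1 / 4}ᶜ = {x | 1 / 4 ≤ ν (Prod.mk x ⁻¹' Γᶜ)} := by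
      ext x; simp
    rw [h1]
    have h2 := mul_meas_ge_le_lintegral hmeas (μ := ν) (1 / 4)
    rw [← Measure.prod_apply hΓ.compl] at h2
    have h3 := h2.trans h
    have h4 := mul_le_mul_right h3 4
    rw [← mul_assoc] at h4
    have h5 : (4 : ℝ≥0∞) * (1 / 4) = 1 := by
      rw [one_div]; exact ENNReal.mul_inv_cancel (by norm_num) (by norm_num)
    have h6 : (4 : ℝ≥0∞) * (1 / 64) = 1 / 16 :=
      (ENNReal.toReal_eq_toReal_iff' (by finiteness) (by finiteness)).1 (by norm_num)
    rwa [h5, h6, one_mul] at h4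
  · set k : X → X → ℝ≥0∞ := fun x y => ENNReal.ofReal ((f x - f y) ^ 2) with hk
    have hkm : Measurable fun ω : X × X => k ω.1 ω.2 := by
      simp only [hk]; fun_prop
    set H : X → ℝ≥0∞ := fun x => ∫⁻ y in Prod.mk x ⁻¹' Γ, k x y ∂ν with hH
    have hHm' : H = fun x => ∫⁻ y, Γ.indicator (fun ω : X × X => k ω.1 ω.2) (x, y) ∂ν := by
      ext x
      change ∫⁻ y in Prod.mk x ⁻¹' Γ, k x y ∂ν = _
      rw [← lintegral_indicator (hsec x)]
      rfl
    have hHm : Measurable H := by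
      rw [hHm']
      exact (hkm.indicator hΓ).lintegral_prod_right'
    have hHint : ∫⁻ x, H x ∂ν ≤ C := by
      refine le_trans (le_of_eq ?_) hC
      rw [← lintegral_indicator hΓ, lintegral_prod _ (hkm.indicator hΓ).aemeasurable, hHm']
    -- Two points of `A` have common good partners y of total measure at least 1/2. Averaging (f x -
    -- f x')² ≤ 2(f x - f y)² + 2(f x' - f y)² over them gives the constant 4.
    have hpt : ∀ x x', ν (Prod.mk x ⁻¹' Γᶜ) < 1 / 4 → ν (Prod.mk x' ⁻¹' Γᶜ) < 1 / 4 →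
        k x x' ≤ 4 * (H x + H x') := by
      intro x x' hx hx'
      set B := Prod.mk x ⁻¹' Γ ∩ Prod.mk x' ⁻¹' Γ with hB
      have hBm : MeasurableSet B := (hsec x).inter (hsec x')
      have hBc : 1 / 2 ≤ ν B := by
        have h1 : ν Bᶜ ≤ 1 / 2 := by
          rw [hB, Set.compl_inter]
          refine (measure_union_le _ _).trans ?_
          refine (add_le_add hx.le hx'.le).trans (le_of_eq ?_)
          refine (ENNReal.toReal_eq_toReal_iff' (by finiteness) (by finiteness)).1 ?_
          rw [ENNReal.toReal_add (by finiteness) (by finiteness)]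
          norm_num
        have h2 : (1 / 2 : ℝ≥0∞) + 1 / 2 ≤ ν B + 1 / 2 := by
          refine le_trans (le_of_eq ?_) (add_le_add le_rfl h1)
          rw [prob_add_prob_compl hBm]
          refine (ENNReal.toReal_eq_toReal_iff' (by finiteness) (by finiteness)).1 ?_
          rw [ENNReal.toReal_add (by finiteness) (by finiteness)]
          norm_num
        exact (ENNReal.add_le_add_iff_right (by finiteness)).1 h2
      have h2 : k x x' * ν B ≤ 2 * H x + 2 * H x' := by
        rw [← setLIntegral_const]
        calc ∫⁻ _ in B, k x x' ∂ν ≤ ∫⁻ y in B, (2 * k x y + 2 * k x' y) ∂ν :=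
              lintegral_mono fun y => ofReal_sq_sub_le _ _ _
          _ = 2 * ∫⁻ y in B, k x y ∂ν + 2 * ∫⁻ y in B, k x' y ∂ν := by
              have hm1 : ∀ x, Measurable (k x) := fun x => hkm.comp measurable_prodMk_left
              rw [lintegral_add_left ((hm1 x).const_mul 2), lintegral_const_mul _ (hm1 x),
                lintegral_const_mul _ (hm1 x')]
          _ ≤ 2 * H x + 2 * H x' := by
              gcongr
              · exact lintegral_mono_set Set.inter_subset_left
              · exact lintegral_mono_set Set.inter_subset_right
      calc k x x' = 2 * (k x x' * (1 / 2)) := by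
            rw [mul_left_comm, one_div, ENNReal.mul_inv_cancel (by norm_num) (by norm_num),
              mul_one]
        _ ≤ 2 * (k x x' * ν B) := by gcongr
        _ ≤ 2 * (2 * H x + 2 * H x') := by gcongr
        _ = 4 * (H x + H x') := by ring
    set A := {x | ν (Prod.mk x ⁻¹' Γᶜ) < 1 / 4}
    have hA : MeasurableSet A := measurableSet_lt hmeas measurable_const
    calc ∫⁻ x in A, ∫⁻ y in A, k x y ∂ν ∂ν
        ≤ ∫⁻ x in A, ∫⁻ y in A, 4 * (H x + H y) ∂ν ∂ν :=
          setLIntegral_mono' hA fun x hx => setLIntegral_mono' hA fun y hy => hpt x y hx hy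
      _ ≤ ∫⁻ x, ∫⁻ y, 4 * (H x + H y) ∂ν ∂ν :=
          (setLIntegral_le_lintegral _ _).trans
            (lintegral_mono fun x => setLIntegral_le_lintegral _ _)
      _ = 4 * (∫⁻ x, H x ∂ν + ∫⁻ x, H x ∂ν) := by
          have h1 : ∀ x, ∫⁻ y, 4 * (H x + H y) ∂ν = 4 * (H x + ∫⁻ y, H y ∂ν) := fun x => by
            rw [lintegral_const_mul _ (by fun_prop), lintegral_add_left measurable_const,
              lintegral_const, measure_univ, mul_one]
          simp only [h1]
          rw [lintegral_const_mul _ (by fun_prop), lintegral_add_left hHm,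
              lintegral_const, measure_univ, mul_one]
      _ ≤ 4 * (C + C) := by gcongr
      _ = 8 * C := by ring

/-- Chebyshev's inequality on the set `A`. -/
theorem measure_lt_abs_sub_average_le {A : Set X} (hA : MeasurableSet A) (hAc : ν Aᶜ ≤ 1 / 16)
    {f : X → ℝ} (hfm : Measurable f) (hf : MemLp f 2 ν) {R : ℝ} (hR : 0 < R)
    (h : ∫⁻ x in A, ∫⁻ y in A, ENNReal.ofReal ((f x - f y) ^ 2) ∂ν ∂ν ≤
      ENNReal.ofReal (R ^ 2 / 16)) :
    ν {x | R < |f x - (ν.real A)⁻¹ * ∫ y in A, f y ∂ν|} ≤ 1 / 8 := by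
  set Φ := (ν.real A)⁻¹ * ∫ y in A, f y ∂ν with hΦ
  set κ := ν.restrict A with hκ
  have hfκ : MemLp f 2 κ := hf.restrict A
  have hf1 : Integrable f κ := hfκ.integrable (by norm_num)
  have hf2 : Integrable (fun x => f x ^ 2) κ :=
    (memLp_two_iff_integrable_sq hfm.aestronglyMeasurable).1 hfκ
  have hq : 1 / 2 ≤ ν.real A := by
    have h1 : ν.real Aᶜ ≤ 1 / 16 := by
      have h2 := ENNReal.toReal_mono (by finiteness) hAc
      norm_num at h2 ⊢
      exact h2
    rw [probReal_compl_eq_one_sub hA] at h1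
    linarith
  have hqκ : κ.real Set.univ = ν.real A := by simp [hκ, Measure.real]
  set S1 := ∫ y, f y ∂κ with hS1
  set S2 := ∫ y, f y ^ 2 ∂κ with hS2
  have hsq : ∀ t : ℝ, Integrable (fun x => (f x - t) ^ 2) κ ∧
      ∫ x, (f x - t) ^ 2 ∂κ = S2 - 2 * t * S1 + t ^ 2 * ν.real A := fun t => by
    have h1 : (fun x => (f x - t) ^ 2) = fun x => f x ^ 2 - 2 * t * f x + t ^ 2 := by
      ext x; ring
    have h2 : Integrable (fun x => f x ^ 2 - 2 * t * f x) κ := hf2.sub (hf1.const_mul _)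
    rw [h1]
    refine ⟨h2.add (integrable_const _), ?_⟩
    rw [integral_add h2 (integrable_const _), integral_sub hf2 (hf1.const_mul _),
      integral_const_mul, integral_const, hqκ, smul_eq_mul, mul_comm (ν.real A)]
  -- The double integral is 2 ν(A) times the integral over A of (f - Φ)². Since ν(A) ≥ 1/2, the
  -- latter is at most R²/16.
  have hdouble : ∫⁻ x in A, ∫⁻ y in A, ENNReal.ofReal ((f x - f y) ^ 2) ∂ν ∂ν =
      ENNReal.ofReal (2 * ν.real A * S2 - 2 * S1 ^ 2) := by
    have h1 : ∀ x, ∫⁻ y in A, ENNReal.ofReal ((f x - f y) ^ 2) ∂ν =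
        ENNReal.ofReal (S2 - 2 * f x * S1 + f x ^ 2 * ν.real A) := fun x => by
      rw [← (hsq (f x)).2, ofReal_integral_eq_lintegral_ofReal (hsq (f x)).1
        (ae_of_all _ fun y => sq_nonneg _)]
      simp only [sub_sq_comm (f x)]
      rfl
    simp only [h1]
    have h2 : Integrable (fun x => S2 - 2 * f x * S1 + f x ^ 2 * ν.real A) κ :=
      ((integrable_const _).sub ((hf1.const_mul 2).mul_const S1)).add (hf2.mul_const _)
    rw [← ofReal_integral_eq_lintegral_ofReal h2 (ae_of_all _ fun x => by
      change 0 ≤ S2 - 2 * f x * S1 + f x ^ 2 * ν.real A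
      rw [← (hsq (f x)).2]
      exact integral_nonneg fun y => sq_nonneg _)]
    congr 1
    have h3 : Integrable (fun x => S2 - 2 * f x * S1) κ :=
      (integrable_const _).sub ((hf1.const_mul 2).mul_const S1)
    rw [integral_add h3 (hf2.mul_const _), integral_sub (integrable_const _) ((hf1.const_mul 2).mul_const S1),
      integral_const, integral_mul_const, integral_mul_const, integral_const_mul, hqκ, smul_eq_mul]
    ring
  rw [hdouble, ENNReal.ofReal_le_ofReal_iff (by positivity)] at h
  have hvar : ∫ x, (f x - Φ) ^ 2 ∂κ ≤ R ^ 2 / 16 := by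
    have h1 : ν.real A * Φ = S1 := by
      rw [hΦ, mul_inv_cancel_left₀ (by linarith)]
    have h2 : 0 ≤ ∫ x, (f x - Φ) ^ 2 ∂κ := integral_nonneg fun y => sq_nonneg _
    have h3 : 2 * ν.real A * ∫ x, (f x - Φ) ^ 2 ∂κ = 2 * ν.real A * S2 - 2 * S1 ^ 2 := by
      rw [(hsq Φ).2, ← h1]; ring
    nlinarith
  have hch : κ {x | R < |f x - Φ|} ≤ 1 / 16 := by
    have h1 : ENNReal.ofReal (R ^ 2) * κ {x | ENNReal.ofReal (R ^ 2) ≤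
        ENNReal.ofReal ((f x - Φ) ^ 2)} ≤ ENNReal.ofReal (R ^ 2 / 16) := by
      refine (mul_meas_ge_le_lintegral (by fun_prop) _).trans ?_
      rw [← ofReal_integral_eq_lintegral_ofReal (hsq Φ).1 (ae_of_all _ fun y => sq_nonneg _)]
      exact ENNReal.ofReal_le_ofReal hvar
    have h2 : {x | R < |f x - Φ|} ⊆ {x | ENNReal.ofReal (R ^ 2) ≤
        ENNReal.ofReal ((f x - Φ) ^ 2)} := fun x hx => by
      refine ENNReal.ofReal_le_ofReal ?_
      rw [← sq_abs (f x - Φ)]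
      exact pow_le_pow_left₀ hR.le (le_of_lt hx) 2
    have h3 : ENNReal.ofReal (R ^ 2 / 16) = ENNReal.ofReal (R ^ 2) * (1 / 16) := by
      rw [div_eq_mul_one_div, ENNReal.ofReal_mul (by positivity)]
      congr 1
      rw [one_div, one_div, ENNReal.ofReal_inv_of_pos (by norm_num)]
      norm_num
    rw [h3] at h1
    refine (measure_mono h2).trans ?_
    exact (ENNReal.mul_le_mul_iff_right (by simpa using hR.ne') ENNReal.ofReal_ne_top).1 h1
  calc ν {x | R < |f x - Φ|} ≤ ν ({x | R < |f x - Φ|} ∩ A) + ν Aᶜ :=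
        (measure_mono fun x hx => by
          by_cases hxA : x ∈ A
          · exact Or.inl ⟨hx, hxA⟩
          · exact Or.inr hxA).trans (measure_union_le _ _)
    _ ≤ 1 / 16 + 1 / 16 := by
        gcongr
        rw [← Measure.restrict_apply' hA]
        exact hch
    _ = 1 / 8 := by
        refine (ENNReal.toReal_eq_toReal_iff' (by finiteness) (by finiteness)).1 ?_
        rw [ENNReal.toReal_add (by finiteness) (by finiteness)]
        norm_num

end Concentration

/-! ### Points moved a bounded distance -/

section Barycenter

open Finsupp (linearCombination)

variable {X : Type z} [MeasurableSpace X] {m : Measure X} [SigmaFinite m]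

/-- The measure with density `ξ²`. -/
def sqMeasure (ξ : Lp ℝ 2 m) : Measure X := m.withDensity fun ω => ENNReal.ofReal (ξ ω ^ 2)

omit [SigmaFinite m] in
theorem measurable_ofReal_sq (ξ : Lp ℝ 2 m) : Measurable fun ω => ENNReal.ofReal (ξ ω ^ 2) :=
  ((Lp.stronglyMeasurable ξ).measurable.pow_const 2).ennreal_ofReal

omit [SigmaFinite m] in
theorem sqMeasure_ac (ξ : Lp ℝ 2 m) : sqMeasure ξ ≪ m := withDensity_absolutelyContinuous _ _

omit [SigmaFinite m] in
theorem isProbabilityMeasure_sqMeasure {ξ : Lp ℝ 2 m} (h : ‖ξ‖ = 1) :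
    IsProbabilityMeasure (sqMeasure ξ) := ⟨by
  rw [sqMeasure, withDensity_apply _ .univ, Measure.restrict_univ, lintegral_ofReal_sq_eq, h]
  simp⟩

omit [SigmaFinite m] in
theorem sqMeasure_apply (ξ : Lp ℝ 2 m) {B : Set X} (hB : MeasurableSet B) :
    sqMeasure ξ B = ∫⁻ ω in B, ENNReal.ofReal (ξ ω ^ 2) ∂m := withDensity_apply _ hB

omit [SigmaFinite m] in
theorem sqMeasure_le_add {ξ η : Lp ℝ 2 m} (hξ : ‖ξ‖ = 1) (hη : ‖η‖ = 1) (h : ‖η - ξ‖ ≤ 1 / 16)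
    {B : Set X} (hB : MeasurableSet B) : sqMeasure η B ≤ sqMeasure ξ B + 1 / 8 := by
  -- From η² - ξ² = (η - ξ)(η + ξ) and ab ≤ 16a² + b²/64. With ‖η - ξ‖ ≤ 1/16 and ‖η + ξ‖ ≤ 2 each
  -- of the two error terms is at most 1/16.
  have h1 : ∫⁻ ω in B, ENNReal.ofReal (η ω ^ 2) ∂m ≤ ∫⁻ ω in B, (ENNReal.ofReal (ξ ω ^ 2) +
      (ENNReal.ofReal 16 * ENNReal.ofReal ((η - ξ) ω ^ 2) +
        ENNReal.ofReal (1 / 64) * ENNReal.ofReal ((η + ξ) ω ^ 2))) ∂m := by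
    refine lintegral_mono_ae (ae_restrict_of_ae ?_)
    filter_upwards [Lp.coeFn_sub η ξ, Lp.coeFn_add η ξ] with ω h1 h2
    rw [h1, h2, Pi.sub_apply, Pi.add_apply, ← ENNReal.ofReal_mul (by norm_num),
      ← ENNReal.ofReal_mul (by norm_num), ← ENNReal.ofReal_add (by positivity) (by positivity),
      ← ENNReal.ofReal_add (by positivity) (by positivity)]
    refine ENNReal.ofReal_le_ofReal ?_
    nlinarith [sq_nonneg (4 * (η ω - ξ ω) - (1 / 8) * (η ω + ξ ω))]
  rw [sqMeasure_apply _ hB, sqMeasure_apply _ hB]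
  refine h1.trans ?_
  rw [lintegral_add_left (measurable_ofReal_sq ξ),
    lintegral_add_left ((measurable_ofReal_sq _).const_mul _),
    lintegral_const_mul _ (measurable_ofReal_sq _), lintegral_const_mul _ (measurable_ofReal_sq _)]
  gcongr
  calc ENNReal.ofReal 16 * ∫⁻ ω in B, ENNReal.ofReal ((η - ξ) ω ^ 2) ∂m +
        ENNReal.ofReal (1 / 64) * ∫⁻ ω in B, ENNReal.ofReal ((η + ξ) ω ^ 2) ∂m
      ≤ ENNReal.ofReal 16 * ∫⁻ ω, ENNReal.ofReal ((η - ξ) ω ^ 2) ∂m +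
        ENNReal.ofReal (1 / 64) * ∫⁻ ω, ENNReal.ofReal ((η + ξ) ω ^ 2) ∂m := by
        gcongr <;> exact Measure.restrict_le_self
    _ = ENNReal.ofReal (16 * ‖η - ξ‖ ^ 2 + 1 / 64 * ‖η + ξ‖ ^ 2) := by
        rw [lintegral_ofReal_sq_eq, lintegral_ofReal_sq_eq, ← ENNReal.ofReal_mul (by norm_num),
          ← ENNReal.ofReal_mul (by norm_num), ← ENNReal.ofReal_add (by positivity) (by positivity)]
    _ ≤ ENNReal.ofReal (1 / 8) := by
        refine ENNReal.ofReal_le_ofReal ?_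
        have h2 : ‖η + ξ‖ ≤ 2 := (norm_add_le _ _).trans (by rw [hξ, hη]; norm_num)
        nlinarith [norm_nonneg (η - ξ), norm_nonneg (η + ξ)]
    _ = 1 / 8 := by
        rw [one_div, one_div, ENNReal.ofReal_inv_of_pos (by norm_num)]
        norm_num

section Action

variable {G : Type v} [Group G] [TopologicalSpace G]

theorem map_act_sqMeasure (σ : NonsingularAction G X m) (g : G) {ξ : Lp ℝ 2 m} (h : ‖ξ‖ = 1) :
    (sqMeasure ξ).map (σ.act g) = sqMeasure (σ.koopmanIsometry g ξ) := by
  have := isProbabilityMeasure_sqMeasure h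
  have hac : (sqMeasure ξ).map (σ.act g) ≪ m :=
    ((sqMeasure_ac ξ).map (σ.measurable_act g)).trans (σ.map_act_ac g)
  have : IsProbabilityMeasure ((sqMeasure ξ).map (σ.act g)) :=
    Measure.isProbabilityMeasure_map (σ.measurable_act g).aemeasurable
  rw [← Measure.withDensity_rnDeriv_eq _ _ hac]
  refine withDensity_congr_ae ?_
  have h1 : (sqMeasure ξ).rnDeriv m =ᵐ[m] fun ω => ENNReal.ofReal (ξ ω ^ 2) :=
    Measure.rnDeriv_withDensity _ (measurable_ofReal_sq ξ)
  filter_upwards [σ.rnDeriv_map_act (sqMeasure_ac ξ) g, σ.koopmanIsometry_ae_eq g ξ,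
    Measure.rnDeriv_ne_top ((sqMeasure ξ).map (σ.act g)) m,
    (σ.quasiMeasurePreserving g⁻¹).ae_eq h1] with ω h2 h3 h4 h5
  simp only [Function.comp_apply] at h5
  rw [h5, ENNReal.toReal_ofReal (sq_nonneg _)] at h2
  rw [h3, ← ENNReal.ofReal_toReal h4, h2, pow_two (koopman σ g ξ ω), σ.koopman_mul_koopman]
  simp only [pow_two]

end Action

theorem sq_integral_abs_le {ν : Measure X} [IsProbabilityMeasure ν] {f : X → ℝ}
    (hf : MemLp f 2 ν) : (∫ x, |f x| ∂ν) ^ 2 ≤ ∫ x, f x ^ 2 ∂ν := by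
  have h := variance_nonneg |f| ν
  rw [variance_eq_sub hf.abs] at h
  simp only [Pi.pow_apply, Pi.abs_apply, sq_abs] at h
  linarith

variable {V : Type u} [NormedAddCommGroup V] [InnerProductSpace ℝ V]
  {P : Type w} [MetricSpace P] [NormedAddTorsor V P]
  {μ : P → Measure X} {o : P} {W : V → X → ℝ}

theorem linearCombination_coordVec_ae_eq (I : IsIsonormal m μ o W) (v : V) (c : P →₀ ℝ) :
    linearCombination ℝ (I.coordVec v) c =ᵐ[m] fun ω => W v ω *
      linearCombination ℝ I.sqrtVec c ω := by
  induction c using Finsupp.induction_linear with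
  | zero =>
    simp only [map_zero]
    filter_upwards [Lp.coeFn_zero ℝ 2 m] with ω h
    rw [h]; simp
  | add c c' h h' =>
    simp only [map_add]
    filter_upwards [Lp.coeFn_add (linearCombination ℝ (I.coordVec v) c)
        (linearCombination ℝ (I.coordVec v) c'),
      Lp.coeFn_add (linearCombination ℝ I.sqrtVec c)
        (linearCombination ℝ I.sqrtVec c'), h, h'] with ω h1 h2 h3 h4
    rw [h1, h2, Pi.add_apply, Pi.add_apply, h3, h4, mul_add]
  | single s a =>
    simp only [Finsupp.linearCombination_single]
    filter_upwards [Lp.coeFn_smul a (I.coordVec v s), Lp.coeFn_smul a (I.sqrtVec s),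
      I.coordVec_ae_eq v s] with ω h1 h2 h3
    rw [h1, h2, Pi.smul_apply, Pi.smul_apply, h3, smul_eq_mul, smul_eq_mul]
    ring

/-- For a general ξ in L² the coordinates need not be square-integrable against ξ² m. For a finite
combination of half-densities, W v · ξ is the same combination of the vectors `coordVec`, and the
resulting bound is linear in ‖v‖, as the Riesz representation of the barycentre requires. -/
theorem memLp_coord_sqMeasure (I : IsIsonormal m μ o W) (v : V) (c : P →₀ ℝ) :
    MemLp (W v) 2 (sqMeasure (linearCombination ℝ I.sqrtVec c)) ∧
      ∫ ω, W v ω ^ 2 ∂(sqMeasure (linearCombination ℝ I.sqrtVec c)) ≤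
        ((∑ x ∈ c.support, |c x| * (‖x -ᵥ o‖ + 1)) * ‖v‖) ^ 2 := by
  set ξ := linearCombination ℝ I.sqrtVec c
  set η := linearCombination ℝ (I.coordVec v) c with hη
  have hae : (fun ω => (ENNReal.ofReal (ξ ω ^ 2)).toReal • W v ω ^ 2) =ᵐ[m] fun ω => η ω ^ 2 := by
    filter_upwards [linearCombination_coordVec_ae_eq I v c] with ω hω
    rw [ENNReal.toReal_ofReal (sq_nonneg _), smul_eq_mul, hω]
    ring
  have hfin : ∀ᵐ ω ∂m, ENNReal.ofReal (ξ ω ^ 2) < ∞ := ae_of_all _ fun ω => ENNReal.ofReal_lt_top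
  constructor
  · rw [memLp_two_iff_integrable_sq (I.meas v).aestronglyMeasurable, sqMeasure,
      integrable_withDensity_iff_integrable_smul' (measurable_ofReal_sq ξ) hfin]
    exact ((memLp_two_iff_integrable_sq (Lp.aestronglyMeasurable η)).1 (Lp.memLp η)).congr hae.symm
  · rw [sqMeasure, integral_withDensity_eq_integral_toReal_smul (measurable_ofReal_sq ξ) hfin,
      integral_congr_ae hae, ← norm_sq_eq_integral_sq]
    refine pow_le_pow_left₀ (norm_nonneg _) ?_ 2
    rw [hη, Finsupp.linearCombination_apply, Finsupp.sum, Finset.sum_mul]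
    refine (norm_sum_le _ _).trans (Finset.sum_le_sum fun x _ => ?_)
    rw [norm_smul, Real.norm_eq_abs, mul_assoc]
    gcongr
    exact I.norm_coordVec_le v x

/-- The average of the coordinates over a set, as a point of the affine space. -/
theorem exists_barycenter [CompleteSpace V] (I : IsIsonormal m μ o W) {c : P →₀ ℝ}
    (hc : ‖linearCombination ℝ I.sqrtVec c‖ = 1) (A : Set X) :
    ∃ x : P, ∀ v, ((sqMeasure (linearCombination ℝ I.sqrtVec c)).real A)⁻¹ *
      ∫ ω in A, W v ω ∂(sqMeasure (linearCombination ℝ I.sqrtVec c)) = ⟪v, x -ᵥ o⟫ := by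
  set ν := sqMeasure (linearCombination ℝ I.sqrtVec c) with hν
  have := isProbabilityMeasure_sqMeasure hc
  have hint : ∀ v, Integrable (W v) ν := fun v =>
    (memLp_coord_sqMeasure I v c).1.integrable (by norm_num)
  set M := ∑ x ∈ c.support, |c x| * (‖x -ᵥ o‖ + 1) with hM
  have hM0 : 0 ≤ M := Finset.sum_nonneg fun x _ => by positivity
  set Φ : V →L[ℝ] ℝ := LinearMap.mkContinuous
    { toFun := fun v => (ν.real A)⁻¹ * ∫ ω in A, W v ω ∂ν
      map_add' := fun v w => by
        rw [integral_congr_ae (ae_restrict_of_ae ((sqMeasure_ac _).ae_eq (I.add v w))),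
          integral_add (hint v).integrableOn (hint w).integrableOn, mul_add]
      map_smul' := fun a v => by
        rw [integral_congr_ae (ae_restrict_of_ae ((sqMeasure_ac _).ae_eq (I.smul a v))),
          integral_const_mul, RingHom.id_apply, smul_eq_mul, mul_left_comm] }
    ((ν.real A)⁻¹ * M) (fun v => by
      rw [LinearMap.coe_mk, AddHom.coe_mk, norm_mul, mul_assoc, Real.norm_of_nonneg (by positivity)]
      gcongr
      refine (norm_integral_le_integral_norm _).trans
        ((setIntegral_le_integral (hint v).norm (ae_of_all _ fun ω => norm_nonneg _)).trans ?_)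
      refine le_of_sq_le_sq ?_ (by positivity)
      obtain ⟨h1, h2⟩ := memLp_coord_sqMeasure I v c
      exact (sq_integral_abs_le h1).trans h2) with hΦ
  refine ⟨(InnerProductSpace.toDual ℝ V).symm Φ +ᵥ o, fun v => ?_⟩
  rw [vadd_vsub, real_inner_comm, InnerProductSpace.toDual_symm_apply]
  rfl

end Barycenter

/-! ### Invariant means and stable spectral gap -/

section NoMean

open Finsupp (linearCombination)

variable {V : Type u} [NormedAddCommGroup V] [InnerProductSpace ℝ V]
  {P : Type w} [MetricSpace P] [NormedAddTorsor V P] {X : Type z} [MeasurableSpace X]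
  {m : Measure X} [SigmaFinite m] {μ : P → Measure X} {o : P} {W : V → X → ℝ}
  {G : Type v} [Group G] [TopologicalSpace G] {α : G →* (P ≃ᵃⁱ[ℝ] P)}
  {σ : NonsingularAction G X m}

section Pair

variable {H : Type*} [NormedAddCommGroup H] [InnerProductSpace ℝ H] {U : P → P → H}

theorem linearCombination_offDiagPart (U : P → P → H) (c : P × P →₀ ℝ) :
    linearCombination ℝ (offDiagPart U) c =
      linearCombination ℝ (fun s => U s.1 s.2) c - linearCombination ℝ (diagPart U) c := by
  simp only [Finsupp.linearCombination_apply, offDiagPart, smul_sub, Finsupp.sum_sub]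

theorem IsGaussianPair.inner_linearCombination (hU : IsGaussianPair U) (c c' : P × P →₀ ℝ) :
    ⟪linearCombination ℝ (offDiagPart U) c, linearCombination ℝ (diagPart U) c'⟫ = 0 := by
  simp [Finsupp.linearCombination_apply, Finsupp.sum_inner, Finsupp.inner_sum, inner_smul_left,
    inner_smul_right, hU.inner_offDiagPart_diagPart]

theorem IsGaussianPair.norm_sq_eq_add (hU : IsGaussianPair U) (c : P × P →₀ ℝ) :
    ‖linearCombination ℝ (fun s => U s.1 s.2) c‖ ^ 2 =
      ‖linearCombination ℝ (offDiagPart U) c‖ ^ 2 + ‖linearCombination ℝ (diagPart U) c‖ ^ 2 := by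
  have h : linearCombination ℝ (fun s => U s.1 s.2) c =
      linearCombination ℝ (offDiagPart U) c + linearCombination ℝ (diagPart U) c := by
    rw [linearCombination_offDiagPart, sub_add_cancel]
  rw [h, norm_add_sq_real, hU.inner_linearCombination]
  ring

end Pair

/-- Under ν = ξ² m every coordinate is concentrated around its value at one point x, because ξ ⊗ ξ
is nearly diagonal and on diagonal vectors differences of coordinates have mean square 2‖v‖². Moving
by g transports this picture to g x, while almost invariance says that ν barely changes; testing the
direction x - g x bounds its length. -/
theorem exists_dist_le_of_norm_koopman_sub_le [CompleteSpace V] (I : IsIsonormal m μ o W)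
    (hσ : IsGaussianAction μ α σ) {c : P →₀ ℝ} (hc : ‖linearCombination ℝ I.sqrtVec c‖ = 1)
    {K : Set G} (hK : ∀ g ∈ K, ‖σ.koopmanIsometry g (linearCombination ℝ I.sqrtVec c) -
      linearCombination ℝ I.sqrtVec c‖ ≤ 1 / 16) {c₂ : P × P →₀ ℝ}
    (hc₂ : linearCombination ℝ (fun s => I.pairVec s.1 s.2) c₂ =
      mulProd (linearCombination ℝ I.sqrtVec c) (linearCombination ℝ I.sqrtVec c))
    (hoff : ‖linearCombination ℝ (offDiagPart I.pairVec) c₂‖ ≤ 1 / 16) :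
    ∃ x : P, ∀ g ∈ K, dist (α g x) x ≤ 64 := by
  set ξ := linearCombination ℝ I.sqrtVec c with hξ
  set e := linearCombination ℝ (diagPart I.pairVec) c₂ with he
  set a := linearCombination ℝ (offDiagPart I.pairVec) c₂ with ha
  have hU := I.isGaussianPair_pairVec
  have he1 : ‖e‖ ^ 2 ≤ 1 := by
    have h1 := hU.norm_sq_eq_add c₂
    rw [hc₂, norm_mulProd, hc] at h1
    nlinarith [sq_nonneg ‖a‖]
  have hae : ∀ᵐ ω ∂(m.prod m), ξ ω.1 * ξ ω.2 = a ω + e ω := by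
    have h1 : mulProd ξ ξ = a + e := by
      rw [ha, linearCombination_offDiagPart, hc₂, sub_add_cancel]
    filter_upwards [mulProd_ae_eq ξ ξ, Lp.coeFn_add a e] with ω h2 h3
    rw [← h2, h1, h3, Pi.add_apply]
  set ν := sqMeasure ξ with hν
  have hprob : IsProbabilityMeasure ν := isProbabilityMeasure_sqMeasure hc
  have hξm := (Lp.stronglyMeasurable ξ).measurable
  have hem := (Lp.stronglyMeasurable e).measurable
  set D : X × X → ℝ≥0∞ := fun ω => ENNReal.ofReal ((ξ ω.1 * ξ ω.2) ^ 2) with hD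
  have hDm : Measurable D := by simp only [hD]; fun_prop
  have hνν : ν.prod ν = (m.prod m).withDensity D := by
    rw [hν, sqMeasure, prod_withDensity (measurable_ofReal_sq ξ) (measurable_ofReal_sq ξ)]
    congr 1
    ext ω
    simp only [hD]
    rw [← ENNReal.ofReal_mul (sq_nonneg _), mul_pow]
  -- The pairs where the diagonal part `e` dominates. Outside Γ the product ξ ⊗ ξ is at most 2|a|,
  -- so the complement has measure at most 4‖a‖² ≤ 1/64; inside, ξ ⊗ ξ may be replaced by 2e.
  set Γ : Set (X × X) := {ω | |ξ ω.1 * ξ ω.2| ≤ 2 * |e ω|} with hΓ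
  have hΓm : MeasurableSet Γ := measurableSet_le (by fun_prop) (by fun_prop)
  have hbad : (ν.prod ν) Γᶜ ≤ 1 / 64 := by
    rw [hνν, withDensity_apply _ hΓm.compl]
    calc ∫⁻ ω in Γᶜ, D ω ∂(m.prod m)
        ≤ ∫⁻ ω in Γᶜ, ENNReal.ofReal 4 * ENNReal.ofReal (a ω ^ 2) ∂(m.prod m) := by
          refine lintegral_mono_ae ((ae_restrict_iff' hΓm.compl).2 ?_)
          filter_upwards [hae] with ω h1 h2
          rw [← ENNReal.ofReal_mul (by norm_num)]
          refine ENNReal.ofReal_le_ofReal ?_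
          have h3 : 2 * |e ω| < |ξ ω.1 * ξ ω.2| := by simpa [hΓ] using h2
          have h4 : |ξ ω.1 * ξ ω.2| ≤ |a ω| + |e ω| := by rw [h1]; exact abs_add_le _ _
          rw [← sq_abs, ← sq_abs (a ω)]
          nlinarith [abs_nonneg (ξ ω.1 * ξ ω.2), abs_nonneg (a ω)]
      _ ≤ ∫⁻ ω, ENNReal.ofReal 4 * ENNReal.ofReal (a ω ^ 2) ∂(m.prod m) :=
          setLIntegral_le_lintegral _ _
      _ = ENNReal.ofReal (4 * ‖a‖ ^ 2) := by
          rw [lintegral_const_mul _ (measurable_ofReal_sq a), lintegral_ofReal_sq_eq,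
            ENNReal.ofReal_mul (by norm_num)]
      _ ≤ ENNReal.ofReal (1 / 64) := by
          refine ENNReal.ofReal_le_ofReal ?_
          nlinarith [norm_nonneg a]
      _ = 1 / 64 := by
          rw [one_div, one_div, ENNReal.ofReal_inv_of_pos (by norm_num)]
          norm_num
  have hgood : ∀ v, ∫⁻ ω in Γ, ENNReal.ofReal ((W v ω.1 - W v ω.2) ^ 2) ∂(ν.prod ν) ≤
      ENNReal.ofReal (8 * ‖v‖ ^ 2) := fun v => by
    have hWm := I.meas v
    have hm1 : Measurable fun ω : X × X => ENNReal.ofReal ((W v ω.1 - W v ω.2) ^ 2) := by fun_prop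
    rw [hνν, setLIntegral_withDensity_eq_setLIntegral_mul _ hDm hm1 hΓm]
    calc ∫⁻ ω in Γ, (D * fun ω : X × X => ENNReal.ofReal ((W v ω.1 - W v ω.2) ^ 2)) ω ∂(m.prod m)
        ≤ ∫⁻ ω in Γ, ENNReal.ofReal 4 * ENNReal.ofReal (((W v ω.1 - W v ω.2) * e ω) ^ 2)
            ∂(m.prod m) := by
          refine setLIntegral_mono' hΓm fun ω hω => ?_
          rw [Pi.mul_apply, hD, ← ENNReal.ofReal_mul (sq_nonneg _),
            ← ENNReal.ofReal_mul (by norm_num)]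
          refine ENNReal.ofReal_le_ofReal ?_
          have h1 : (ξ ω.1 * ξ ω.2) ^ 2 ≤ 4 * e ω ^ 2 := by
            have h2 : |ξ ω.1 * ξ ω.2| ≤ 2 * |e ω| := hω
            rw [← sq_abs, ← sq_abs (e ω)]
            nlinarith [abs_nonneg (ξ ω.1 * ξ ω.2), abs_nonneg (e ω)]
          have h3 := mul_le_mul_of_nonneg_right h1 (sq_nonneg (W v ω.1 - W v ω.2))
          linarith
      _ ≤ ∫⁻ ω, ENNReal.ofReal 4 * ENNReal.ofReal (((W v ω.1 - W v ω.2) * e ω) ^ 2)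
            ∂(m.prod m) := setLIntegral_le_lintegral _ _
      _ = ENNReal.ofReal (4 * (2 * ‖v‖ ^ 2 * ‖e‖ ^ 2)) := by
          rw [lintegral_const_mul _ (by fun_prop), I.lintegral_sq_mul_diagPart, ← he,
            ← ENNReal.ofReal_mul (by norm_num)]
      _ ≤ ENNReal.ofReal (8 * ‖v‖ ^ 2) := by
          refine ENNReal.ofReal_le_ofReal ?_
          nlinarith [sq_nonneg ‖v‖]
  obtain ⟨A, hA, hAc, hAv⟩ := exists_set_lintegral_sq_sub_le hΓm hbad
  obtain ⟨x, hx⟩ := exists_barycenter I hc A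
  -- The mean square over A × A is at most 8 · 8‖v‖² = 64‖v‖², which is R²/16 for R = 32‖v‖. This
  -- fixes the constants 32 and 64.
  have hconc : ∀ v, v ≠ 0 → ν {ω | 32 * ‖v‖ < |W v ω - ⟪v, x -ᵥ o⟫|} ≤ 1 / 8 := fun v hv => by
    have hv0 : 0 < ‖v‖ := norm_pos_iff.2 hv
    rw [← hx v]
    refine measure_lt_abs_sub_average_le hA hAc (I.meas v) (memLp_coord_sqMeasure I v c).1
      (by positivity) ((hAv (W v) (I.meas v) _ (hgood v)).trans (le_of_eq ?_))
    rw [← ENNReal.ofReal_ofNat, ← ENNReal.ofReal_mul (by norm_num)]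
    congr 1
    ring
  refine ⟨x, fun g hg => ?_⟩
  set L := (α g).linearIsometryEquiv with hL
  set v := x -ᵥ α g x with hv
  rw [dist_comm, dist_eq_norm_vsub V, ← hv]
  rcases eq_or_ne v 0 with hv0 | hv0
  · rw [hv0, norm_zero]; norm_num
  have hw0 : L.symm v ≠ 0 := by simpa using hv0
  have hcomp := I.coord_comp_ae_eq (σ.measurable_act g) (hσ g) v
  have hη1 : ‖σ.koopmanIsometry g ξ‖ = 1 := by rw [LinearIsometry.norm_map, hc]
  set B := {ω | 32 * ‖v‖ < |W v ω - ⟪v, x -ᵥ o⟫|} with hB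
  have hBm : MeasurableSet B := by
    have := I.meas v
    exact measurableSet_lt (by fun_prop) (by fun_prop)
  have h1 : ν (σ.act g ⁻¹' B) ≤ 1 / 8 + 1 / 8 := by
    rw [← Measure.map_apply (σ.measurable_act g) hBm, hν, map_act_sqMeasure σ g hc]
    exact (sqMeasure_le_add hc hη1 (hK g hg) hBm).trans (by gcongr; exact hconc v hv0)
  have h2 := hconc (L.symm v) hw0
  -- The exceptional sets have ν-measure at most 1/4, at most 1/8, and zero, so some ω avoids them
  -- all.
  obtain ⟨ω, hω1, hω2, hω3⟩ : ∃ ω, ω ∉ σ.act g ⁻¹' B ∧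
      ω ∉ {ω | 32 * ‖L.symm v‖ < |W (L.symm v) ω - ⟪L.symm v, x -ᵥ o⟫|} ∧
      W v (σ.act g ω) = W (L.symm v) ω + ⟪v, α g o -ᵥ o⟫ := by
    by_contra hne
    push Not at hne
    have h3 : ν {ω | ¬ (W v (σ.act g ω) = W (L.symm v) ω + ⟪v, α g o -ᵥ o⟫)} = 0 :=
      (sqMeasure_ac ξ).ae_eq hcomp
    have h4 : (Set.univ : Set X) ⊆ (σ.act g ⁻¹' B ∪
        {ω | 32 * ‖L.symm v‖ < |W (L.symm v) ω - ⟪L.symm v, x -ᵥ o⟫|}) ∪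
        {ω | ¬ (W v (σ.act g ω) = W (L.symm v) ω + ⟪v, α g o -ᵥ o⟫)} := by
      intro ω _
      by_cases h5 : ω ∈ σ.act g ⁻¹' B
      · exact Or.inl (Or.inl h5)
      · by_cases h6 : ω ∈ {ω | 32 * ‖L.symm v‖ < |W (L.symm v) ω - ⟪L.symm v, x -ᵥ o⟫|}
        · exact Or.inl (Or.inr h6)
        · exact Or.inr (hne ω h5 h6)
    have h5 : (1 : ℝ≥0∞) ≤ 1 / 8 + 1 / 8 + 1 / 8 + 0 := by
      refine measure_univ (μ := ν).symm.le.trans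
        ((measure_mono h4).trans ((measure_union_le _ _).trans ?_))
      rw [h3]
      gcongr
      exact (measure_union_le _ _).trans (add_le_add h1 h2)
    have h6 := ENNReal.toReal_mono (by finiteness) h5
    rw [add_zero, ENNReal.toReal_add (by finiteness) (by finiteness),
      ENNReal.toReal_add (by finiteness) (by finiteness)] at h6
    norm_num at h6
  have h3 : |W v (σ.act g ω) - ⟪v, x -ᵥ o⟫| ≤ 32 * ‖v‖ := by simpa [hB] using hω1
  have h4 : |W (L.symm v) ω - ⟪L.symm v, x -ᵥ o⟫| ≤ 32 * ‖v‖ := by simpa using hω2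
  have h5 : ⟪L.symm v, x -ᵥ o⟫ = ⟪v, α g x -ᵥ α g o⟫ := by
    rw [← (α g).map_vsub, ← hL, ← L.inner_map_map, LinearIsometryEquiv.apply_symm_apply]
  -- At the chosen ω the two estimates concern the same random value up to known constants, and the
  -- difference of their centres is ⟪v, x - g x⟫ = ‖v‖². Hence ‖v‖² ≤ 64‖v‖.
  have h6 : ⟪v, x -ᵥ o⟫ - ⟪v, α g x -ᵥ α g o⟫ - ⟪v, α g o -ᵥ o⟫ = ‖v‖ ^ 2 := by
    rw [← inner_sub_right, ← inner_sub_right, ← real_inner_self_eq_norm_sq]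
    congr 1
    rw [sub_sub, vsub_add_vsub_cancel, vsub_sub_vsub_cancel_right]
  rw [hω3] at h3
  rw [h5] at h4
  have h7 : ‖v‖ ^ 2 ≤ 64 * ‖v‖ := by
    rw [abs_le] at h3 h4
    linarith [h3.1, h4.2]
  have hv1 : 0 < ‖v‖ := norm_pos_iff.2 hv0
  nlinarith

end NoMean

/-! ### The absence of invariant means -/

section Spectral

open Finsupp (linearCombination)

variable {V : Type u} [NormedAddCommGroup V] [InnerProductSpace ℝ V]
  {P : Type w} [MetricSpace P] [NormedAddTorsor V P] {X : Type z} [MeasurableSpace X]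
  {m : Measure X} [SigmaFinite m] {μ : P → Measure X} {o : P} {W : V → X → ℝ}
  {G : Type v} [Group G] [TopologicalSpace G] {α : G →* (P ≃ᵃⁱ[ℝ] P)}
  {σ : NonsingularAction G X m}

theorem IsGaussianPair.norm_offDiagPart_le {H : Type*} [NormedAddCommGroup H]
    [InnerProductSpace ℝ H] {U : P → P → H} (hU : IsGaussianPair U) (c : P × P →₀ ℝ) :
    ‖linearCombination ℝ (offDiagPart U) c‖ ≤ ‖linearCombination ℝ (fun s => U s.1 s.2) c‖ := by
  refine le_of_sq_le_sq ?_ (norm_nonneg _)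
  rw [hU.norm_sq_eq_add]
  exact le_add_of_nonneg_right (sq_nonneg _)

/-- The coefficients are the products c x · c y. They do not depend on the family f, so the same
ones serve the half-densities and their translates by g. -/
theorem exists_linearCombination_eq_mulProd {ι : Type*} (m : Measure X) [SigmaFinite m]
    (c : ι →₀ ℝ) :
    ∃ c₂ : ι × ι →₀ ℝ, ∀ f : ι → Lp ℝ 2 m,
      linearCombination ℝ (fun s => mulProd (f s.1) (f s.2)) c₂ =
        mulProd (linearCombination ℝ f c) (linearCombination ℝ f c) := by
  refine ⟨c.sum fun x a => c.sum fun y b => Finsupp.single (x, y) (a * b), fun f => ?_⟩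
  have h : ∀ g : Lp ℝ 2 m, mulProd (linearCombination ℝ f c) g =
      c.sum fun x a => a • mulProd (f x) g := fun g => by
    rw [Finsupp.linearCombination_apply, Finsupp.sum, map_sum, LinearMap.sum_apply, Finsupp.sum]
    simp only [map_smul, LinearMap.smul_apply]
  rw [h]
  simp only [map_finsuppSum, Finsupp.linearCombination_single]
  simp only [Finsupp.linearCombination_apply, map_finsuppSum, map_smul, mul_smul,
    Finsupp.smul_sum]

theorem IsGaussianAction.koopmanIsometry_linearCombination (hσ : IsGaussianAction μ α σ)
    (I : IsIsonormal m μ o W) (g : G) (c : P →₀ ℝ) :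
    σ.koopmanIsometry g (linearCombination ℝ I.sqrtVec c) =
      linearCombination ℝ (fun x => I.sqrtVec (α g x)) c := by
  simp only [Finsupp.linearCombination_apply, map_finsuppSum, map_smul]
  congr 1
  ext x a : 2
  rw [IsIsonormal.sqrtVec, koopmanIsometry_sqrtDensity I hσ]
  rfl

/-- Half-densities are total, so ξ is approximated within δ by a finite combination, whose
displacement is at most 3δ. Its norm is at least 1/2, so normalising costs a factor 2. -/
theorem exists_linearCombination_norm_koopman_sub_le (I : IsIsonormal m μ o W)
    {ξ : Lp ℝ 2 m} (hξ : ‖ξ‖ = 1) {K : Set G} {δ : ℝ} (hδ : 0 < δ) (hδ' : δ ≤ 1 / 2)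
    (hK : ∀ g ∈ K, ‖σ.koopmanIsometry g ξ - ξ‖ ≤ δ) :
    ∃ c : P →₀ ℝ, ‖linearCombination ℝ I.sqrtVec c‖ = 1 ∧
      ∀ g ∈ K, ‖σ.koopmanIsometry g (linearCombination ℝ I.sqrtVec c) -
        linearCombination ℝ I.sqrtVec c‖ ≤ 6 * δ := by
  obtain ⟨c, hc⟩ := exists_finsupp_norm_toLp_sub_lt I.memLp_sqrtDensity
    I.topologicalClosure_span_sqrtDensity ξ hδ
  set η := linearCombination ℝ I.sqrtVec c with hη
  have hc' : ‖ξ - η‖ < δ := hc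
  have h1 : 1 / 2 ≤ ‖η‖ := by
    have := norm_sub_norm_le ξ η
    linarith
  have h0 : 0 < ‖η‖ := by linarith
  refine ⟨‖η‖⁻¹ • c, ?_, fun g hg => ?_⟩
  · rw [map_smul, ← hη, norm_smul, norm_inv, norm_norm, inv_mul_cancel₀ h0.ne']
  · rw [map_smul, ← hη, map_smul, ← smul_sub, norm_smul, norm_inv, norm_norm]
    have h2 : ‖σ.koopmanIsometry g η - η‖ ≤ 3 * δ := by
      have h3 : σ.koopmanIsometry g η - η = (ξ - η) + (σ.koopmanIsometry g ξ - ξ) -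
          σ.koopmanIsometry g (ξ - η) := by
        rw [map_sub]; abel
      rw [h3]
      have h4 := norm_sub_le ((ξ - η) + (σ.koopmanIsometry g ξ - ξ)) (σ.koopmanIsometry g (ξ - η))
      have h5 := norm_add_le (ξ - η) (σ.koopmanIsometry g ξ - ξ)
      rw [LinearIsometry.norm_map] at h4
      linarith [hK g hg]
    rw [inv_mul_le_iff₀ h0]
    nlinarith

/-- Taking off-diagonal parts does not increase norms and commutes with the action, so the
displacement is controlled by that of ξ ⊗ ξ. -/
theorem IsIsonormal.norm_offDiagPart_sub_le (I : IsIsonormal m μ o W)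
    (hσ : IsGaussianAction μ α σ) {c : P →₀ ℝ} {c₂ : P × P →₀ ℝ}
    (hc₂ : ∀ f : P → Lp ℝ 2 m, linearCombination ℝ (fun s => mulProd (f s.1) (f s.2)) c₂ =
      mulProd (linearCombination ℝ f c) (linearCombination ℝ f c)) (g : G) :
    ‖linearCombination ℝ (fun s => offDiagPart I.pairVec (α g s.1, α g s.2)) c₂ -
        linearCombination ℝ (offDiagPart I.pairVec) c₂‖ ≤
      2 * ‖linearCombination ℝ I.sqrtVec c‖ *
        ‖σ.koopmanIsometry g (linearCombination ℝ I.sqrtVec c) -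
          linearCombination ℝ I.sqrtVec c‖ := by
  have h := I.isGaussianPair_pairVec.norm_offDiagPart_le
    (Finsupp.mapDomain (fun s : P × P => (α g s.1, α g s.2)) c₂ - c₂)
  rw [map_sub, map_sub, Finsupp.linearCombination_mapDomain,
    Finsupp.linearCombination_mapDomain] at h
  have h1 : linearCombination ℝ ((fun s : P × P => I.pairVec s.1 s.2) ∘
      fun s : P × P => (α g s.1, α g s.2)) c₂ =
        mulProd (σ.koopmanIsometry g (linearCombination ℝ I.sqrtVec c))
          (σ.koopmanIsometry g (linearCombination ℝ I.sqrtVec c)) := by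
    rw [hσ.koopmanIsometry_linearCombination I]
    exact hc₂ fun x => I.sqrtVec (α g x)
  have h2 : linearCombination ℝ (fun s : P × P => I.pairVec s.1 s.2) c₂ =
      mulProd (linearCombination ℝ I.sqrtVec c) (linearCombination ℝ I.sqrtVec c) :=
    hc₂ I.sqrtVec
  rw [h1, h2] at h
  refine h.trans ((norm_mulProd_sub_le _ _).trans (le_of_eq ?_))
  rw [LinearIsometry.norm_map]
  ring

theorem exists_dist_le_of_hasInvariantMean [CompleteSpace V]
    [TopologicalSpace.SeparableSpace V] [IsTopologicalGroup G] [LocallyCompactSpace G]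
    [SecondCountableTopology G] [IsProbabilityMeasure m] (I : IsIsonormal m μ o W)
    (hα : ∀ x : P, Continuous fun g => α g x) (hσ : IsGaussianAction μ α σ)
    (hgap : HasStableSpectralGap (linearPart α)) (hmean : HasInvariantMean σ)
    {K : Set G} (hK : IsCompact K) :
    ∃ x : P, ∀ g ∈ K, dist (α g x) x ≤ 64 := by
  obtain ⟨K₀, hK₀, ε, hε, hgap₀⟩ :=
    I.isGaussianPair_pairVec.exists_le_norm_offDiagPart_sub hα hgap
  -- After normalisation displacements are at most 6δ. This must not exceed 1/16, and 2 · 6δ ≤ ε/16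
  -- makes the off-diagonal part at most 1/16 through the gap constant ε.
  set δ : ℝ := min (1 / 96) (ε / 192) with hδ
  have hδ0 : 0 < δ := by positivity
  have hδ1 : δ ≤ 1 / 96 := min_le_left _ _
  have hδ2 : δ ≤ ε / 192 := min_le_right _ _
  obtain ⟨ξ, hξ, hξK⟩ := exists_norm_koopman_sub_le hmean (hK.union hK₀) hδ0
  obtain ⟨c, hc, hcK⟩ :=
    exists_linearCombination_norm_koopman_sub_le I hξ hδ0 (by linarith) hξK
  obtain ⟨c₂, hc₂⟩ := exists_linearCombination_eq_mulProd m c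
  refine exists_dist_le_of_norm_koopman_sub_le I hσ hc
    (fun g hg => (hcK g (Or.inl hg)).trans (by linarith)) (hc₂ I.sqrtVec) ?_
  obtain ⟨g, hg, h⟩ := hgap₀ c₂
  have h1 := h.trans (I.norm_offDiagPart_sub_le hσ hc₂ g)
  rw [hc] at h1
  have h2 := hcK g (Or.inr hg)
  have h3 : ε * ‖linearCombination ℝ (offDiagPart I.pairVec) c₂‖ ≤ ε * (1 / 16) := by linarith
  exact le_of_mul_le_mul_left h3 hε

/-- Two points moved by at most C by the gap set `K` differ by a vector moved by at most 2C, hence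
lie within 2C/ε of each other. For each g compare x with a point moved by at most C by `K` and by g.
Since C does not depend on the compact set, the orbit of x is bounded. -/
theorem hasFixedPoint_of_exists_dist_le [CompleteSpace V] {C : ℝ}
    (hgap : HasStableSpectralGap (linearPart α))
    (h : ∀ K : Set G, IsCompact K → ∃ x : P, ∀ g ∈ K, dist (α g x) x ≤ C) :
    HasFixedPoint α := by
  obtain ⟨K, hK, ε, hε, hv⟩ := hgap.exists_le_norm_sub
  obtain ⟨x, hx⟩ := h K hK
  refine hasFixedPoint_of_bounded_orbit α x (C + 2 * (2 * C / ε)) fun g => ?_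
  obtain ⟨y, hy⟩ := h (K ∪ {g}) (hK.union isCompact_singleton)
  obtain ⟨k, hk, hkv⟩ := hv (y -ᵥ x)
  have h1 : ‖linearPart α k (y -ᵥ x) - (y -ᵥ x)‖ ≤ 2 * C := by
    have h2 : linearPart α k (y -ᵥ x) - (y -ᵥ x) = (α k y -ᵥ y) - (α k x -ᵥ x) := by
      have h3 : linearPart α k (y -ᵥ x) = α k y -ᵥ α k x := (α k).map_vsub y x
      rw [h3, vsub_sub_vsub_comm]
    rw [h2]
    refine (norm_sub_le _ _).trans ?_
    rw [← dist_eq_norm_vsub, ← dist_eq_norm_vsub]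
    linarith [hx k hk, hy k (Or.inl hk)]
  have h2 : dist y x ≤ 2 * C / ε := by
    rw [le_div_iff₀ hε, dist_eq_norm_vsub V, mul_comm]
    exact hkv.trans h1
  have h3 := dist_triangle4 (α g x) (α g y) y x
  rw [AffineIsometryEquiv.dist_map, dist_comm x y] at h3
  linarith [hy g (Or.inr rfl)]

omit [SigmaFinite m] in
theorem hasFixedPoint_of_hasInvariantMean [CompleteSpace V]
    [TopologicalSpace.SeparableSpace V] [IsTopologicalGroup G] [LocallyCompactSpace G]
    [SecondCountableTopology G] (I : IsIsonormal m μ o W)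
    (hα : ∀ x : P, Continuous fun g => α g x) (hσ : IsGaussianAction μ α σ)
    (hgap : HasStableSpectralGap (linearPart α)) (hmean : HasInvariantMean σ) :
    HasFixedPoint α := by
  have := I.prob o
  -- The preceding results need a probability measure, so m is replaced by the equivalent measure `μ
  -- o`.
  have Io := I.congr_measure (I.ac o) (I.ac' o)
  have hσo : IsGaussianAction μ α (σ.congrMeasure (I.ac o) (I.ac' o)) := hσ
  exact hasFixedPoint_of_exists_dist_le hgap fun K hK =>
    exists_dist_le_of_hasInvariantMean Io hα hσo hgap
      (HasInvariantMean.congrMeasure hmean (I.ac o) (I.ac' o)) hK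

end Spectral

end GaussianDictionary

end

/-! ### The four assertions assembled -/

theorem mainTheorem7
    {G : Type v} [Group G] [TopologicalSpace G] [IsTopologicalGroup G] [T2Space G]
    [LocallyCompactSpace G] [SecondCountableTopology G]
    {V : Type u} [NormedAddCommGroup V] [InnerProductSpace ℝ V] [CompleteSpace V]
    [TopologicalSpace.SeparableSpace V]
    {P : Type w} [MetricSpace P] [NormedAddTorsor V P]
    (α : G →* (P ≃ᵃⁱ[ℝ] P)) (hα : ∀ x : P, Continuous fun g => α g x) :
    -- a Gaussian density with its Gaussian action exists
    (∃ (X : Type u) (_ : MeasurableSpace X) (_ : StandardBorelSpace X) (m : Measure X)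
        (_ : SigmaFinite m) (μ : P → Measure X) (σ : GaussianDictionary.NonsingularAction G X m),
        GaussianDictionary.IsGaussianDensity m μ ∧ GaussianDictionary.IsGaussianAction μ α σ) ∧
    -- and each of them has the following properties
    ∀ (X : Type z) [MeasurableSpace X] [StandardBorelSpace X] (m : Measure X) [SigmaFinite m]
      (μ : P → Measure X) (σ : GaussianDictionary.NonsingularAction G X m),
      GaussianDictionary.IsGaussianDensity m μ → GaussianDictionary.IsGaussianAction μ α σ →
      (GaussianDictionary.HasInvariantProbability σ ↔ GaussianDictionary.HasFixedPoint α) ∧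
      (GaussianDictionary.IsZeroType σ ↔ GaussianDictionary.IsProperAction α) ∧
      (GaussianDictionary.HasAlmostFixedPoints α →
        GaussianDictionary.HasAlmostVanishingEntropy σ ∧ GaussianDictionary.HasInvariantMean σ) ∧
      (GaussianDictionary.HasStableSpectralGap (GaussianDictionary.linearPart α) →
        ¬ GaussianDictionary.HasFixedPoint α → ¬ GaussianDictionary.HasInvariantMean σ) := by
  refine ⟨GaussianDictionary.exists_gaussianAction α hα, fun X _ _ m _ μ σ hd hσ => ?_⟩
  obtain ⟨o⟩ : Nonempty P := inferInstance
  obtain ⟨W, I⟩ := hd.exists_isIsonormal o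
  exact ⟨GaussianDictionary.hasInvariantProbability_iff I hσ,
    GaussianDictionary.isZeroType_iff I hσ,
    fun h => ⟨GaussianDictionary.hasAlmostVanishingEntropy_of_hasAlmostFixedPoints I hσ h,
      GaussianDictionary.hasInvariantMean_of_hasAlmostFixedPoints I hσ h⟩,
    fun hgap hfix hmean => hfix
      (GaussianDictionary.hasFixedPoint_of_hasInvariantMean I hα hσ hgap hmean)⟩
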